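/- Let $p$ be a prime and $K$ a finite extension of $\mathbb Q_p$ with the norm extending that of $\mathbb Q_p$; $K^m$ carries the maximum norm. **Smoothness classes.** For a clopen $\Omega\subseteq K^m$ and $f:\Omega\to K^r$ put $$\Phi^v f(x;h_1,\dots,h_v;\zeta_1,\dots,\zeta_v)=\frac{1}{\zeta_1\cdots\zeta_v}\sum_{S\subseteq\{1,\dots,v\}}(-1)^{v-|S|}f\Big(x+\sum_{i\in S}\zeta_ih_i\Big),$$ where $\zeta_i\in K\setminus\{0\}$, $h_i\in K^m$ and all points $x+\sum_{i\in S}\zeta_ih_i$ lie in $\Omega$. The function $f$ is of class $C^l$ if for all $v\le l$ the function $\Phi^vf$ extends continuously to all such $(x;h;\zeta)$ with arbitrary $\zeta_i\in K$. It is of class $C^{(t,s)}$ if the same holds for the partial difference quotients in which $h_1,\dots,h_v$ are coordinate vectors, the $j$-th of them occurring $s_j$ times, whenever $\sum_j\max(s_j-s,0)\le t$. **Antiderivation.** Fix a partition of $K$ into compact clopen sets $U$ (for example the balls of a given radius) and, on each $U$, an approximation of the identity: maps $\sigma_k:U\to U$ ($k\ge 0$) such that $\sigma_0$ is constant, $\sigma_k\circ\sigma_i=\sigma_i\circ\sigma_k=\sigma_i$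 for $k\ge i$, and for some $0<\rho<1$ one has $\sigma_k(x)=\sigma_k(y)$ whenever $|x-y|<\rho^k$, and $|\sigma_k(x)-x|<\rho^k$ for $k\ge1$. For $n\ge1$ put $$P^n_{x_j}h(x)=\sum_{k\ge0}\sum_{i=0}^{n-1}\frac{\partial^ih}{\partial x_j^i}(x_1,\dots,\sigma_k(x_j),\dots,x_m)\,\frac{(\sigma_{k+1}(x_j)-\sigma_k(x_j))^{i+1}}{(i+1)!}.$$ For $q\ge0$, $n\ge1$, a map $f$ on a clopen $\Omega\subseteq K^m$ is of class ${}_SC^{(q+1,n-1)}$ if it is of class $C^{(q+1,n-1)}$ and for each $j$ there are $h$ of class $C^{(q,n-1)}$ on $\Omega$ and a function $g$, not depending on $x_j$ as long as $x_j$ stays in one set $U$ of the partition, with $f=P^n_{x_j}(h\chi_\Omega)+g$ on $\Omega$. **Manifolds.** An ${}_SC^{(q+1,n-1)}$-manifold $M$ of dimension $m=m_M$ is a topological space with an atlas of homeomorphisms $\phi_i:V_i\to\phi_i(V_i)$ from clopen sets $V_i$ covering $M$ onto clopen subsets of $K^{m}$ such that $\phi_i\circ\phi_j^{-1}$ is of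 class ${}_SC^{(q+1,n-1)}$ on $\phi_j(V_i\cap V_j)$ for all $i\neq j$. A map $f:M\to N$ between such manifolds is a $C^l$-mapping if it is continuous and of class $C^l$ in all charts of the given atlases. For a $C^l$-mapping $f$ with $l\geq 1$ let $\mathcal E=\{z\in M:\ \operatorname{rank}(d_zf)<m_N\}$. Let $\nu$ be the Haar measure on $K^{m_N}$ with $\nu(B(0,1))=1$, where $B(0,1)$ is the closed unit ball. A disjoint refinement of the atlas of $N$ (a partition of $N$ into clopen sets $W_i$, each contained in the domain of a chart $\psi_i$) induces the Borel measure $\mu$ on $N$ with $\mu(S)=\sum_i\nu(\psi_i(S\cap W_i))$; a set is called $\mu$-null if it is contained in a Borel set of $\mu$-measure $0$. **Theorem.** Let $q\ge0$, $n\ge1$, let $M$ and $N$ be ${}_SC^{(q+1,n-1)}$-manifolds over $K$, $M$ second countable, and let $f:M\to N$ be a $C^l$-mapping with $l>\max(m_M,m_N)$. Then: 1. $\mu(f(\mathcal E))=0$ for every measure $\mu$ on $N$ induced as above by a disjoint refinement of its atlas; 2. $N\setminus f(\mathcal E)$ is dense in $N$; 3. if $m_M<m_N$, then $\mu(f(M))=0$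 for every such $\mu$. -/

import Mathlib

open MeasureTheory Set
open scoped Manifold

noncomputable section

namespace NASard

section DifferenceQuotients

variable {K : Type*} [NontriviallyNormedField K] {m : ℕ}
  {Y : Type*} [NormedAddCommGroup Y] [NormedSpace K Y]

/-- The point `x + ∑_{i ∈ S} ζ_i h_i` of `K^m`. -/
def vertex {v : ℕ} (x : Fin m → K) (h : Fin v → Fin m → K) (ζ : Fin v → K)
    (S : Finset (Fin v)) : Fin m → K :=
  x + ∑ i ∈ S, ζ i • h i

/-- The domain of the `v`-th difference quotient of a function on `Ω ⊆ K^m`, with directions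
`(h_1, …, h_v)` restricted to the set `H`: all `(x; h_1, …, h_v; ζ_1, …, ζ_v)` for which every
point `x + ∑_{i ∈ S} ζ_i h_i` lies in `Ω`. -/
def quotDomain {v : ℕ} (H : Set (Fin v → Fin m → K)) (Ω : Set (Fin m → K)) :
    Set ((Fin m → K) × (Fin v → Fin m → K) × (Fin v → K)) :=
  {w | w.2.1 ∈ H ∧ ∀ S : Finset (Fin v), vertex w.1 w.2.1 w.2.2 S ∈ Ω}

/-- The iterated difference quotient
`Φ^v f (x; h_1, …, h_v; ζ_1, …, ζ_v)`, where `Φ^0 f = f` and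
`Φ^{v+1} f (x; h_1, …, h_{v+1}; ζ_1, …, ζ_{v+1}) =
  (Φ^v f (x + ζ_{v+1} h_{v+1}; …) - Φ^v f (x; …)) / ζ_{v+1}`,
written out as an alternating sum. It is meaningful if all `ζ_i` are nonzero. -/
def diffQuot {v : ℕ} (f : (Fin m → K) → Y) (x : Fin m → K) (h : Fin v → Fin m → K)
    (ζ : Fin v → K) : Y :=
  (∏ i, ζ i)⁻¹ • ∑ S : Finset (Fin v), (-1 : K) ^ (v - S.card) • f (vertex x h ζ S)

/-- The `v`-th difference quotient of `f` on `Ω` with directions in `H` extends continuously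
to the points where some of the `ζ_i` vanish. -/
def HasContDiffQuot {v : ℕ} (H : Set (Fin v → Fin m → K)) (Ω : Set (Fin m → K))
    (f : (Fin m → K) → Y) : Prop :=
  ∃ Φ : (Fin m → K) × (Fin v → Fin m → K) × (Fin v → K) → Y,
    ContinuousOn Φ (quotDomain H Ω) ∧
    ∀ x h ζ, (x, h, ζ) ∈ quotDomain H Ω → (∀ i, ζ i ≠ 0) → Φ (x, h, ζ) = diffQuot f x h ζ

/-- `f` is of class `C^l` on `Ω` in the sense of difference quotients. -/
def IsC (l : ℕ) (Ω : Set (Fin m → K)) (f : (Fin m → K) → Y) : Prop :=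
  ∀ v ≤ l, HasContDiffQuot (v := v) univ Ω f

/-- `f` is of class `C^{(t,s)}` on `Ω`: the partial difference quotients, of order `s_j` in the
`j`-th coordinate, have continuous extensions whenever the orders `s_j` exceed `s` by at most `t`
in total, `∑_j max (s_j - s, 0) ≤ t`. The directions are the coordinate vectors `e_{c 1}, …, e_{c v}`,
and `s_j` is the number of times that `j` occurs among the `c i`. -/
def IsCPair (t s : ℕ) (Ω : Set (Fin m → K)) (f : (Fin m → K) → Y) : Prop :=
  ∀ (v : ℕ) (c : Fin v → Fin m),
    ∑ j, ((Finset.univ.filter fun i => c i = j).card - s) ≤ t →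
      HasContDiffQuot {fun i => Pi.single (c i) 1} Ω f

end DifferenceQuotients

section Antiderivation

variable {K : Type*} [NontriviallyNormedField K]

/-- `σ` is an approximation of the identity on `U ⊆ K`. (The bound on `‖σ_k x - x‖` is asked for
`k ≥ 1` only: for `k = 0` it would exclude the sets `U` of diameter at least one, such as the
unit ball.) -/
structure IsApproxId (σ : ℕ → K → K) (U : Set K) : Prop where
  mapsTo : ∀ k, MapsTo (σ k) U U
  const_zero : ∀ x ∈ U, ∀ y ∈ U, σ 0 x = σ 0 y
  comp_left : ∀ k i, i ≤ k → ∀ x ∈ U, σ k (σ i x) = σ i x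
  comp_right : ∀ k i, i ≤ k → ∀ x ∈ U, σ i (σ k x) = σ i x
  exists_rate : ∃ ρ : ℝ, 0 < ρ ∧ ρ < 1 ∧
    (∀ k, ∀ x ∈ U, ∀ y ∈ U, ‖x - y‖ < ρ ^ k → σ k x = σ k y) ∧
    (∀ k, 1 ≤ k → ∀ x ∈ U, ‖σ k x - x‖ < ρ ^ k)

variable (K) in
/-- A decomposition of `K` into disjoint compact clopen sets (for instance, the balls of a given
radius) with an approximation of the identity on each of them; `σ k` is defined on `K` piecewise. -/
structure ApproxSystem where
  pieces : Set (Set K)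
  isPartition : Setoid.IsPartition pieces
  isClopen : ∀ U ∈ pieces, IsClopen U
  isCompact : ∀ U ∈ pieces, IsCompact U
  σ : ℕ → K → K
  approx : ∀ U ∈ pieces, IsApproxId σ U

variable {m : ℕ} {Y : Type*} [NormedAddCommGroup Y] [NormedSpace K Y]

/-- The antiderivation `P^n_{x_j}` in the `j`-th coordinate: with `x_{j,k} = σ_k (x_j)`,
`P^n_{x_j} f (x) = ∑_{k ≥ 0} ∑_{i < n}
  (∂^i f / ∂ x_j^i)(…, x_{j,k}, …) (x_{j,k+1} - x_{j,k})^{i+1} / (i+1)!`. -/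
def antideriv (A : ApproxSystem K) (n : ℕ) (j : Fin m) (f : (Fin m → K) → Y)
    (x : Fin m → K) : Y :=
  ∑' k : ℕ, ∑ i ∈ Finset.range n,
    ((A.σ (k + 1) (x j) - A.σ k (x j)) ^ (i + 1) / ((i + 1).factorial : K)) •
      iteratedDeriv i (fun t : K => f (Function.update x j t)) (A.σ k (x j))

/-- `f` is of class `_S C^{(q+1,n-1)}` on the clopen set `Ω ⊆ K^m`: it is of class `C^{(q+1,n-1)}`
and, for each coordinate `x_j`, it is `P^n_{x_j} h` for some `h` of class `C^{(q,n-1)}` on `Ω`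
(extended by zero), up to a summand which does not depend on `x_j` as long as `x_j` stays in one
and the same piece of `K`. -/
def IsSC (A : ApproxSystem K) (q n : ℕ) (Ω : Set (Fin m → K)) (f : (Fin m → K) → Y) : Prop :=
  IsCPair (q + 1) (n - 1) Ω f ∧
  ∀ j : Fin m, ∃ h g : (Fin m → K) → Y,
    IsCPair q (n - 1) Ω h ∧
    (∀ x, ∀ U ∈ A.pieces, x j ∈ U → ∀ t ∈ U, g (Function.update x j t) = g x) ∧
    ∀ x ∈ Ω, f x = antideriv A n j (Ω.indicator h) x + g x

end Antiderivation

section Manifolds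

variable {K : Type*} [NontriviallyNormedField K]

/-- `M`, with its given atlas, is an `_S C^{(q+1,n-1)}`-manifold of dimension `m` over `K`. -/
structure IsSCManifold (A : ApproxSystem K) (q n m : ℕ) (M : Type*) [TopologicalSpace M]
    [ChartedSpace (Fin m → K) M] : Prop where
  isClopen_source : ∀ e ∈ atlas (Fin m → K) M, IsClopen e.source
  isClopen_target : ∀ e ∈ atlas (Fin m → K) M, IsClopen e.target
  transition : ∀ e ∈ atlas (Fin m → K) M, ∀ e' ∈ atlas (Fin m → K) M, e ≠ e' →
    IsSC A q n (e.target ∩ e.symm ⁻¹' e'.source) (e' ∘ e.symm)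

variable {a b : ℕ} {M : Type*} [TopologicalSpace M] [ChartedSpace (Fin a → K) M]
  {N : Type*} [TopologicalSpace N] [ChartedSpace (Fin b → K) N]

variable (K a b) in
/-- `f : M → N` is a `C^l`-mapping: it is continuous and of class `C^l` in the charts of the
given atlases. -/
structure IsCMap (l : ℕ) (f : M → N) : Prop where
  continuous : Continuous f
  isC : ∀ e ∈ atlas (Fin a → K) M, ∀ e' ∈ atlas (Fin b → K) N,
    IsC l (e.target ∩ e.symm ⁻¹' (f ⁻¹' e'.source)) (e' ∘ f ∘ e.symm)

variable (K a b) in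
/-- The differential `d_z f`, with the tangent spaces identified with `K^a` and `K^b` by means of
the charts at `z` and at `f z`. -/
def differential (f : M → N) (z : M) : (Fin a → K) →L[K] (Fin b → K) :=
  mfderiv 𝓘(K, Fin a → K) 𝓘(K, Fin b → K) f z

variable (K a b) in
/-- The set of all `z ∈ M` such that the rank of `d_z f` is less than `b = dim N`. -/
def criticalSet (f : M → N) : Set M :=
  {z | Module.finrank K (LinearMap.range (differential K a b f z).toLinearMap) < b}

variable (K b N) in
/-- A disjoint refinement of the atlas of `N`: a partition of `N` into clopen sets `cell i`,
each of them contained in the domain of a chart `chart i` of the atlas. -/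
structure DisjointRefinement (ι : Type*) where
  chart : ι → OpenPartialHomeomorph N (Fin b → K)
  cell : ι → Set N
  chart_mem : ∀ i, chart i ∈ atlas (Fin b → K) N
  isClopen_cell : ∀ i, IsClopen (cell i)
  cell_subset : ∀ i, cell i ⊆ (chart i).source
  disjoint : Pairwise (Function.onFun Disjoint cell)
  iUnion_cell : ⋃ i, cell i = univ

end Manifolds

section InducedMeasure

variable (p : ℕ) [Fact p.Prime] (K : Type*) [NontriviallyNormedField K] [NormedAlgebra ℚ_[p] K]
  [FiniteDimensional ℚ_[p] K] [MeasurableSpace K] [BorelSpace K]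

/-- The closed unit ball of `K^b` (for the maximum norm). -/
def unitBall (b : ℕ) : TopologicalSpace.PositiveCompacts (Fin b → K) where
  carrier := Metric.closedBall 0 1
  isCompact' := by
    have : ProperSpace K := FiniteDimensional.proper ℚ_[p] K
    exact isCompact_closedBall 0 1
  interior_nonempty' :=
    ⟨0, Metric.ball_subset_interior_closedBall (Metric.mem_ball_self one_pos)⟩

/-- The Haar measure on `K^b` which gives measure one to the closed unit ball. -/
def haar (b : ℕ) : Measure (Fin b → K) :=
  haveI : ProperSpace K := FiniteDimensional.proper ℚ_[p] K
  Measure.addHaarMeasure (unitBall p K b)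

variable {K} {b : ℕ} {N : Type*} [TopologicalSpace N] [ChartedSpace (Fin b → K) N]
  [MeasurableSpace N]

/-- The measure on `N` induced by the Haar measure on `K^b` with the help of the charts of a
disjoint refinement `D` of the atlas: on each cell it is the Haar measure carried over by the
chart. -/
def inducedMeasure {ι : Type*} (D : DisjointRefinement K b N ι) : Measure N :=
  Measure.sum fun i =>
    ((haar p K b).restrict (D.chart i '' D.cell i)).map (D.chart i).symm

end InducedMeasure

end NASard

end

/-! Bounded `l`-fold difference quotients give `f` a Taylor expansion of order `l` near every point,
uniformly in the base point, although `K` has no mean value theorem: divided differences with steps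
`p^N ζ` are compared instead. So on a compact set `f` is encoded by Taylor polynomials that satisfy
Whitney's compatibility conditions, and Sard's argument is run for such families of polynomial
jets, indexed by a compact space of critical points, by induction on the number of variables.

Suppose that all partial derivatives of orders `1, …, k` vanish along the family. Where a derivative
of order `k + 1` is nonzero, the points lie on the graph of a function of one variable fewer. Newton
iteration produces polynomial jets of that function of order `l - k` only, but composing jets that
are flat of order `k` with it loses nothing, so the composed family again has order `l`. For `k = 0`
one component of `f` is first fixed, by Fubini's theorem. What remains in the end are points at
which all derivatives of order less than `l` vanish; there `f` is Hölder of exponent `l > a`, and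
the image is null. -/

noncomputable section

namespace NASard

section PartialDerivatives

variable {K : Type*} [NontriviallyNormedField K] {n : ℕ} {f : (Fin n → K) → K} {z : Fin n → K}

/-- The partial derivative `∂f/∂z_i` of a function on `K^n`. As for `fderiv`, it is zero where `f`
is not differentiable. -/
def partialDeriv (i : Fin n) (f : (Fin n → K) → K) (z : Fin n → K) : K :=
  fderiv K f z (Pi.single i 1)

theorem fderiv_apply_eq_sum_partialDeriv (f : (Fin n → K) → K) (z v : Fin n → K) :
    fderiv K f z v = ∑ i, partialDeriv i f z * v i := by
  conv_lhs => rw [pi_eq_sum_univ' v]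
  simp [partialDeriv, mul_comm]

theorem partialDeriv_update_of_eq_eval {i : Fin n} {q : Polynomial K} (hf : Differentiable K f)
    (hq : ∀ τ, f (Function.update z i τ) = q.eval τ) (τ : K) :
    partialDeriv i f (Function.update z i τ) = q.derivative.eval τ := by
  have h := (hf _).hasFDerivAt.comp_hasDerivAt τ (hasDerivAt_update z i τ)
  exact h.unique ((q.hasDerivAt τ).congr_of_eventuallyEq (Filter.Eventually.of_forall hq))

end PartialDerivatives

section PolyFamily

variable {K : Type*} [NontriviallyNormedField K] {T S : Type*} {n m : ℕ}

/-- Families `P t`, `t : T`, of polynomial functions on `K^n` whose degrees and coefficients are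
bounded uniformly in `t`. They are generated by the coordinates and by the bounded functions of the
parameter `t`, so that the estimates below, uniform in `t`, follow by induction. -/
inductive PolyFamily : (T → (Fin n → K) → K) → Prop
  | param (θ : T → K) (C : ℝ) (h : ∀ t, ‖θ t‖ ≤ C) : PolyFamily fun t _ => θ t
  | coord (i : Fin n) : PolyFamily fun _ z => z i
  | add {P Q : T → (Fin n → K) → K} (hP : PolyFamily P) (hQ : PolyFamily Q) :
      PolyFamily fun t z => P t z + Q t z
  | mul {P Q : T → (Fin n → K) → K} (hP : PolyFamily P) (hQ : PolyFamily Q) :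
      PolyFamily fun t z => P t z * Q t z

namespace PolyFamily

variable {P Q : T → (Fin n → K) → K}

theorem const (c : K) : PolyFamily fun (_ : T) (_ : Fin n → K) => c :=
  param _ ‖c‖ fun _ => le_rfl

theorem neg (hP : PolyFamily P) : PolyFamily fun t z => -P t z := by
  simpa using (const (-1)).mul hP

theorem sub (hP : PolyFamily P) (hQ : PolyFamily Q) : PolyFamily fun t z => P t z - Q t z := by
  simpa [sub_eq_add_neg] using hP.add hQ.neg

theorem sum {ι : Type*} (s : Finset ι) {P : ι → T → (Fin n → K) → K}
    (hP : ∀ i ∈ s, PolyFamily (P i)) : PolyFamily fun t z => ∑ i ∈ s, P i t z := by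
  classical
  induction s using Finset.induction_on with
  | empty => simpa using const 0
  | insert i s hi ih =>
    simp only [Finset.sum_insert hi]
    exact (hP i (by simp)).add (ih fun j hj => hP j (by simp [hj]))

theorem prod {ι : Type*} (s : Finset ι) {P : ι → T → (Fin n → K) → K}
    (hP : ∀ i ∈ s, PolyFamily (P i)) : PolyFamily fun t z => ∏ i ∈ s, P i t z := by
  classical
  induction s using Finset.induction_on with
  | empty => simpa using const 1
  | insert i s hi ih =>
    simp only [Finset.prod_insert hi]
    exact (hP i (by simp)).mul (ih fun j hj => hP j (by simp [hj]))

theorem comp_index (σ : S → T) (hP : PolyFamily P) : PolyFamily fun s => P (σ s) := by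
  induction hP with
  | param θ C h => exact param _ C fun s => h (σ s)
  | coord i => exact coord i
  | add _ _ h₁ h₂ => exact h₁.add h₂
  | mul _ _ h₁ h₂ => exact h₁.mul h₂

theorem subst (hP : PolyFamily P) {G : Fin n → T → (Fin m → K) → K}
    (hG : ∀ i, PolyFamily (G i)) : PolyFamily fun t y => P t fun i => G i t y := by
  induction hP with
  | param θ C h => exact param _ C h
  | coord i => exact hG i
  | add _ _ h₁ h₂ => exact h₁.add h₂
  | mul _ _ h₁ h₂ => exact h₁.mul h₂

theorem bounded (hP : PolyFamily P) (R : ℝ) :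
    ∃ C, 0 ≤ C ∧ ∀ t z, ‖z‖ ≤ R → ‖P t z‖ ≤ C := by
  induction hP with
  | param θ C h => exact ⟨max C 0, le_max_right _ _, fun t _ _ => (h t).trans (le_max_left _ _)⟩
  | coord i => exact ⟨max R 0, le_max_right _ _, fun _ z hz =>
      (norm_le_pi_norm z i).trans (hz.trans (le_max_left _ _))⟩
  | add _ _ h₁ h₂ =>
    obtain ⟨C₁, hC₁, h₁⟩ := h₁
    obtain ⟨C₂, hC₂, h₂⟩ := h₂
    exact ⟨C₁ + C₂, by positivity, fun t z hz => norm_add_le_of_le (h₁ t z hz) (h₂ t z hz)⟩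
  | mul _ _ h₁ h₂ =>
    obtain ⟨C₁, hC₁, h₁⟩ := h₁
    obtain ⟨C₂, hC₂, h₂⟩ := h₂
    exact ⟨C₁ * C₂, by positivity, fun t z hz => norm_mul_le_of_le (h₁ t z hz) (h₂ t z hz)⟩

theorem lipschitz (hP : PolyFamily P) (R : ℝ) :
    ∃ C, 0 ≤ C ∧ ∀ t z w, ‖z‖ ≤ R → ‖w‖ ≤ R → ‖P t z - P t w‖ ≤ C * ‖z - w‖ := by
  induction hP with
  | param θ _ _ => exact ⟨0, le_rfl, by simp⟩
  | coord i => exact ⟨1, zero_le_one, fun _ z w _ _ => by simpa using norm_le_pi_norm (z - w) i⟩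
  | @add P Q _ _ h₁ h₂ =>
    obtain ⟨C₁, hC₁, h₁⟩ := h₁
    obtain ⟨C₂, hC₂, h₂⟩ := h₂
    refine ⟨C₁ + C₂, by positivity, fun t z w hz hw => ?_⟩
    rw [add_sub_add_comm, add_mul]
    exact norm_add_le_of_le (h₁ t z w hz hw) (h₂ t z w hz hw)
  | @mul P Q hP hQ h₁ h₂ =>
    obtain ⟨C₁, hC₁, h₁⟩ := h₁
    obtain ⟨C₂, hC₂, h₂⟩ := h₂
    obtain ⟨B₁, hB₁, hP⟩ := hP.bounded R
    obtain ⟨B₂, hB₂, hQ⟩ := hQ.bounded R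
    refine ⟨C₁ * B₂ + B₁ * C₂, by positivity, fun t z w hz hw => ?_⟩
    calc ‖P t z * Q t z - P t w * Q t w‖
        = ‖(P t z - P t w) * Q t z + P t w * (Q t z - Q t w)‖ := by ring_nf
      _ ≤ C₁ * ‖z - w‖ * B₂ + B₁ * (C₂ * ‖z - w‖) :=
          norm_add_le_of_le (norm_mul_le_of_le (h₁ t z w hz hw) (hQ t z hz))
            (norm_mul_le_of_le (hP t w hw) (h₂ t z w hz hw))
      _ = _ := by ring

theorem exists_polynomial (hP : PolyFamily P) :
    ∃ D : ℕ, ∀ t z i, ∃ q : Polynomial K, q.natDegree ≤ D ∧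
      ∀ τ, P t (Function.update z i τ) = q.eval τ := by
  induction hP with
  | param θ _ _ => exact ⟨0, fun t z i => ⟨.C (θ t), by simp, by simp⟩⟩
  | coord j =>
    refine ⟨1, fun t z i => ?_⟩
    by_cases hij : j = i
    · subst hij
      exact ⟨.X, by simp, by simp⟩
    · exact ⟨.C (z j), by simp, fun τ => by simp [Function.update_of_ne hij]⟩
  | add _ _ h₁ h₂ =>
    obtain ⟨D₁, h₁⟩ := h₁
    obtain ⟨D₂, h₂⟩ := h₂
    refine ⟨max D₁ D₂, fun t z i => ?_⟩
    obtain ⟨q₁, hq₁, e₁⟩ := h₁ t z i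
    obtain ⟨q₂, hq₂, e₂⟩ := h₂ t z i
    exact ⟨q₁ + q₂, (Polynomial.natDegree_add_le _ _).trans (max_le_max hq₁ hq₂),
      fun τ => by simp [e₁, e₂]⟩
  | mul _ _ h₁ h₂ =>
    obtain ⟨D₁, h₁⟩ := h₁
    obtain ⟨D₂, h₂⟩ := h₂
    refine ⟨D₁ + D₂, fun t z i => ?_⟩
    obtain ⟨q₁, hq₁, e₁⟩ := h₁ t z i
    obtain ⟨q₂, hq₂, e₂⟩ := h₂ t z i
    exact ⟨q₁ * q₂, Polynomial.natDegree_mul_le.trans (add_le_add hq₁ hq₂),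
      fun τ => by simp [e₁, e₂]⟩

theorem differentiable (hP : PolyFamily P) (t : T) : Differentiable K (P t) := by
  induction hP with
  | param θ _ _ => exact differentiable_const _
  | coord i => exact differentiable_apply i
  | add _ _ h₁ h₂ => exact h₁.add h₂
  | mul _ _ h₁ h₂ => exact h₁.mul h₂

theorem fderiv_add (hP : PolyFamily P) (hQ : PolyFamily Q) (t : T) (z v : Fin n → K) :
    fderiv K (fun z => P t z + Q t z) z v = fderiv K (P t) z v + fderiv K (Q t) z v := by
  rw [fderiv_fun_add (hP.differentiable t z) (hQ.differentiable t z)]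
  rfl

theorem fderiv_mul (hP : PolyFamily P) (hQ : PolyFamily Q) (t : T) (z v : Fin n → K) :
    fderiv K (fun z => P t z * Q t z) z v =
      fderiv K (P t) z v * Q t z + P t z * fderiv K (Q t) z v := by
  rw [fderiv_fun_mul (hP.differentiable t z) (hQ.differentiable t z)]
  simp only [add_apply, smul_apply, smul_eq_mul]
  ring

protected theorem partialDeriv (hP : PolyFamily P) (i : Fin n) :
    PolyFamily fun t => partialDeriv i (P t) := by
  induction hP with
  | param θ _ _ =>
    have h : (fun t => partialDeriv i fun _ => θ t) = fun _ _ => 0 := by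
      ext t z
      simp [NASard.partialDeriv]
    exact h ▸ const 0
  | coord j =>
    have h : (fun _ : T => partialDeriv i fun z : Fin n → K => z j) =
        fun _ _ => Pi.single (M := fun _ => K) i 1 j := by
      ext _ z
      simp [NASard.partialDeriv, (hasFDerivAt_apply j z).fderiv]
    exact h ▸ const _
  | @add P Q hP hQ h₁ h₂ =>
    have h : (fun t => partialDeriv i fun z => P t z + Q t z) =
        fun t z => partialDeriv i (P t) z + partialDeriv i (Q t) z :=
      funext₂ fun t z => fderiv_add hP hQ t z _
    exact h ▸ h₁.add h₂
  | @mul P Q hP hQ h₁ h₂ =>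
    have h : (fun t => partialDeriv i fun z => P t z * Q t z) =
        fun t z => partialDeriv i (P t) z * Q t z + P t z * partialDeriv i (Q t) z :=
      funext₂ fun t z => fderiv_mul hP hQ t z _
    exact h ▸ (h₁.mul hQ).add (hP.mul h₂)

theorem exists_norm_fderiv_le (hP : PolyFamily P) (R : ℝ) :
    ∃ C, 0 ≤ C ∧ ∀ t z v, ‖z‖ ≤ R → ‖fderiv K (P t) z v‖ ≤ C * ‖v‖ := by
  choose B hB hPB using fun i => (hP.partialDeriv i).bounded R
  refine ⟨∑ i, B i, Finset.sum_nonneg fun i _ => hB i, fun t z v hz => ?_⟩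
  rw [fderiv_apply_eq_sum_partialDeriv, Finset.sum_mul]
  exact norm_sum_le_of_le _ fun i _ => norm_mul_le_of_le (hPB i t z hz) (norm_le_pi_norm v i)

theorem exists_norm_sub_sub_fderiv_le (hP : PolyFamily P) (R : ℝ) :
    ∃ C, 0 ≤ C ∧ ∀ t z w w', ‖z‖ ≤ R → ‖w‖ ≤ R → ‖w'‖ ≤ R →
      ‖P t w - P t w' - fderiv K (P t) z (w - w')‖ ≤
        C * (‖w - z‖ + ‖w' - z‖) * ‖w - w'‖ := by
  induction hP with
  | param θ _ _ => exact ⟨0, le_rfl, by simp⟩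
  | coord i => exact ⟨0, le_rfl, by simp [(hasFDerivAt_apply i _).fderiv]⟩
  | @add P Q hP hQ h₁ h₂ =>
    obtain ⟨C₁, hC₁, h₁⟩ := h₁
    obtain ⟨C₂, hC₂, h₂⟩ := h₂
    refine ⟨C₁ + C₂, by positivity, fun t z w w' hz hw hw' => ?_⟩
    rw [fderiv_add hP hQ, add_sub_add_comm, add_sub_add_comm, add_mul, add_mul]
    exact norm_add_le_of_le (h₁ t z w w' hz hw hw') (h₂ t z w w' hz hw hw')
  | @mul P Q hP hQ h₁ h₂ =>
    obtain ⟨C₁, hC₁, h₁⟩ := h₁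
    obtain ⟨C₂, hC₂, h₂⟩ := h₂
    obtain ⟨B₁, hB₁, bP⟩ := hP.bounded R
    obtain ⟨B₂, hB₂, bQ⟩ := hQ.bounded R
    obtain ⟨L₁, hL₁, lP⟩ := hP.lipschitz R
    obtain ⟨L₂, hL₂, lQ⟩ := hQ.lipschitz R
    obtain ⟨D₁, hD₁, dP⟩ := hP.exists_norm_fderiv_le R
    obtain ⟨D₂, hD₂, dQ⟩ := hQ.exists_norm_fderiv_le R
    refine ⟨C₁ * B₂ + D₁ * L₂ + B₁ * C₂ + L₁ * D₂, by positivity, fun t z w w' hz hw hw' => ?_⟩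
    rw [fderiv_mul hP hQ]
    have hwz : ‖w - z‖ ≤ ‖w - z‖ + ‖w' - z‖ := le_add_of_nonneg_right (norm_nonneg _)
    have hwz' : ‖w' - z‖ ≤ ‖w - z‖ + ‖w' - z‖ := le_add_of_nonneg_left (norm_nonneg _)
    set P' := fderiv K (P t) z (w - w')
    set Q' := fderiv K (Q t) z (w - w')
    set ρ := ‖w - z‖ + ‖w' - z‖
    calc ‖P t w * Q t w - P t w' * Q t w' - (P' * Q t z + P t z * Q')‖
        = ‖(P t w - P t w' - P') * Q t w + P' * (Q t w - Q t z)
          + P t w' * (Q t w - Q t w' - Q') + (P t w' - P t z) * Q'‖ := by ring_nf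
      _ ≤ C₁ * ρ * ‖w - w'‖ * B₂ + D₁ * ‖w - w'‖ * (L₂ * ρ)
          + B₁ * (C₂ * ρ * ‖w - w'‖) + L₁ * ρ * (D₂ * ‖w - w'‖) := by
        refine norm_add_le_of_le (norm_add_le_of_le (norm_add_le_of_le
          (norm_mul_le_of_le (h₁ t z w w' hz hw hw') (bQ t w hw))
          (norm_mul_le_of_le (dP t z _ hz) ((lQ t w z hw hz).trans ?_)))
          (norm_mul_le_of_le (bP t w' hw') (h₂ t z w w' hz hw hw')))
          (norm_mul_le_of_le ((lP t w' z hw' hz).trans ?_) (dQ t z _ hz)) <;> gcongr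
      _ = _ := by ring

end PolyFamily

end PolyFamily

section PolynomialInequalities

variable (K : Type*) [NontriviallyNormedField K]

theorem exists_norm_le_le_mul :
    ∃ c : ℝ, 1 < c ∧ ∀ r : ℝ, 0 < r → ∃ τ : K, τ ≠ 0 ∧ ‖τ‖ ≤ r ∧ r ≤ c * ‖τ‖ := by
  obtain ⟨c, hc⟩ := NormedField.exists_one_lt_norm K
  refine ⟨‖c‖, hc, fun r hr => ?_⟩
  obtain ⟨d, hd, h₁, h₂, -⟩ := rescale_to_shell hc hr (one_ne_zero (α := K))
  simp only [smul_eq_mul, mul_one] at h₁ h₂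
  exact ⟨d, hd, h₁.le, by rwa [div_le_iff₀' (by linarith)] at h₂⟩

variable {K} in
theorem coeff_eq_sum_eval_mul_coeff_basis {v : ℕ → K} {D : ℕ}
    (hv : InjOn v (Finset.range (D + 1))) {q : Polynomial K} (hq : q.natDegree ≤ D) (k : ℕ) :
    q.coeff k = ∑ i ∈ Finset.range (D + 1),
      q.eval (v i) * (Lagrange.basis (Finset.range (D + 1)) v i).coeff k := by
  have hdeg : q.degree < ((Finset.range (D + 1)).card : WithBot ℕ) := by
    rw [Finset.card_range]
    exact Polynomial.degree_lt_iff_coeff_zero _ _ |>.2 fun m hm =>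
      Polynomial.coeff_eq_zero_of_natDegree_lt (by omega)
  conv_lhs => rw [Lagrange.eq_interpolate hv hdeg, Lagrange.interpolate_apply,
    Polynomial.finsetSum_coeff]
  simp only [Polynomial.coeff_C_mul]

theorem exists_norm_coeff_le (D : ℕ) :
    ∃ W : ℝ, 0 ≤ W ∧ ∀ q : Polynomial K, q.natDegree ≤ D → ∀ M : ℝ,
      (∀ τ, ‖τ‖ ≤ 1 → ‖q.eval τ‖ ≤ M) → ∀ k ≤ D, ‖q.coeff k‖ ≤ W * M := by
  obtain ⟨ϖ, hϖ₀, hϖ₁⟩ := NormedField.exists_norm_lt_one K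
  set s := Finset.range (D + 1)
  have hv : InjOn (fun i : ℕ => ϖ ^ i) s := fun i _ j _ hij =>
    pow_right_injective₀ hϖ₀ hϖ₁.ne (by simpa using congrArg norm hij)
  set w : ℕ → ℝ := fun k => ∑ i ∈ s, ‖(Lagrange.basis s (fun i => ϖ ^ i) i).coeff k‖
  have hw : ∀ k, 0 ≤ w k := fun k => by positivity
  refine ⟨∑ k ∈ s, w k, by positivity, fun q hq M hM k hk => ?_⟩
  have hM₀ : 0 ≤ M := (norm_nonneg _).trans (hM 0 (by simp))
  calc ‖q.coeff k‖ ≤ ∑ i ∈ s, M * ‖(Lagrange.basis s (fun i => ϖ ^ i) i).coeff k‖ := by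
        rw [coeff_eq_sum_eval_mul_coeff_basis hv hq]
        refine norm_sum_le_of_le _ fun i _ => norm_mul_le_of_le (hM _ ?_) le_rfl
        rw [norm_pow]
        exact pow_le_one₀ (norm_nonneg _) hϖ₁.le
    _ = w k * M := by rw [← Finset.mul_sum, mul_comm]
    _ ≤ (∑ k ∈ s, w k) * M := by
        gcongr
        exact Finset.single_le_sum (fun k _ => hw k) (Finset.mem_range_succ_iff.2 hk)

theorem exists_norm_coeff_mul_pow_le (D : ℕ) :
    ∃ W : ℝ, 0 ≤ W ∧ ∀ q : Polynomial K, q.natDegree ≤ D → ∀ r M : ℝ, 0 < r →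
      (∀ τ, ‖τ‖ ≤ r → ‖q.eval τ‖ ≤ M) → ∀ k, ‖q.coeff k‖ * r ^ k ≤ W * M := by
  obtain ⟨c, hc, hshell⟩ := exists_norm_le_le_mul K
  obtain ⟨W, hW, hcoeff⟩ := exists_norm_coeff_le K D
  refine ⟨c ^ D * W, by positivity, fun q hq r M hr hM k => ?_⟩
  have hM₀ : 0 ≤ M := (norm_nonneg _).trans (hM 0 (by simpa using hr.le))
  obtain hk | hk := lt_or_ge D k
  · rw [Polynomial.coeff_eq_zero_of_natDegree_lt (by omega), norm_zero, zero_mul]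
    positivity
  obtain ⟨τ, -, hτ, hτr⟩ := hshell r hr
  have hscaled : ‖q.coeff k * τ ^ k‖ ≤ W * M := by
    rw [← Polynomial.comp_C_mul_X_coeff]
    refine hcoeff _ (Polynomial.natDegree_le_iff_coeff_eq_zero.2 fun m hm => ?_) M
      (fun σ hσ => ?_) k hk
    · rw [Polynomial.comp_C_mul_X_coeff, Polynomial.coeff_eq_zero_of_natDegree_lt (by omega),
        zero_mul]
    · rw [Polynomial.eval_comp, Polynomial.eval_C_mul, Polynomial.eval_X]
      exact hM _ ((norm_mul_le_of_le hτ hσ).trans_eq (mul_one r))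
  calc ‖q.coeff k‖ * r ^ k ≤ ‖q.coeff k‖ * (c * ‖τ‖) ^ k := by gcongr
    _ = c ^ k * ‖q.coeff k * τ ^ k‖ := by rw [norm_mul, norm_pow, mul_pow]; ring
    _ ≤ c ^ D * (W * M) := by
        gcongr
        exact hc.le
    _ = _ := by ring

theorem exists_norm_eval_derivative_mul_le (D : ℕ) :
    ∃ W : ℝ, 0 ≤ W ∧ ∀ q : Polynomial K, q.natDegree ≤ D → ∀ x : K, ∀ r M : ℝ, 0 < r →
      (∀ τ, ‖τ - x‖ ≤ r → ‖q.eval τ‖ ≤ M) → ‖q.derivative.eval x‖ * r ≤ W * M := by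
  obtain ⟨W, hW, hcoeff⟩ := exists_norm_coeff_mul_pow_le K D
  refine ⟨W, hW, fun q hq x r M hr hM => ?_⟩
  simpa using hcoeff (Polynomial.taylor x q) (by rwa [Polynomial.natDegree_taylor]) r M hr
    (fun τ hτ => by rw [Polynomial.taylor_eval]; exact hM _ (by simpa using hτ)) 1

-- The mean value inequality fails over `K`; for polynomials, the coefficients replace it.
theorem exists_norm_eval_sub_eval_le [CharZero K] (D : ℕ) :
    ∃ W : ℝ, 0 ≤ W ∧ ∀ q : Polynomial K, q.natDegree ≤ D → ∀ x y : K, ∀ M : ℝ,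
      (∀ τ, ‖τ - x‖ ≤ ‖y - x‖ → ‖q.derivative.eval τ‖ ≤ M) →
        ‖q.eval y - q.eval x‖ ≤ W * M * ‖y - x‖ := by
  obtain ⟨W, hW, hcoeff⟩ := exists_norm_coeff_mul_pow_le K D
  refine ⟨∑ k ∈ Finset.range D, W / ‖((k + 1 : ℕ) : K)‖, by positivity, fun q hq x y M hM => ?_⟩
  obtain rfl | hxy := eq_or_ne y x
  · simp
  have hr : 0 < ‖y - x‖ := norm_pos_iff.2 (sub_ne_zero.2 hxy)
  set Q := Polynomial.taylor x q with hQ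
  have hQD : Q.natDegree ≤ D := by rwa [hQ, Polynomial.natDegree_taylor]
  have hQ' : Q.derivative = Polynomial.taylor x q.derivative := by
    simp [hQ, Polynomial.taylor_apply, Polynomial.derivative_comp]
  have hderiv : ∀ k, ‖Q.coeff (k + 1)‖ * ‖((k + 1 : ℕ) : K)‖ * ‖y - x‖ ^ k ≤ W * M := fun k => by
    have h := hcoeff Q.derivative ((Polynomial.natDegree_derivative_le _).trans (by omega)) _ M hr
      (fun τ hτ => by
        rw [hQ', Polynomial.taylor_eval]; exact hM _ (by simpa using hτ)) k
    rw [Polynomial.coeff_derivative, norm_mul] at h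
    exact_mod_cast h
  have hincr : q.eval y - q.eval x =
      ∑ k ∈ Finset.range D, Q.coeff (k + 1) * (y - x) ^ (k + 1) := by
    rw [show q.eval y = Q.eval (y - x) by simp [hQ, Polynomial.taylor_eval],
      show q.eval x = Q.coeff 0 by simp [hQ],
      Polynomial.eval_eq_sum_range' (Nat.lt_succ_of_le hQD), Finset.sum_range_succ', pow_zero,
      mul_one, add_sub_cancel_right]
  rw [hincr, Finset.sum_mul, Finset.sum_mul]
  refine norm_sum_le_of_le _ fun k _ => ?_
  have hk : 0 < ‖((k + 1 : ℕ) : K)‖ := norm_pos_iff.2 (Nat.cast_ne_zero.2 k.succ_ne_zero)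
  calc ‖Q.coeff (k + 1) * (y - x) ^ (k + 1)‖
      = ‖Q.coeff (k + 1)‖ * ‖((k + 1 : ℕ) : K)‖ * ‖y - x‖ ^ k / ‖((k + 1 : ℕ) : K)‖ *
          ‖y - x‖ := by
        rw [norm_mul, norm_pow, pow_succ]
        field_simp
    _ ≤ W * M / ‖((k + 1 : ℕ) : K)‖ * ‖y - x‖ :=
        mul_le_mul_of_nonneg_right (div_le_div_of_nonneg_right (hderiv k) hk.le) hr.le
    _ = _ := by ring

end PolynomialInequalities

section CoordinateChanges

theorem norm_sub_le_of_update {X Y : Type*} [SeminormedAddCommGroup Y] {n : ℕ}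
    (G : (Fin n → X) → Y) (z w : Fin n → X) (B : ℝ)
    (h : ∀ (i : Fin n) (x : Fin n → X), (∀ j, x j = z j ∨ x j = w j) → x i = z i →
      ‖G (Function.update x i (w i)) - G x‖ ≤ B) : ‖G w - G z‖ ≤ n * B := by
  have key : ∀ s : Finset (Fin n), ‖G (s.piecewise w z) - G z‖ ≤ s.card * B := by
    intro s
    induction s using Finset.induction_on with
    | empty => simp
    | insert i s hi ih =>
      rw [Finset.piecewise_insert, Finset.card_insert_of_notMem hi]
      have hstep := h i (s.piecewise w z)
        (fun j => by by_cases hj : j ∈ s <;> simp [hj]) (by simp [hi])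
      calc _ = ‖(G (Function.update (s.piecewise w z) i (w i)) - G (s.piecewise w z))
            + (G (s.piecewise w z) - G z)‖ := by abel_nf
        _ ≤ B + s.card * B := norm_add_le_of_le hstep ih
        _ = _ := by push_cast; ring
  simpa using key Finset.univ

theorem norm_update_sub_le {K : Type*} [NormedAddCommGroup K] {n : ℕ} (z w : Fin n → K)
    (i : Fin n) (τ : K) : ‖Function.update z i τ - w‖ ≤ ‖z - w‖ + ‖τ - z i‖ := by
  have h : Function.update z i τ - w = (z - w) + Pi.single i (τ - z i) := by
    ext j
    by_cases hj : j = i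
    · subst hj; simp
    · simp [hj]
  rw [h]
  exact norm_add_le_of_le le_rfl (Pi.norm_single (G := fun _ : Fin n => K) _).le

end CoordinateChanges

section Whitney

variable {K : Type*} [NontriviallyNormedField K] {T S : Type*} {n : ℕ}
  {P : T → (Fin n → K) → K} {u : T → Fin n → K} {l : ℕ} {B : ℝ}

/-- The polynomials `P t`, considered as jets at the points `u t ∈ K^n`, satisfy the compatibility
conditions of Whitney's extension theorem of order `l`. -/
def IsWhitney (l : ℕ) (u : T → Fin n → K) (P : T → (Fin n → K) → K) : Prop :=
  ∀ R : ℝ, ∃ C, 0 ≤ C ∧ ∀ s t z, ‖z‖ ≤ R →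
    ‖P t z - P s z‖ ≤ C * (‖z - u t‖ + ‖z - u s‖) ^ l

theorem IsWhitney.comp_index (σ : S → T) (h : IsWhitney l u P) :
    IsWhitney l (fun s => u (σ s)) (fun s => P (σ s)) := fun R => by
  obtain ⟨C, hC, h⟩ := h R
  exact ⟨C, hC, fun s t z hz => h (σ s) (σ t) z hz⟩

theorem IsWhitney.exists_norm_partialDeriv_sub_le (h : IsWhitney (l + 1) u P) (hP : PolyFamily P)
    (hu : ∀ t, ‖u t‖ ≤ B) (i : Fin n) (R : ℝ) :
    ∃ C, 0 ≤ C ∧ ∀ s t z, ‖z‖ ≤ R → ∀ r, ‖z - u t‖ + ‖z - u s‖ < r →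
      r < ‖z - u t‖ + ‖z - u s‖ + 1 →
      ‖partialDeriv i (P t) z - partialDeriv i (P s) z‖ ≤ C * r ^ l := by
  obtain ⟨D, hD⟩ := hP.exists_polynomial
  obtain ⟨W, hW, hderiv⟩ := exists_norm_eval_derivative_mul_le K D
  obtain ⟨C, hC, hWhitney⟩ := h (3 * R + 2 * B + 1)
  refine ⟨W * C * 3 ^ (l + 1), by positivity, fun s t z hz r hr hr' => ?_⟩
  have hr₀ : 0 < r := lt_of_le_of_lt (by positivity) hr
  obtain ⟨q₁, hq₁, e₁⟩ := hD t z i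
  obtain ⟨q₂, hq₂, e₂⟩ := hD s z i
  have hball : ∀ τ, ‖τ - z i‖ ≤ r → ‖(q₁ - q₂).eval τ‖ ≤ C * (3 * r) ^ (l + 1) := fun τ hτ => by
    have hz₀ := norm_update_sub_le z 0 i τ
    have hzt := norm_update_sub_le z (u t) i τ
    have hzs := norm_update_sub_le z (u s) i τ
    have ht := norm_sub_le_of_le hz (hu t)
    have hs := norm_sub_le_of_le hz (hu s)
    rw [sub_zero, sub_zero] at hz₀
    rw [Polynomial.eval_sub, ← e₁, ← e₂]
    refine (hWhitney s t _ (by linarith)).trans ?_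
    gcongr
    linarith
  have hmarkov := hderiv (q₁ - q₂) ((Polynomial.natDegree_sub_le _ _).trans (max_le hq₁ hq₂))
    (z i) r _ hr₀ hball
  rw [Polynomial.derivative_sub, Polynomial.eval_sub,
    ← partialDeriv_update_of_eq_eval (hP.differentiable t) e₁,
    ← partialDeriv_update_of_eq_eval (hP.differentiable s) e₂, Function.update_eq_self, mul_pow,
    pow_succ r] at hmarkov
  exact le_of_mul_le_mul_right (hmarkov.trans_eq (by ring)) hr₀

protected theorem IsWhitney.partialDeriv (h : IsWhitney (l + 1) u P) (hP : PolyFamily P)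
    (hu : ∀ t, ‖u t‖ ≤ B) (i : Fin n) : IsWhitney l u fun t => partialDeriv i (P t) := fun R => by
  obtain ⟨C, hC, hbound⟩ := h.exists_norm_partialDeriv_sub_le hP hu i R
  refine ⟨C, hC, fun s t z hz => ?_⟩
  have hlim : Filter.Tendsto (fun r : ℝ => C * r ^ l) (nhdsWithin (‖z - u t‖ + ‖z - u s‖)
      (Ioi (‖z - u t‖ + ‖z - u s‖)))
      (nhds (C * (‖z - u t‖ + ‖z - u s‖) ^ l)) :=
    (Continuous.tendsto (by fun_prop) _).mono_left nhdsWithin_le_nhds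
  refine ge_of_tendsto hlim ?_
  filter_upwards [Ioo_mem_nhdsGT (lt_add_one _)] with r hr using hbound s t z hz r hr.1 hr.2

/-- The iterated partial derivative of `f`, in the coordinates listed in `L`. -/
def iterPartialDeriv (L : List (Fin n)) (f : (Fin n → K) → K) : (Fin n → K) → K :=
  L.foldl (fun f i => partialDeriv i f) f

theorem iterPartialDeriv_concat (i : Fin n) (L : List (Fin n)) (f : (Fin n → K) → K) :
    iterPartialDeriv (L ++ [i]) f = partialDeriv i (iterPartialDeriv L f) := by
  simp only [iterPartialDeriv, List.foldl_append, List.foldl_cons, List.foldl_nil]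

protected theorem PolyFamily.iterPartialDeriv (hP : PolyFamily P) (L : List (Fin n)) :
    PolyFamily fun t => iterPartialDeriv L (P t) := by
  induction L generalizing P with
  | nil => exact hP
  | cons i _ ih => exact ih (hP.partialDeriv i)

protected theorem IsWhitney.iterPartialDeriv (L : List (Fin n))
    (h : IsWhitney (l + L.length) u P) (hP : PolyFamily P) (hu : ∀ t, ‖u t‖ ≤ B) :
    IsWhitney l u fun t => iterPartialDeriv L (P t) := by
  induction L generalizing P with
  | nil => exact h
  | cons i _ ih =>
    exact ih (IsWhitney.partialDeriv (by simpa [add_assoc] using h) hP hu i) (hP.partialDeriv i)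

theorem IsWhitney.continuous [TopologicalSpace T] (h : IsWhitney (l + 1) u P)
    (hP : PolyFamily P) (hu : ∀ t, ‖u t‖ ≤ B) (hc : Continuous u) :
    Continuous fun t => P t (u t) := by
  obtain ⟨C, -, h⟩ := h B
  obtain ⟨C', -, h'⟩ := hP.lipschitz B
  refine continuous_iff_continuousAt.2 fun t => ?_
  rw [ContinuousAt, tendsto_iff_norm_sub_tendsto_zero]
  have hlim : Filter.Tendsto (fun s => C * ‖u s - u t‖ ^ (l + 1) + C' * ‖u s - u t‖) (nhds t)
      (nhds 0) := by
    have : Continuous fun s => C * ‖u s - u t‖ ^ (l + 1) + C' * ‖u s - u t‖ := by fun_prop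
    simpa using this.tendsto t
  refine squeeze_zero (fun _ => norm_nonneg _) (fun s => ?_) hlim
  have hst := h t s (u s) (hu s)
  rw [sub_self, norm_zero, zero_add] at hst
  calc ‖P s (u s) - P t (u t)‖ = ‖(P s (u s) - P t (u s)) + (P t (u s) - P t (u t))‖ := by abel_nf
    _ ≤ _ := norm_add_le_of_le hst (h' t _ _ (hu s) (hu t))

end Whitney

section Flat

variable {K : Type*} [NontriviallyNormedField K] {T S : Type*} {n k : ℕ}
  {P : T → (Fin n → K) → K} {u : T → Fin n → K} {B : ℝ}

/-- `P t` is Lipschitz near `u t` with a constant that vanishes to the order `k` at `u t`, uniformly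
in `t`. -/
def IsFlat (k : ℕ) (u : T → Fin n → K) (P : T → (Fin n → K) → K) : Prop :=
  ∀ R : ℝ, ∃ C, 0 ≤ C ∧ ∀ t z w, ‖z‖ ≤ R → ‖w‖ ≤ R →
    ‖P t z - P t w‖ ≤ C * (‖z - u t‖ + ‖w - u t‖) ^ k * ‖z - w‖

theorem IsFlat.comp_index (σ : S → T) (h : IsFlat k u P) :
    IsFlat k (fun s => u (σ s)) (fun s => P (σ s)) := fun R => by
  obtain ⟨C, hC, h⟩ := h R
  exact ⟨C, hC, fun t => h (σ t)⟩

theorem PolyFamily.isFlat_zero (hP : PolyFamily P) : IsFlat 0 u P := fun R => by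
  simpa using hP.lipschitz R

theorem IsFlat.exists_norm_le (h : IsFlat k u P) (hu : ∀ t, ‖u t‖ ≤ B)
    (hvan : ∀ t, P t (u t) = 0) (R : ℝ) :
    ∃ C, 0 ≤ C ∧ ∀ t z, ‖z‖ ≤ R → ‖P t z‖ ≤ C * ‖z - u t‖ ^ (k + 1) := by
  obtain ⟨C, hC, h⟩ := h (max R B)
  refine ⟨C, hC, fun t z hz => ?_⟩
  have := h t z (u t) (hz.trans (le_max_left _ _)) ((hu t).trans (le_max_right _ _))
  rwa [hvan t, sub_self, norm_zero, add_zero, sub_zero, mul_assoc, ← pow_succ] at this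

theorem PolyFamily.isFlat_succ_of_partialDeriv [CharZero K] (hP : PolyFamily P)
    (hu : ∀ t, ‖u t‖ ≤ B)
    (hvan : ∀ t i, partialDeriv i (P t) (u t) = 0)
    (hflat : ∀ i, IsFlat k u fun t => partialDeriv i (P t)) : IsFlat (k + 1) u P := by
  intro R
  obtain ⟨D, hD⟩ := hP.exists_polynomial
  obtain ⟨W, hW, hmean⟩ := exists_norm_eval_sub_eval_le K D
  choose C hC hderiv using fun i =>
    (hflat i).exists_norm_le hu (fun t => hvan t i) (4 * (R + B) + B)
  set A := ∑ i, C i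
  have hCA : ∀ i, C i ≤ A := fun i => Finset.single_le_sum (fun i _ => hC i) (Finset.mem_univ i)
  have hA₀ : 0 ≤ A := Finset.sum_nonneg fun i _ => hC i
  refine ⟨n * (W * (A * 2 ^ (k + 1))), by positivity, fun t z w hz hw => ?_⟩
  set ρ := ‖z - u t‖ + ‖w - u t‖
  have hzw : ‖w - z‖ ≤ ρ := by
    simpa only [dist_eq_norm, add_comm, norm_sub_rev (u t)] using dist_triangle w (u t) z
  rw [norm_sub_rev]
  refine (norm_sub_le_of_update (P t) z w (W * (A * (2 * ρ) ^ (k + 1)) * ‖z - w‖)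
    fun i x hx hxi => ?_).trans_eq (by rw [mul_pow]; ring)
  obtain ⟨q, hq, hqeval⟩ := hD t x i
  have hxu : ‖x - u t‖ ≤ ρ := by
    refine (pi_norm_le_iff_of_nonneg (by positivity)).2 fun j => ?_
    rcases hx j with h | h <;> rw [Pi.sub_apply, h]
    · exact (norm_le_pi_norm (z - u t) j).trans (le_add_of_nonneg_right (norm_nonneg _))
    · exact (norm_le_pi_norm (w - u t) j).trans (le_add_of_nonneg_left (norm_nonneg _))
  have hwx : ‖w i - x i‖ ≤ ‖w - z‖ := hxi ▸ norm_le_pi_norm (w - z) i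
  have hstep := hmean q hq (x i) (w i) (A * (2 * ρ) ^ (k + 1)) fun τ hτ => by
    have hτu : ‖Function.update x i τ - u t‖ ≤ 2 * ρ := by
      linarith [norm_update_sub_le x (u t) i τ]
    have hρ : ρ ≤ 2 * (R + B) :=
      (add_le_add (norm_sub_le_of_le hz (hu t)) (norm_sub_le_of_le hw (hu t))).trans_eq (by ring)
    have hτR : ‖Function.update x i τ‖ ≤ 4 * (R + B) + B := by
      linarith [norm_le_norm_sub_add (Function.update x i τ) (u t), hu t]
    rw [← partialDeriv_update_of_eq_eval (hP.differentiable t) hqeval]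
    exact (hderiv i t _ hτR).trans (by gcongr; exact hCA i)
  rw [← hqeval, ← hqeval, Function.update_eq_self] at hstep
  rw [norm_sub_rev z w]
  exact hstep.trans (by gcongr)

theorem PolyFamily.isFlat [CharZero K] (hP : PolyFamily P) (hu : ∀ t, ‖u t‖ ≤ B)
    (hvan : ∀ t, ∀ L : List (Fin n), 1 ≤ L.length → L.length ≤ k →
      iterPartialDeriv L (P t) (u t) = 0) : IsFlat k u P := by
  induction k generalizing P with
  | zero => exact hP.isFlat_zero
  | succ k ih =>
    exact hP.isFlat_succ_of_partialDeriv hu (fun t i => hvan t [i] (by simp) (by simp))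
      fun i => ih (hP.partialDeriv i) fun t L _ h₂ => hvan t (i :: L) (by simp) (by simpa using h₂)

end Flat

section Graph

variable {X : Type*} {n : ℕ} {i : Fin (n + 1)}

/-- The point over `y` of the graph of `φ`, a function giving the `i`-th coordinate in terms of the
others. -/
def graphAt (i : Fin (n + 1)) (φ : (Fin n → X) → X) (y : Fin n → X) : Fin (n + 1) → X :=
  i.insertNth (φ y) y

theorem graphAt_apply_self (φ : (Fin n → X) → X) (y : Fin n → X) : graphAt i φ y i = φ y := by
  simp [graphAt]

theorem removeNth_graphAt (φ : (Fin n → X) → X) (y : Fin n → X) :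
    i.removeNth (graphAt i φ y) = y := by
  simp [graphAt]

theorem graphAt_removeNth {φ : (Fin n → X) → X} {z : Fin (n + 1) → X}
    (h : φ (i.removeNth z) = z i) : graphAt i φ (i.removeNth z) = z := by
  rw [graphAt, h, Fin.insertNth_self_removeNth]

end Graph

section GraphNorm

variable {K : Type*} [NontriviallyNormedField K] {T : Type*} {n : ℕ} {i : Fin (n + 1)}

theorem norm_le_apply_add_removeNth (i : Fin (n + 1)) (z : Fin (n + 1) → K) :
    ‖z‖ ≤ ‖z i‖ + ‖i.removeNth z‖ := by
  refine (pi_norm_le_iff_of_nonneg (by positivity)).2 fun j => ?_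
  induction j using i.succAboveCases with
  | x => exact le_add_of_nonneg_right (norm_nonneg _)
  | p j => exact (norm_le_pi_norm (i.removeNth z) j).trans (le_add_of_nonneg_left (norm_nonneg _))

theorem norm_removeNth_le (i : Fin (n + 1)) (z : Fin (n + 1) → K) : ‖i.removeNth z‖ ≤ ‖z‖ :=
  (pi_norm_le_iff_of_nonneg (norm_nonneg _)).2 fun j => norm_le_pi_norm z (i.succAbove j)

theorem norm_graphAt_sub_le (φ : (Fin n → K) → K) (y : Fin n → K) (z : Fin (n + 1) → K) :
    ‖graphAt i φ y - z‖ ≤ ‖φ y - z i‖ + ‖y - i.removeNth z‖ := by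
  have h := norm_le_apply_add_removeNth i (graphAt i φ y - z)
  have e : i.removeNth (graphAt i φ y - z) = y - i.removeNth z := by
    ext j; simp [graphAt, Fin.removeNth]
  rwa [e, Pi.sub_apply, graphAt_apply_self] at h

theorem norm_graphAt_sub_graphAt_le (φ ψ : (Fin n → K) → K) (y : Fin n → K) :
    ‖graphAt i φ y - graphAt i ψ y‖ ≤ ‖φ y - ψ y‖ := by
  simpa [graphAt_apply_self, removeNth_graphAt] using
    norm_graphAt_sub_le (i := i) φ y (graphAt i ψ y)

variable {P R : T → (Fin n → K) → K} {F : T → (Fin (n + 1) → K) → K} {u : T → Fin (n + 1) → K}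
  {B Λ : ℝ}

theorem PolyFamily.comp_graphAt (hF : PolyFamily F) (hR : PolyFamily R) (i : Fin (n + 1)) :
    PolyFamily fun t y => F t (graphAt i (R t) y) := by
  refine hF.subst (G := fun j t y => graphAt i (R t) y j) fun j => ?_
  induction j using i.succAboveCases with
  | x => simpa only [graphAt_apply_self] using hR
  | p j => simpa [graphAt] using coord j

theorem PolyFamily.exists_norm_graphAt_le (hR : PolyFamily R) (hu : ∀ t, ‖u t‖ ≤ B)
    (hRu : ∀ t, R t (i.removeNth (u t)) = u t i) (ρ : ℝ) :
    ∃ κ N, 0 ≤ κ ∧ B ≤ N ∧ ∀ t y, ‖y‖ ≤ ρ →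
      ‖graphAt i (R t) y‖ ≤ N ∧ ‖graphAt i (R t) y - u t‖ ≤ κ * ‖y - i.removeNth (u t)‖ := by
  obtain ⟨A, hA, hlip⟩ := hR.lipschitz (max ρ B)
  refine ⟨A + 1, (A + 1) * (ρ + B) + B + (A + 1) * |ρ + B|, by positivity, ?_, fun t y hy => ?_⟩
  · nlinarith [neg_abs_le (ρ + B)]
  have hgraph : ‖graphAt i (R t) y - u t‖ ≤ (A + 1) * ‖y - i.removeNth (u t)‖ := by
    have hRy := hlip t y (i.removeNth (u t)) (hy.trans (le_max_left _ _))
      ((norm_removeNth_le i _).trans ((hu t).trans (le_max_right _ _)))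
    rw [hRu] at hRy
    linarith [norm_graphAt_sub_le (i := i) (R t) y (u t)]
  refine ⟨?_, hgraph⟩
  have hyu := norm_sub_le_of_le hy ((norm_removeNth_le i _).trans (hu t))
  nlinarith [norm_le_norm_sub_add (graphAt i (R t) y) (u t), hu t, abs_nonneg (ρ + B)]

theorem PolyFamily.exists_norm_graphAt_sub_le (hR : PolyFamily R) (hu : ∀ t, ‖u t‖ ≤ B)
    (hRu : ∀ t, R t (i.removeNth (u t)) = u t i) (hΛ₀ : 0 ≤ Λ)
    (hΛ : ∀ s t, ‖u s i - u t i‖ ≤ Λ * ‖i.removeNth (u s) - i.removeNth (u t)‖) (ρ : ℝ) :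
    ∃ κ N, 0 < κ ∧ B ≤ N ∧ ∀ s t y, ‖y‖ ≤ ρ → ‖graphAt i (R s) y‖ ≤ N ∧
      ‖graphAt i (R s) y - u t‖ ≤ κ * (‖y - i.removeNth (u t)‖ + ‖y - i.removeNth (u s)‖) := by
  obtain ⟨κ, N, hκ, hN, h⟩ := hR.exists_norm_graphAt_le hu hRu ρ
  refine ⟨κ + Λ + 1, N, by positivity, hN, fun s t y hy => ⟨(h s y hy).1, ?_⟩⟩
  set a := ‖y - i.removeNth (u t)‖
  set b := ‖y - i.removeNth (u s)‖
  have hab : ‖i.removeNth (u s) - i.removeNth (u t)‖ ≤ a + b := by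
    simpa only [sub_sub_sub_cancel_left] using
      norm_sub_le (y - i.removeNth (u t)) (y - i.removeNth (u s))
  have hst := norm_le_apply_add_removeNth i (u s - u t)
  have hsplit : i.removeNth (u s - u t) = i.removeNth (u s) - i.removeNth (u t) := rfl
  rw [Pi.sub_apply, hsplit] at hst
  calc ‖graphAt i (R s) y - u t‖ = ‖(graphAt i (R s) y - u s) + (u s - u t)‖ := by abel_nf
    _ ≤ κ * b + (Λ * (a + b) + (a + b)) :=
        norm_add_le_of_le (h s y hy).2
          (hst.trans (add_le_add ((hΛ s t).trans (by gcongr)) hab))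
    _ ≤ κ * (a + b) + (Λ * (a + b) + (a + b)) := by
        gcongr
        exact le_add_of_nonneg_left (norm_nonneg _)
    _ = _ := by ring

end GraphNorm

section Implicit

variable {K : Type*} [NontriviallyNormedField K] {T : Type*} {n j k : ℕ} {i : Fin (n + 1)}
  {P : T → (Fin (n + 1) → K) → K} {u : T → Fin (n + 1) → K} {R : T → (Fin n → K) → K}
  {B c Λ : ℝ}

theorem PolyFamily.exists_norm_sub_sub_partialDeriv_mul_le (hP : PolyFamily P) (i : Fin (n + 1))
    (N : ℝ) :
    ∃ C, 0 ≤ C ∧ ∀ t z (φ ψ : (Fin n → K) → K) y, ‖z‖ ≤ N → ‖graphAt i φ y‖ ≤ N →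
      ‖graphAt i ψ y‖ ≤ N →
      ‖P t (graphAt i φ y) - P t (graphAt i ψ y) - partialDeriv i (P t) z * (φ y - ψ y)‖ ≤
        C * (‖graphAt i φ y - z‖ + ‖graphAt i ψ y - z‖) * ‖φ y - ψ y‖ := by
  obtain ⟨C, hC, h⟩ := hP.exists_norm_sub_sub_fderiv_le N
  refine ⟨C, hC, fun t z φ ψ y hz hφ hψ => ?_⟩
  have htaylor := h t z _ _ hz hφ hψ
  have hfderiv : fderiv K (P t) z (graphAt i φ y - graphAt i ψ y) =
      partialDeriv i (P t) z * (φ y - ψ y) := by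
    simp [fderiv_apply_eq_sum_partialDeriv, Fin.sum_univ_succAbove _ i, graphAt]
  rw [hfderiv] at htaylor
  exact htaylor.trans (by gcongr; exact norm_graphAt_sub_graphAt_le φ ψ y)

theorem IsWhitney.exists_norm_fderiv_sub_le (h : IsWhitney (j + 2) u P) (hP : PolyFamily P)
    (hu : ∀ t, ‖u t‖ ≤ B) (hzero : ∀ t, P t (u t) = 0) :
    ∃ C, 0 ≤ C ∧ ∀ s t, ‖u s - u t‖ ≤ 1 →
      ‖fderiv K (P t) (u t) (u s - u t)‖ ≤ C * ‖u s - u t‖ ^ 2 := by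
  obtain ⟨C₁, hC₁, htaylor⟩ := hP.exists_norm_sub_sub_fderiv_le B
  obtain ⟨C₂, hC₂, hwhitney⟩ := h B
  refine ⟨C₂ + C₁, by positivity, fun s t hst => ?_⟩
  have h₁ := htaylor t (u t) (u s) (u t) (hu t) (hu s) (hu t)
  have h₂ := hwhitney s t (u s) (hu s)
  rw [hzero, sub_zero, sub_self, norm_zero, add_zero, mul_assoc, ← pow_two] at h₁
  rw [sub_self, norm_zero, add_zero, hzero, sub_zero] at h₂
  have hpow : ‖u s - u t‖ ^ (j + 2) ≤ ‖u s - u t‖ ^ 2 :=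
    pow_le_pow_of_le_one (norm_nonneg _) hst (by lia)
  calc ‖fderiv K (P t) (u t) (u s - u t)‖
      = ‖P t (u s) - (P t (u s) - fderiv K (P t) (u t) (u s - u t))‖ := by rw [sub_sub_cancel]
    _ ≤ C₂ * ‖u s - u t‖ ^ 2 + C₁ * ‖u s - u t‖ ^ 2 :=
        norm_sub_le_of_le (h₂.trans (by gcongr)) h₁
    _ = _ := by ring

theorem PolyFamily.exists_norm_partialDeriv_mul_le (hP : PolyFamily P) (i : Fin (n + 1)) (N : ℝ) :
    ∃ E, 0 ≤ E ∧ ∀ t z v, ‖z‖ ≤ N →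
      ‖partialDeriv i (P t) z * v i‖ ≤ ‖fderiv K (P t) z v‖ + E * ‖i.removeNth v‖ := by
  choose D hD hbound using fun j => (hP.partialDeriv j).bounded N
  refine ⟨∑ j, D (i.succAbove j), Finset.sum_nonneg fun j _ => hD _, fun t z v hz => ?_⟩
  rw [fderiv_apply_eq_sum_partialDeriv, Fin.sum_univ_succAbove _ i, Finset.sum_mul]
  refine norm_le_add_norm_add _ _ |>.trans (add_le_add_right ?_ _)
  exact norm_sum_le_of_le _ fun j _ => norm_mul_le_of_le (hbound _ t _ hz)
    (norm_le_pi_norm (i.removeNth v) j)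

theorem IsWhitney.exists_lipschitz (h : IsWhitney (j + 2) u P) (hP : PolyFamily P)
    (hu : ∀ t, ‖u t‖ ≤ B) (hzero : ∀ t, P t (u t) = 0) (hc : 0 < c)
    (hpd : ∀ t, c ≤ ‖partialDeriv i (P t) (u t)‖) :
    ∃ δ, 0 < δ ∧ ∃ Λ, 0 ≤ Λ ∧ ∀ s t, ‖u s - u t‖ ≤ δ →
      ‖u s i - u t i‖ ≤ Λ * ‖i.removeNth (u s) - i.removeNth (u t)‖ := by
  obtain ⟨C, hC, hsecant⟩ := h.exists_norm_fderiv_sub_le hP hu hzero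
  obtain ⟨E, hE, hcoord⟩ := hP.exists_norm_partialDeriv_mul_le i B
  refine ⟨min 1 (c / (2 * (C + 1))), by positivity, 2 / c * (E + c / 2), by positivity,
    fun s t hst => ?_⟩
  set Δ := ‖u s - u t‖
  set Δ' := ‖i.removeNth (u s) - i.removeNth (u t)‖
  have hΔ₀ : 0 ≤ Δ := norm_nonneg _
  have hΔ : C * Δ ≤ c / 2 := by
    have := hst.trans (min_le_right _ _)
    rw [le_div_iff₀ (by positivity)] at this
    linarith
  have hsplit : Δ ≤ ‖u s i - u t i‖ + Δ' := norm_le_apply_add_removeNth i (u s - u t)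
  have hsmall : C * Δ ^ 2 ≤ c / 2 * (‖u s i - u t i‖ + Δ') := by
    rw [pow_two, ← mul_assoc]; gcongr
  have hmain : c * ‖u s i - u t i‖ ≤ C * Δ ^ 2 + E * Δ' :=
    calc c * ‖u s i - u t i‖ ≤ ‖partialDeriv i (P t) (u t)‖ * ‖u s i - u t i‖ := by
          gcongr; exact hpd t
      _ = ‖partialDeriv i (P t) (u t) * (u s - u t) i‖ := (norm_mul _ _).symm
      _ ≤ _ := (hcoord t _ _ (hu t)).trans
          (add_le_add_left (hsecant s t (hst.trans (min_le_left _ _))) _)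
  calc ‖u s i - u t i‖ = 2 / c * (c / 2 * ‖u s i - u t i‖) := by field_simp
    _ ≤ 2 / c * ((E + c / 2) * Δ') := mul_le_mul_of_nonneg_left (by linarith) (by positivity)
    _ = _ := by ring

theorem PolyFamily.exists_newton_step (hP : PolyFamily P) (hu : ∀ t, ‖u t‖ ≤ B)
    (hzero : ∀ t, P t (u t) = 0) (hc : 0 < c) (hpd : ∀ t, c ≤ ‖partialDeriv i (P t) (u t)‖)
    (hR : PolyFamily R) (hRu : ∀ t, R t (i.removeNth (u t)) = u t i)
    (hRP : ∀ ρ, ∃ C, 0 ≤ C ∧ ∀ t y, ‖y‖ ≤ ρ →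
      ‖P t (graphAt i (R t) y)‖ ≤ C * ‖y - i.removeNth (u t)‖ ^ k) :
    ∃ R' : T → (Fin n → K) → K, PolyFamily R' ∧ (∀ t, R' t (i.removeNth (u t)) = u t i) ∧
      ∀ ρ, ∃ C, 0 ≤ C ∧ ∀ t y, ‖y‖ ≤ ρ →
        ‖P t (graphAt i (R' t) y)‖ ≤ C * ‖y - i.removeNth (u t)‖ ^ (k + 1) := by
  have hnorm_inv : ∀ t, ‖(partialDeriv i (P t) (u t))⁻¹‖ ≤ c⁻¹ := fun t => by
    rw [norm_inv]; exact inv_anti₀ hc (hpd t)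
  set R' : T → (Fin n → K) → K :=
    fun t y => R t y - (partialDeriv i (P t) (u t))⁻¹ * P t (graphAt i (R t) y)
  have hR' : PolyFamily R' := hR.sub ((param _ c⁻¹ hnorm_inv).mul (hP.comp_graphAt hR i))
  have hR'u : ∀ t, R' t (i.removeNth (u t)) = u t i := fun t => by
    simp only [R', graphAt_removeNth (hRu t), hRu, hzero, mul_zero, sub_zero]
  refine ⟨R', hR', hR'u, fun ρ => ?_⟩
  obtain ⟨C, hC, hRP⟩ := hRP ρ
  obtain ⟨κ₁, N₁, hκ₁, hN₁, hgraph⟩ := hR.exists_norm_graphAt_le hu hRu ρ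
  obtain ⟨κ₂, N₂, hκ₂, -, hgraph'⟩ := hR'.exists_norm_graphAt_le hu hR'u ρ
  obtain ⟨A, hA, htaylor⟩ := hP.exists_norm_sub_sub_partialDeriv_mul_le i (max N₁ N₂)
  refine ⟨A * (κ₂ + κ₁) * (c⁻¹ * C), by positivity, fun t y hy => ?_⟩
  have ht := htaylor t (u t) (R' t) (R t) y ((hu t).trans (hN₁.trans (le_max_left _ _)))
    ((hgraph' t y hy).1.trans (le_max_right _ _)) ((hgraph t y hy).1.trans (le_max_left _ _))
  have hne : partialDeriv i (P t) (u t) ≠ 0 := norm_pos_iff.1 (hc.trans_le (hpd t))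
  have hstep : R' t y - R t y = -((partialDeriv i (P t) (u t))⁻¹ * P t (graphAt i (R t) y)) := by
    simp [R']
  have hlinear : P t (graphAt i (R' t) y) - P t (graphAt i (R t) y)
      - partialDeriv i (P t) (u t) * (R' t y - R t y) = P t (graphAt i (R' t) y) := by
    rw [hstep, mul_neg, mul_inv_cancel_left₀ hne]; ring
  calc _ ≤ _ := hlinear ▸ ht
    _ ≤ A * (κ₂ * ‖y - i.removeNth (u t)‖ + κ₁ * ‖y - i.removeNth (u t)‖) *
        (c⁻¹ * (C * ‖y - i.removeNth (u t)‖ ^ k)) := by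
      gcongr
      · exact (hgraph' t y hy).2
      · exact (hgraph t y hy).2
      · rw [hstep, norm_neg]
        exact norm_mul_le_of_le (hnorm_inv t) (hRP t y hy)
    _ = _ := by ring

/-- Newton's iteration, started at a constant, gains one order of vanishing in each step. -/
theorem PolyFamily.exists_implicit (hP : PolyFamily P) (hu : ∀ t, ‖u t‖ ≤ B)
    (hzero : ∀ t, P t (u t) = 0) (hc : 0 < c) (hpd : ∀ t, c ≤ ‖partialDeriv i (P t) (u t)‖)
    (k : ℕ) :
    ∃ R : T → (Fin n → K) → K, PolyFamily R ∧ (∀ t, R t (i.removeNth (u t)) = u t i) ∧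
      ∀ ρ, ∃ C, 0 ≤ C ∧ ∀ t y, ‖y‖ ≤ ρ →
        ‖P t (graphAt i (R t) y)‖ ≤ C * ‖y - i.removeNth (u t)‖ ^ k := by
  induction k with
  | zero =>
    have hR : PolyFamily fun t (_ : Fin n → K) => u t i :=
      param _ B fun t => (norm_le_pi_norm _ i).trans (hu t)
    refine ⟨fun t _ => u t i, hR, fun t => rfl, fun ρ => ?_⟩
    simpa using (hP.comp_graphAt hR i).bounded ρ
  | succ k ih =>
    obtain ⟨R, hR, hRu, hRP⟩ := ih
    exact hP.exists_newton_step hu hzero hc hpd hR hRu hRP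

theorem PolyFamily.exists_norm_sub_le_of_graphAt (hP : PolyFamily P) (hu : ∀ t, ‖u t‖ ≤ B)
    (hc : 0 < c) (hpd : ∀ t, c ≤ ‖partialDeriv i (P t) (u t)‖) (N : ℝ) (hN : B ≤ N) :
    ∃ ε, 0 < ε ∧ ∀ t (φ ψ : (Fin n → K) → K) y, ‖graphAt i φ y‖ ≤ N → ‖graphAt i ψ y‖ ≤ N →
      ‖graphAt i φ y - u t‖ ≤ ε → ‖graphAt i ψ y - u t‖ ≤ ε →
      ‖φ y - ψ y‖ ≤ 2 / c * ‖P t (graphAt i φ y) - P t (graphAt i ψ y)‖ := by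
  obtain ⟨A, hA, htaylor⟩ := hP.exists_norm_sub_sub_partialDeriv_mul_le i N
  refine ⟨c / (4 * (A + 1)), by positivity, fun t φ ψ y hφ hψ hφu hψu => ?_⟩
  have ht := htaylor t (u t) φ ψ y ((hu t).trans hN) hφ hψ
  have hsmall : A * (‖graphAt i φ y - u t‖ + ‖graphAt i ψ y - u t‖) ≤ c / 2 :=
    calc _ ≤ (A + 1) * (c / (4 * (A + 1)) + c / (4 * (A + 1))) := by gcongr; linarith
      _ = c / 2 := by field_simp; norm_num
  have hlower : c * ‖φ y - ψ y‖ ≤ ‖partialDeriv i (P t) (u t) * (φ y - ψ y)‖ := by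
    rw [norm_mul]; gcongr; exact hpd t
  have hupper := norm_le_norm_add_norm_sub
    (P t (graphAt i φ y) - P t (graphAt i ψ y)) (partialDeriv i (P t) (u t) * (φ y - ψ y))
  have hhalf : c / 2 * ‖φ y - ψ y‖ ≤ ‖P t (graphAt i φ y) - P t (graphAt i ψ y)‖ := by
    nlinarith [mul_le_mul_of_nonneg_right hsmall (norm_nonneg (φ y - ψ y))]
  calc ‖φ y - ψ y‖ = 2 / c * (c / 2 * ‖φ y - ψ y‖) := by field_simp
    _ ≤ _ := by gcongr

theorem PolyFamily.isWhitney_of_near {v : T → Fin n → K} (hR : PolyFamily R)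
    (h : ∀ ρ : ℝ, ∃ r, 0 < r ∧ ∃ C, 0 ≤ C ∧ ∀ s t y, ‖y‖ ≤ ρ → ‖y - v t‖ + ‖y - v s‖ ≤ r →
      ‖R t y - R s y‖ ≤ C * (‖y - v t‖ + ‖y - v s‖) ^ j) : IsWhitney j v R := by
  intro ρ
  obtain ⟨r, hr, C, hC, hnear⟩ := h ρ
  obtain ⟨D, hD, hbound⟩ := hR.bounded ρ
  refine ⟨C + 2 * D / r ^ j, by positivity, fun s t y hy => ?_⟩
  rcases le_or_gt (‖y - v t‖ + ‖y - v s‖) r with hle | hlt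
  · refine (hnear s t y hy hle).trans ?_
    gcongr
    exact le_add_of_nonneg_right (by positivity)
  · calc ‖R t y - R s y‖ ≤ 2 * D := by
          rw [two_mul]; exact norm_sub_le_of_le (hbound t y hy) (hbound s y hy)
      _ = 2 * D / r ^ j * r ^ j := by field_simp
      _ ≤ _ := by
        gcongr
        exact le_add_of_nonneg_left hC

theorem IsWhitney.implicit (h : IsWhitney j u P) (hP : PolyFamily P)
    (hu : ∀ t, ‖u t‖ ≤ B) (hc : 0 < c)
    (hpd : ∀ t, c ≤ ‖partialDeriv i (P t) (u t)‖) (hΛ₀ : 0 ≤ Λ)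
    (hΛ : ∀ s t, ‖u s i - u t i‖ ≤ Λ * ‖i.removeNth (u s) - i.removeNth (u t)‖)
    (hR : PolyFamily R) (hRu : ∀ t, R t (i.removeNth (u t)) = u t i)
    (hRP : ∀ ρ, ∃ C, 0 ≤ C ∧ ∀ t y, ‖y‖ ≤ ρ →
        ‖P t (graphAt i (R t) y)‖ ≤ C * ‖y - i.removeNth (u t)‖ ^ j) :
    IsWhitney j (fun t => i.removeNth (u t)) R := by
  refine hR.isWhitney_of_near fun ρ => ?_
  obtain ⟨CE, hCE, herror⟩ := hRP ρ
  obtain ⟨κ, N, hκ, hN, hgraph⟩ := hR.exists_norm_graphAt_sub_le hu hRu hΛ₀ hΛ ρ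
  obtain ⟨CW, hCW, hwhitney⟩ := h N
  obtain ⟨ε, hε, hinverse⟩ := hP.exists_norm_sub_le_of_graphAt hu hc hpd N hN
  refine ⟨ε / (2 * κ), by positivity, 2 / c * (CE + (CW * (3 * κ) ^ j + CE)), by positivity,
    fun s t y hy hr => ?_⟩
  have hst := hgraph s t y hy
  have htt := hgraph t t y hy
  have hss := hgraph s s y hy
  set a := ‖y - i.removeNth (u t)‖
  set b := ‖y - i.removeNth (u s)‖
  have ha : 0 ≤ κ * a := mul_nonneg hκ.le (norm_nonneg _)
  have hb : 0 ≤ κ * b := mul_nonneg hκ.le (norm_nonneg _)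
  have hε' : κ * (2 * (a + b)) ≤ ε := by
    have := (le_div_iff₀ (by positivity)).1 hr
    linarith
  have hjet : ‖P t (graphAt i (R s) y) - P s (graphAt i (R s) y)‖ ≤
      CW * (3 * κ * (a + b)) ^ j :=
    (hwhitney s t _ hst.1).trans (by gcongr; linarith)
  have hdiff : ‖P t (graphAt i (R t) y) - P t (graphAt i (R s) y)‖ ≤
      (CE + (CW * (3 * κ) ^ j + CE)) * (a + b) ^ j :=
    calc _ = ‖P t (graphAt i (R t) y) - ((P t (graphAt i (R s) y) - P s (graphAt i (R s) y))
          + P s (graphAt i (R s) y))‖ := by rw [sub_add_cancel]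
      _ ≤ CE * (a + b) ^ j + (CW * (3 * κ * (a + b)) ^ j + CE * (a + b) ^ j) :=
        norm_sub_le_of_le
          ((herror t y hy).trans (by gcongr; exact le_add_of_nonneg_right (norm_nonneg _)))
          (norm_add_le_of_le hjet
            ((herror s y hy).trans (by gcongr; exact le_add_of_nonneg_left (norm_nonneg _))))
      _ = _ := by rw [mul_pow (3 * κ)]; ring
  calc ‖R t y - R s y‖ ≤ 2 / c * ‖P t (graphAt i (R t) y) - P t (graphAt i (R s) y)‖ :=
        hinverse t _ _ y htt.1 hst.1 (by linarith) (by linarith)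
    _ ≤ 2 / c * ((CE + (CW * (3 * κ) ^ j + CE)) * (a + b) ^ j) := by gcongr
    _ = _ := by ring

theorem IsWhitney.comp_graphAt {F : T → (Fin (n + 1) → K) → K}
    (h : IsWhitney (j + k) u F) (hF : IsFlat k u F)
    (hu : ∀ t, ‖u t‖ ≤ B) (hΛ₀ : 0 ≤ Λ)
    (hΛ : ∀ s t, ‖u s i - u t i‖ ≤ Λ * ‖i.removeNth (u s) - i.removeNth (u t)‖)
    (hR : PolyFamily R) (hRu : ∀ t, R t (i.removeNth (u t)) = u t i)
    (hRW : IsWhitney j (fun t => i.removeNth (u t)) R) :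
    IsWhitney (j + k) (fun t => i.removeNth (u t)) fun t y => F t (graphAt i (R t) y) := by
  intro ρ
  obtain ⟨κ, N, hκ, -, hgraph⟩ := hR.exists_norm_graphAt_sub_le hu hRu hΛ₀ hΛ ρ
  obtain ⟨CR, hCR, hRst⟩ := hRW ρ
  obtain ⟨CW, hCW, hFst⟩ := h N
  obtain ⟨CF, hCF, hFt⟩ := hF N
  refine ⟨CF * (3 * κ) ^ k * CR + CW * (3 * κ) ^ (j + k), by positivity, fun s t y hy => ?_⟩
  have hst := hgraph s t y hy
  have htt := hgraph t t y hy
  have hss := hgraph s s y hy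
  have hR' := hRst s t y hy
  set a := ‖y - i.removeNth (u t)‖
  set b := ‖y - i.removeNth (u s)‖
  have ha : 0 ≤ κ * a := mul_nonneg hκ.le (norm_nonneg _)
  have hb : 0 ≤ κ * b := mul_nonneg hκ.le (norm_nonneg _)
  have hclose := (norm_graphAt_sub_graphAt_le (i := i) (R t) (R s) y).trans hR'
  calc ‖F t (graphAt i (R t) y) - F s (graphAt i (R s) y)‖
      = ‖(F t (graphAt i (R t) y) - F t (graphAt i (R s) y))
        + (F t (graphAt i (R s) y) - F s (graphAt i (R s) y))‖ := by rw [sub_add_sub_cancel]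
    _ ≤ CF * (3 * κ * (a + b)) ^ k * (CR * (a + b) ^ j) + CW * (3 * κ * (a + b)) ^ (j + k) :=
        norm_add_le_of_le ((hFt t _ _ htt.1 hst.1).trans (by gcongr; linarith))
          ((hFst s t _ hst.1).trans (by gcongr; linarith))
    _ = _ := by rw [mul_pow (3 * κ), mul_pow (3 * κ), pow_add (a + b)]; ring

end Implicit

section BallScaling

variable {K : Type*} [NontriviallyNormedField K] [MeasurableSpace K] [BorelSpace K]
  (μ : Measure K) [μ.IsAddHaarMeasure]

theorem measure_closedBall_norm_mul [ProperSpace K] (c : Kˣ) (r : ℝ) :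
    μ (Metric.closedBall 0 (‖(c : K)‖ * r)) =
      distribHaarChar K c * μ (Metric.closedBall 0 r) := by
  have h := smul_closedBall' c.ne_zero (0 : K) r
  rw [smul_zero] at h
  rw [← h]
  exact (distribHaarChar_mul μ c _).symm

theorem two_mul_measure_closedBall_le {x : K} (hx₀ : 0 < ‖x‖) (hx : ‖x‖ < 1 / 2) :
    2 * μ (Metric.closedBall 0 (‖x‖ ^ 2)) ≤ μ (Metric.closedBall 0 1) := by
  have hdisj : Disjoint (Metric.closedBall (0 : K) (‖x‖ ^ 2)) (Metric.closedBall x (‖x‖ ^ 2)) :=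
    Metric.closedBall_disjoint_closedBall (by rw [dist_zero_left]; nlinarith)
  have hsub : Metric.closedBall (0 : K) (‖x‖ ^ 2) ∪ Metric.closedBall x (‖x‖ ^ 2) ⊆
      Metric.closedBall 0 1 :=
    union_subset (Metric.closedBall_subset_closedBall (by nlinarith))
      (Metric.closedBall_subset_closedBall' (by rw [dist_zero_right]; nlinarith))
  calc 2 * μ (Metric.closedBall 0 (‖x‖ ^ 2))
      = μ (Metric.closedBall 0 (‖x‖ ^ 2) ∪ Metric.closedBall x (‖x‖ ^ 2)) := by
        rw [measure_union hdisj measurableSet_closedBall, Measure.addHaar_closedBall_center μ x,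
          two_mul]
    _ ≤ _ := measure_mono hsub

variable [ProperSpace K]

theorem exists_measure_closedBall_pow_mul :
    ∃ (η : ℝ) (θ : ENNReal), 0 < η ∧ η < 1 ∧ θ ≠ 0 ∧ θ < 1 ∧ ∀ (N : ℕ) (r : ℝ),
      μ (Metric.closedBall 0 (η ^ N * r)) = θ ^ N * μ (Metric.closedBall 0 r) := by
  obtain ⟨x, hx₀, hx₁⟩ := NormedField.exists_norm_lt K (show (0 : ℝ) < 1 / 2 by norm_num)
  obtain ⟨θ, hscale⟩ : ∃ θ : ENNReal, ∀ r : ℝ,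
      μ (Metric.closedBall 0 (‖x‖ ^ 2 * r)) = θ * μ (Metric.closedBall 0 r) :=
    ⟨_, fun r => by
      rw [← norm_pow]
      exact measure_closedBall_norm_mul μ
        (Units.mk0 (x ^ 2) (pow_ne_zero 2 (norm_pos_iff.1 hx₀))) r⟩
  have hV : μ (Metric.closedBall 0 1) ≠ 0 := (Metric.measure_closedBall_pos μ 0 one_pos).ne'
  have hV' : μ (Metric.closedBall 0 1) ≠ ⊤ := (isCompact_closedBall 0 1).measure_lt_top.ne
  have htwo : 2 * θ ≤ 1 := by
    have h := two_mul_measure_closedBall_le μ hx₀ hx₁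
    rw [← mul_one (‖x‖ ^ 2), hscale, ← mul_assoc] at h
    exact (ENNReal.mul_le_mul_iff_left hV hV').1 (h.trans_eq (one_mul _).symm)
  refine ⟨‖x‖ ^ 2, θ, by positivity, by nlinarith, fun hθ => ?_, lt_of_not_ge fun hθ => ?_,
    fun N r => ?_⟩
  · have h := hscale 1
    rw [hθ, zero_mul] at h
    exact (Metric.measure_closedBall_pos μ 0 (by positivity)).ne' h
  · have : (2 : ENNReal) * 1 ≤ 1 := (mul_le_mul_right hθ 2).trans htwo
    norm_num at this
  · induction N with
    | zero => simp
    | succ N ih => rw [pow_succ' (‖x‖ ^ 2), pow_succ' θ, mul_assoc, mul_assoc, hscale, ih]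

theorem pi_measure_closedBall {n : ℕ} (x : Fin n → K) {r : ℝ} (hr : 0 ≤ r) :
    (Measure.pi fun _ : Fin n => μ) (Metric.closedBall x r) = μ (Metric.closedBall 0 r) ^ n := by
  rw [Measure.pi_closedBall _ _ hr]
  simp [Measure.addHaar_closedBall_center μ]

end BallScaling

section Holder

variable {T X Y : Type*} [NormedAddCommGroup X] [NormedAddCommGroup Y] {u : T → X} {f : T → Y}
  {B C r ρ : ℝ} {l : ℕ}

/-- A neighbourhood of the set of the pairs `(u t, f t)`. Fubini's theorem for it compares the
measures of the ranges of `u` and `f`. -/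
def pairNhd (u : T → X) (f : T → Y) (r ρ : ℝ) : Set (X × Y) :=
  ⋃ t, Metric.ball (u t) r ×ˢ Metric.ball (f t) ρ

theorem isOpen_pairNhd : IsOpen (pairNhd u f r ρ) :=
  isOpen_iUnion fun _ => Metric.isOpen_ball.prod Metric.isOpen_ball

theorem preimage_pairNhd_subset_closedBall (hC : 0 ≤ C)
    (hf : ∀ s t, ‖f s - f t‖ ≤ C * ‖u s - u t‖ ^ l) {t : T} {x : X}
    (hx : x ∈ Metric.ball (u t) r) :
    Prod.mk x ⁻¹' pairNhd u f r (r ^ l) ⊆ Metric.closedBall (f t) (r ^ l * (1 + C * 2 ^ l)) := by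
  intro y hy
  obtain ⟨s, hxs, hys⟩ := mem_iUnion.1 hy
  have hst : ‖u s - u t‖ ≤ 2 * r := by
    have h := norm_sub_le (x - u t) (x - u s)
    rw [sub_sub_sub_cancel_left] at h
    linarith [mem_ball_iff_norm.1 hx, mem_ball_iff_norm.1 hxs]
  rw [mem_closedBall_iff_norm]
  calc ‖y - f t‖ = ‖(y - f s) + (f s - f t)‖ := by rw [sub_add_sub_cancel]
    _ ≤ r ^ l + C * (2 * r) ^ l :=
        norm_add_le_of_le (mem_ball_iff_norm.1 hys).le ((hf s t).trans (by gcongr))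
    _ = _ := by ring

variable [MeasurableSpace X] [OpensMeasurableSpace X] [SecondCountableTopology X]
  [MeasurableSpace Y] [OpensMeasurableSpace Y] (lam : Measure X) (ν : Measure Y) [SFinite ν]
  {V : ENNReal}

theorem measure_pairNhd_le (hC : 0 ≤ C) (hu : ∀ t, ‖u t‖ ≤ B)
    (hf : ∀ s t, ‖f s - f t‖ ≤ C * ‖u s - u t‖ ^ l)
    (hV : ∀ t, ν (Metric.closedBall (f t) (r ^ l * (1 + C * 2 ^ l))) ≤ V) :
    (lam.prod ν) (pairNhd u f r (r ^ l)) ≤ V * lam (Metric.closedBall 0 (B + r)) := by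
  rw [Measure.prod_apply isOpen_pairNhd.measurableSet]
  calc ∫⁻ x, ν (Prod.mk x ⁻¹' pairNhd u f r (r ^ l)) ∂lam
      ≤ ∫⁻ x, (Metric.closedBall 0 (B + r)).indicator (fun _ => V) x ∂lam := by
        refine lintegral_mono fun x => ?_
        rcases (Prod.mk x ⁻¹' pairNhd u f r (r ^ l)).eq_empty_or_nonempty with he | ⟨y, hy⟩
        · simp [he]
        obtain ⟨t, hx, -⟩ := mem_iUnion.1 hy
        have hxB : x ∈ Metric.closedBall 0 (B + r) := by
          rw [mem_closedBall_zero_iff]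
          linarith [mem_ball_iff_norm.1 hx, norm_le_norm_sub_add x (u t), hu t]
        rw [indicator_of_mem hxB]
        exact (measure_mono (preimage_pairNhd_subset_closedBall hC hf hx)).trans (hV t)
    _ = _ := lintegral_indicator_const measurableSet_closedBall _

theorem measure_range_mul_le_measure_pairNhd [SFinite lam] (hm : MeasurableSet (range f))
    (hρ : 0 < ρ) (hV : ∀ t, V ≤ lam (Metric.ball (u t) r)) :
    ν (range f) * V ≤ (lam.prod ν) (pairNhd u f r ρ) := by
  rw [Measure.prod_apply_symm isOpen_pairNhd.measurableSet, mul_comm, ← setLIntegral_const]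
  refine (setLIntegral_mono' hm ?_).trans (setLIntegral_le_lintegral _ _)
  rintro _ ⟨t, rfl⟩
  exact (hV t).trans
    (measure_mono fun x hx => mem_iUnion.2 ⟨t, hx, Metric.mem_ball_self hρ⟩)

end Holder

section NullRange

variable {K : Type*} [NontriviallyNormedField K] [ProperSpace K] [MeasurableSpace K] [BorelSpace K]
  (μ : Measure K) [μ.IsAddHaarMeasure] {T : Type*} {n b l : ℕ} {u : T → Fin n → K}
  {f : T → Fin b → K} {B C : ℝ}

theorem pow_mul_measure_range_le_of_holder {η : ℝ} {θ : ENNReal} (hη₀ : 0 < η) (hη₁ : η < 1)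
    (hscale : ∀ (N : ℕ) (r : ℝ),
      μ (Metric.closedBall 0 (η ^ N * r)) = θ ^ N * μ (Metric.closedBall 0 r))
    (hC : 0 ≤ C) (hu : ∀ t, ‖u t‖ ≤ B) (hf : ∀ s t, ‖f s - f t‖ ≤ C * ‖u s - u t‖ ^ l)
    (hm : MeasurableSet (range f)) (N : ℕ) :
    (Measure.pi fun _ : Fin b => μ) (range f) *
        (θ ^ (N + 1) * μ (Metric.closedBall 0 1)) ^ n ≤
      (θ ^ (N * l) * μ (Metric.closedBall 0 (1 + C * 2 ^ l))) ^ b *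
        (Measure.pi fun _ : Fin n => μ) (Metric.closedBall 0 (B + 1)) := by
  refine (measure_range_mul_le_measure_pairNhd (u := u) (r := η ^ N) (ρ := (η ^ N) ^ l)
    (Measure.pi fun _ : Fin n => μ) _ hm (by positivity) fun t => ?_).trans
    ((measure_pairNhd_le (V := (θ ^ (N * l) * μ (Metric.closedBall 0 (1 + C * 2 ^ l))) ^ b)
      (Measure.pi fun _ : Fin n => μ) _ hC hu hf fun t => ?_).trans ?_)
  · rw [← hscale, ← pi_measure_closedBall μ (u t) (by positivity), mul_one]
    exact measure_mono
      (Metric.closedBall_subset_ball (pow_lt_pow_right_of_lt_one₀ hη₀ hη₁ N.lt_succ_self))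
  · rw [← hscale, ← pi_measure_closedBall μ (f t) (by positivity), pow_mul]
  · gcongr
    exact pow_le_one₀ hη₀.le hη₁.le

theorem measure_range_eq_zero_of_holder (hl : n < l * b) (hC : 0 ≤ C) (hu : ∀ t, ‖u t‖ ≤ B)
    (hf : ∀ s t, ‖f s - f t‖ ≤ C * ‖u s - u t‖ ^ l) (hm : MeasurableSet (range f)) :
    (Measure.pi fun _ : Fin b => μ) (range f) = 0 := by
  obtain ⟨η, θ, hη₀, hη₁, hθ₀, hθ₁, hscale⟩ := exists_measure_closedBall_pow_mul μ
  set ν := Measure.pi fun _ : Fin b => μ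
  set V := μ (Metric.closedBall 0 1)
  set W := μ (Metric.closedBall 0 (1 + C * 2 ^ l)) ^ b *
    (Measure.pi fun _ : Fin n => μ) (Metric.closedBall 0 (B + 1))
  have hW : W ≠ ⊤ := ENNReal.mul_ne_top
    (ENNReal.pow_ne_top (isCompact_closedBall 0 _).measure_lt_top.ne)
    (isCompact_closedBall 0 _).measure_lt_top.ne
  obtain ⟨k, hk⟩ : ∃ k, l * b = n + (k + 1) := ⟨l * b - n - 1, by lia⟩
  have hdecay : ∀ N : ℕ, ν (range f) * (θ * V) ^ n ≤ θ ^ N * W := fun N => by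
    have hθN : θ ^ (N * n) ≠ ⊤ := ENNReal.pow_ne_top (hθ₁.trans ENNReal.one_lt_top).ne
    refine (ENNReal.mul_le_mul_iff_right (pow_ne_zero _ hθ₀) hθN).1 ?_
    calc θ ^ (N * n) * (ν (range f) * (θ * V) ^ n) = ν (range f) * (θ ^ (N + 1) * V) ^ n := by
          rw [pow_succ, mul_assoc (θ ^ N), mul_pow (θ ^ N), ← pow_mul]; ring
      _ ≤ _ := pow_mul_measure_range_le_of_holder μ hη₀ hη₁ hscale hC hu hf hm N
      _ = θ ^ (N * n) * (θ ^ (N * (k + 1)) * W) := by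
          rw [mul_pow, ← pow_mul, mul_assoc N, hk, mul_add, pow_add]; ring
      _ ≤ θ ^ (N * n) * (θ ^ N * W) := by
          gcongr θ ^ (N * n) * (?_ * W)
          exact pow_le_pow_of_le_one zero_le hθ₁.le (Nat.le_mul_of_pos_right _ k.succ_pos)
  have hlim : Filter.Tendsto (fun N : ℕ => θ ^ N * W) Filter.atTop (nhds (0 * W)) :=
    ENNReal.Tendsto.mul_const (ENNReal.tendsto_pow_atTop_nhds_zero_of_lt_one hθ₁) (Or.inr hW)
  have hle := ge_of_tendsto' hlim hdecay
  rw [zero_mul, nonpos_iff_eq_zero, mul_eq_zero] at hle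
  exact hle.resolve_right
    (pow_ne_zero _ (mul_ne_zero hθ₀ (Metric.measure_closedBall_pos μ 0 one_pos).ne'))

end NullRange

theorem measure_range_eq_zero_of_cover {T Y ι : Type*} [Countable ι] [MeasurableSpace Y]
    (ν : Measure Y) (f : T → Y) (S : ι → Set T) (hS : ∀ t, ∃ k, t ∈ S k)
    (h : ∀ k, ν (range fun t : S k => f t) = 0) : ν (range f) = 0 := by
  refine measure_mono_null ?_ (measure_iUnion_null h)
  rintro _ ⟨t, rfl⟩
  obtain ⟨k, hk⟩ := hS t
  exact mem_iUnion.2 ⟨k, ⟨t, hk⟩, rfl⟩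

section Critical

variable {K : Type*} [NontriviallyNormedField K] {T S : Type*} {n b l k : ℕ} {B : ℝ}

/-- `K^b`-valued Whitney jets of order `l`, represented by bounded families of polynomials, at the
points `u t` which depend continuously on the parameter `t`. -/
structure IsJetFamily [TopologicalSpace T] (l : ℕ) (u : T → Fin n → K)
    (F : Fin b → T → (Fin n → K) → K) : Prop where
  continuous : Continuous u
  polyFamily : ∀ j, PolyFamily (F j)
  isWhitney : ∀ j, IsWhitney l u (F j)

/-- The partial derivatives of the orders `1, …, k` of all `F j t` vanish at `u t`. -/
def DerivsVanish (k : ℕ) (u : T → Fin n → K) (F : Fin b → T → (Fin n → K) → K) : Prop :=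
  ∀ j t, ∀ L : List (Fin n), 1 ≤ L.length → L.length ≤ k → iterPartialDeriv L (F j t) (u t) = 0

/-- The differential of `(F j t)_j` at `u t` is not onto `K^b`: it is annihilated by a nonzero
linear form. -/
def IsCritical (u : T → Fin n → K) (F : Fin b → T → (Fin n → K) → K) (t : T) : Prop :=
  ∃ v : Fin b → K, v ≠ 0 ∧ HasFDerivAt (fun z => ∑ j, v j * F j t z) (0 : (Fin n → K) →L[K] K) (u t)

namespace IsJetFamily

variable [TopologicalSpace T] [TopologicalSpace S] {u : T → Fin n → K}
  {F : Fin b → T → (Fin n → K) → K}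

theorem comp_index {σ : S → T} (hF : IsJetFamily l u F) (hσ : Continuous σ) :
    IsJetFamily l (fun s => u (σ s)) (fun j s => F j (σ s)) :=
  ⟨hF.continuous.comp hσ, fun j => (hF.polyFamily j).comp_index σ,
    fun j => (hF.isWhitney j).comp_index σ⟩

theorem restrict (hF : IsJetFamily l u F) (A : Set T) :
    IsJetFamily l (fun t : A => u t) (fun j (t : A) => F j t) :=
  hF.comp_index continuous_subtype_val

variable [CompactSpace T]

theorem exists_norm_le (hF : IsJetFamily l u F) : ∃ B, ∀ t, ‖u t‖ ≤ B := by
  obtain ⟨B, hB⟩ := (isCompact_range hF.continuous).isBounded.exists_norm_le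
  exact ⟨B, fun t => hB _ (mem_range_self t)⟩

theorem continuous_iterPartialDeriv (hF : IsJetFamily l u F) (j : Fin b) {L : List (Fin n)}
    (hL : L.length < l) : Continuous fun t => iterPartialDeriv L (F j t) (u t) := by
  obtain ⟨B, hB⟩ := hF.exists_norm_le
  obtain ⟨d, rfl⟩ : ∃ d, l = d + 1 + L.length := ⟨l - L.length - 1, by lia⟩
  exact ((hF.isWhitney j).iterPartialDeriv L (hF.polyFamily j) hB).continuous
    ((hF.polyFamily j).iterPartialDeriv L) hB hF.continuous

theorem continuous_eval (hF : IsJetFamily l u F) (hl : 0 < l) :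
    Continuous fun t j => F j t (u t) :=
  continuous_pi fun j => hF.continuous_iterPartialDeriv j (L := []) hl

theorem isClosed_range_eval (hF : IsJetFamily l u F) (hl : 0 < l) :
    IsClosed (range fun t j => F j t (u t)) :=
  (isCompact_range (hF.continuous_eval hl)).isClosed

end IsJetFamily

theorem DerivsVanish.isFlat [CharZero K] {u : T → Fin n → K} {F : Fin b → T → (Fin n → K) → K}
    (h : DerivsVanish k u F) (hF : ∀ j, PolyFamily (F j)) (hu : ∀ t, ‖u t‖ ≤ B) (j : Fin b) :
    IsFlat k u (F j) :=
  (hF j).isFlat hu (h j)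

theorem IsWhitney.exists_norm_sub_le_of_isFlat {u : T → Fin n → K} {P : T → (Fin n → K) → K}
    (h : IsWhitney (k + 1) u P) (hflat : IsFlat k u P) (hu : ∀ t, ‖u t‖ ≤ B) :
    ∃ C, 0 ≤ C ∧ ∀ s t, ‖P s (u s) - P t (u t)‖ ≤ C * ‖u s - u t‖ ^ (k + 1) := by
  obtain ⟨C, hC, hflat⟩ := hflat B
  obtain ⟨D, hD, hwhitney⟩ := h B
  refine ⟨C + D, by positivity, fun s t => ?_⟩
  have h₁ := hflat s (u s) (u t) (hu s) (hu t)
  have h₂ := hwhitney t s (u t) (hu t)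
  rw [sub_self, norm_zero, zero_add, norm_sub_rev (u t), mul_assoc, ← pow_succ] at h₁
  rw [sub_self, norm_zero, add_zero, norm_sub_rev (u t)] at h₂
  calc ‖P s (u s) - P t (u t)‖ = ‖(P s (u s) - P s (u t)) + (P s (u t) - P t (u t))‖ := by
        rw [sub_add_sub_cancel]
    _ ≤ _ := norm_add_le_of_le h₁ h₂
    _ = _ := by ring

theorem hasFDerivAt_comp_graphAt {i : Fin (n + 1)} {φ : (Fin n → K) → K}
    {f g : (Fin (n + 1) → K) → K} {c : K} {y : Fin n → K} (hφ : DifferentiableAt K φ y)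
    (hf : HasFDerivAt (fun z => f z + c * g z) (0 : (Fin (n + 1) → K) →L[K] K) (graphAt i φ y))
    (hg : HasFDerivAt (fun y => g (graphAt i φ y)) (0 : (Fin n → K) →L[K] K) y) :
    HasFDerivAt (fun y => f (graphAt i φ y)) (0 : (Fin n → K) →L[K] K) y := by
  have hgraph : DifferentiableAt K (graphAt i φ) y := by
    refine differentiableAt_pi.2 fun j => ?_
    induction j using i.succAboveCases with
    | x => simpa only [graphAt_apply_self] using hφ
    | p j => simpa [graphAt] using differentiableAt_apply j y
  convert! (hf.comp y hgraph.hasFDerivAt).sub (hg.const_mul c) using 1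
  · ext; simp
  · ext; simp

theorem hasFDerivAt_zero_of_forall_norm_le {f : (Fin n → K) → K} {y₀ : Fin n → K} {j : ℕ}
    (h : ∀ ρ : ℝ, ∃ C, ∀ y, ‖y‖ ≤ ρ → ‖f y‖ ≤ C * ‖y - y₀‖ ^ (j + 2)) :
    HasFDerivAt f (0 : (Fin n → K) →L[K] K) y₀ := by
  obtain ⟨C, hC⟩ := h (‖y₀‖ + 1)
  refine Asymptotics.IsBigO.hasFDerivAt (n := j + 2) (.of_bound C ?_) (by lia)
  filter_upwards [Metric.closedBall_mem_nhds y₀ one_pos] with y hy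
  rw [norm_pow, norm_norm]
  exact hC y ((norm_le_norm_add_norm_sub' y y₀).trans
    (add_le_add_right (mem_closedBall_iff_norm.1 hy) _))

theorem IsCritical.removeNth {u : T → Fin n → K} {F : Fin (b + 1) → T → (Fin n → K) → K}
    {t : T} {i : Fin n} (h : IsCritical u F t) {j₀ : Fin (b + 1)}
    (hpd : partialDeriv i (F j₀ t) (u t) ≠ 0) (x : K) :
    ∃ v : Fin b → K, v ≠ 0 ∧ ∃ v₀ : K, HasFDerivAt
      (fun z => ∑ j, v j * F (j₀.succAbove j) t z + v₀ * (F j₀ t z - x))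
        (0 : (Fin n → K) →L[K] K) (u t) := by
  obtain ⟨v, hv, hderiv⟩ := h
  simp only [Fin.sum_univ_succAbove _ j₀] at hderiv
  refine ⟨j₀.removeNth v, fun hv₀ => ?_, v j₀, ?_⟩
  · have hv' : ∀ j, v (j₀.succAbove j) = 0 := fun j => congrFun hv₀ j
    have hvj₀ : v j₀ ≠ 0 := fun h₀ => hv (funext (j₀.forall_iff_succAbove.2 ⟨h₀, hv'⟩))
    have hF₀ := hderiv.const_mul (v j₀)⁻¹
    simp only [hv', zero_mul, Finset.sum_const_zero, add_zero, inv_mul_cancel_left₀ hvj₀] at hF₀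
    exact hpd (by simp [partialDeriv, hF₀.fderiv])
  · convert! hderiv.sub_const (v j₀ * x) using 1
    ext z
    simp only [Fin.removeNth]
    ring

end Critical

section NullPieces

theorem measure_range_eq_zero_of_forall_dist_le {T X Y : Type*} [TopologicalSpace T]
    [CompactSpace T] [PseudoMetricSpace X] [MeasurableSpace Y] (ν : Measure Y) {u : T → X}
    (hu : Continuous u) (f : T → Y) {δ : ℝ} (hδ : 0 < δ)
    (h : ∀ A : Set T, IsClosed A → (∀ s ∈ A, ∀ t ∈ A, dist (u s) (u t) ≤ δ) →
      ν (range fun t : A => f t) = 0) : ν (range f) = 0 := by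
  obtain ⟨s, hs⟩ := CompactSpace.elim_nhds_subcover
    (fun t => u ⁻¹' Metric.closedBall (u t) (δ / 2))
    fun t => hu.continuousAt (Metric.closedBall_mem_nhds _ (by positivity))
  refine measure_range_eq_zero_of_cover ν f
    (fun t : s => u ⁻¹' Metric.closedBall (u t) (δ / 2)) (fun t => ?_) fun t₀ =>
      h _ (Metric.isClosed_closedBall.preimage hu) fun s hs t ht => ?_
  · obtain ⟨t', ht', h⟩ := mem_iUnion₂.1 (hs.ge (mem_univ t))
    exact ⟨⟨t', ht'⟩, h⟩
  · rw [← add_halves δ]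
    exact (dist_triangle_right _ _ (u t₀)).trans (add_le_add hs ht)

theorem pi_measure_range_eq_zero_of_forall_slice {K T : Type*} [MeasurableSpace K]
    (μ : Measure K) [SigmaFinite μ] {b : ℕ} {f : T → Fin (b + 1) → K} (hf : MeasurableSet (range f))
    (j₀ : Fin (b + 1))
    (h : ∀ x, (Measure.pi fun _ : Fin b => μ)
      (range fun t : {t | f t j₀ = x} => j₀.removeNth (f t)) = 0) :
    (Measure.pi fun _ : Fin (b + 1) => μ) (range f) = 0 := by
  let e := MeasurableEquiv.piFinSuccAbove (fun _ : Fin (b + 1) => K) j₀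
  have hsymm : MeasurableSet (e.symm ⁻¹' range f) := e.symm.measurable hf
  rw [← preimage_id (s := range f), ← e.symm_comp_self, preimage_comp,
    (measurePreserving_piFinSuccAbove (fun _ : Fin (b + 1) => μ) j₀).measure_preimage
      hsymm.nullMeasurableSet, Measure.measure_prod_null hsymm]
  refine Filter.Eventually.of_forall fun x => measure_mono_null ?_ (h x)
  rintro y ⟨t, ht⟩
  have ht : f t = j₀.insertNth x y := ht
  exact ⟨⟨t, by simp [ht]⟩, by simp [ht]⟩

end NullPieces

section Sard

universe w

variable {K : Type*} [NontriviallyNormedField K] [MeasurableSpace K] (μ : Measure K) {n b l : ℕ}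

/-- Sard's theorem for Whitney jets of order `l` in `n` variables. -/
def SardAt (l n : ℕ) : Prop :=
  ∀ (b : ℕ) (T : Type w) [TopologicalSpace T] [CompactSpace T] (u : T → Fin n → K)
    (F : Fin b → T → (Fin n → K) → K), IsJetFamily l u F → (∀ t, IsCritical u F t) →
    (Measure.pi fun _ : Fin b => μ) (range fun t j => F j t (u t)) = 0

variable {T : Type w} [TopologicalSpace T] [CompactSpace T] {u : T → Fin (n + 1) → K}
  {F : Fin b → T → (Fin (n + 1) → K) → K} {g : T → (Fin (n + 1) → K) → K} {c Λ : ℝ}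
  {i : Fin (n + 1)} {j k : ℕ}

variable {μ}

theorem SardAt.of_graph (hS : SardAt.{w} μ (j + 2 + k) n) {R : T → (Fin n → K) → K}
    (hF : IsJetFamily (j + 2 + k) u F) (hFk : ∀ i, IsFlat k u (F i)) (hg : PolyFamily g)
    (hgW : IsWhitney (j + 2) u g) (hc : 0 < c) (hpd : ∀ t, c ≤ ‖partialDeriv i (g t) (u t)‖)
    (hΛ₀ : 0 ≤ Λ) (hΛ : ∀ s t, ‖u s i - u t i‖ ≤ Λ * ‖i.removeNth (u s) - i.removeNth (u t)‖)
    (hR : PolyFamily R) (hRu : ∀ t, R t (i.removeNth (u t)) = u t i)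
    (hRg : ∀ ρ, ∃ C, 0 ≤ C ∧ ∀ t y, ‖y‖ ≤ ρ →
      ‖g t (graphAt i (R t) y)‖ ≤ C * ‖y - i.removeNth (u t)‖ ^ (j + 2))
    (hcrit : ∀ t, ∃ v : Fin b → K, v ≠ 0 ∧ ∃ v₀ : K,
      HasFDerivAt (fun z => ∑ j, v j * F j t z + v₀ * g t z)
        (0 : (Fin (n + 1) → K) →L[K] K) (u t)) :
    (Measure.pi fun _ : Fin b => μ) (range fun t j => F j t (u t)) = 0 := by
  obtain ⟨B, hB⟩ := hF.exists_norm_le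
  have hRW := hgW.implicit hg hB hc hpd hΛ₀ hΛ hR hRu hRg
  have hgraph : ∀ t, graphAt i (R t) (i.removeNth (u t)) = u t := fun t => graphAt_removeNth (hRu t)
  have hnull := hS b T (fun t => i.removeNth (u t)) (fun j t y => F j t (graphAt i (R t) y))
    ⟨continuous_pi fun j => (continuous_apply (i.succAbove j)).comp hF.continuous,
      fun j => (hF.polyFamily j).comp_graphAt hR i,
      fun j => (hF.isWhitney j).comp_graphAt (hFk j) hB hΛ₀ hΛ hR hRu hRW⟩ fun t => ?_
  · simpa only [hgraph] using hnull
  obtain ⟨v, hv, v₀, hv₀⟩ := hcrit t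
  refine ⟨v, hv, hasFDerivAt_comp_graphAt (f := fun z => ∑ j, v j * F j t z)
    (hR.differentiable t _) ((hgraph t).symm ▸ hv₀) ?_⟩
  refine hasFDerivAt_zero_of_forall_norm_le (j := j) fun ρ => ?_
  obtain ⟨C, -, hC⟩ := hRg ρ
  exact ⟨C, hC t⟩

theorem SardAt.of_equation (hS : SardAt.{w} μ (j + 2 + k) n)
    (hF : IsJetFamily (j + 2 + k) u F) (hFk : ∀ i, IsFlat k u (F i)) (hg : PolyFamily g)
    (hgW : IsWhitney (j + 2) u g) (hg₀ : ∀ t, g t (u t) = 0) (hc : 0 < c)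
    (hpd : ∀ t, c ≤ ‖partialDeriv i (g t) (u t)‖)
    (hcrit : ∀ t, ∃ v : Fin b → K, v ≠ 0 ∧ ∃ v₀ : K,
      HasFDerivAt (fun z => ∑ j, v j * F j t z + v₀ * g t z)
        (0 : (Fin (n + 1) → K) →L[K] K) (u t)) :
    (Measure.pi fun _ : Fin b => μ) (range fun t j => F j t (u t)) = 0 := by
  obtain ⟨B, hB⟩ := hF.exists_norm_le
  obtain ⟨δ, hδ, Λ, hΛ₀, hΛ⟩ := hgW.exists_lipschitz hg hB hg₀ hc hpd
  obtain ⟨R, hR, hRu, hRg⟩ := hg.exists_implicit hB hg₀ hc hpd (j + 2)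
  refine measure_range_eq_zero_of_forall_dist_le _ hF.continuous _ hδ fun A hA hAδ => ?_
  have : CompactSpace A := isCompact_iff_compactSpace.1 hA.isCompact
  refine hS.of_graph (hF.restrict A) (fun j => (hFk j).comp_index Subtype.val)
    (hg.comp_index Subtype.val) (hgW.comp_index Subtype.val) hc (fun t => hpd t) hΛ₀
    (fun s t => hΛ s t (dist_eq_norm (u s) (u t) ▸ hAδ s s.2 t t.2))
    (hR.comp_index Subtype.val) (fun t => hRu t) (fun ρ => ?_) fun t => hcrit t
  obtain ⟨C, hC, h⟩ := hRg ρ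
  exact ⟨C, hC, fun t => h t⟩

theorem SardAt.of_partialDeriv_ne_zero [ProperSpace K] [BorelSpace K] [SigmaFinite μ]
    (hS : SardAt.{w} μ (l + 2) n) (hF : IsJetFamily (l + 2) u F) (hcrit : ∀ t, IsCritical u F t)
    (hc : 0 < c) (j₀ : Fin b) (hpd : ∀ t, c ≤ ‖partialDeriv i (F j₀ t) (u t)‖) :
    (Measure.pi fun _ : Fin b => μ) (range fun t j => F j t (u t)) = 0 := by
  obtain _ | b := b
  · exact j₀.elim0
  refine pi_measure_range_eq_zero_of_forall_slice μ
    (hF.isClosed_range_eval (by lia)).measurableSet j₀ fun x => ?_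
  set A : Set T := {t | F j₀ t (u t) = x}
  have : CompactSpace A := isCompact_iff_compactSpace.1 (isClosed_eq
    ((continuous_apply j₀).comp (hF.continuous_eval (by lia))) continuous_const).isCompact
  have hFA := hF.restrict A
  refine hS.of_equation (k := 0) (g := fun (t : A) z => F j₀ t z - x)
    ⟨hFA.continuous, fun j => hFA.polyFamily (j₀.succAbove j),
      fun j => hFA.isWhitney (j₀.succAbove j)⟩
    (fun j => (hFA.polyFamily (j₀.succAbove j)).isFlat_zero) ((hFA.polyFamily j₀).sub (.const x))
    (fun R => ?_) (fun t => sub_eq_zero.2 t.2) hc (i := i) (fun t => ?_) fun t =>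
      (hcrit t).removeNth (norm_pos_iff.1 (hc.trans_le (hpd t))) x
  · simpa only [sub_sub_sub_cancel_right] using hFA.isWhitney j₀ R
  · simpa only [partialDeriv, fderiv_sub_const] using hpd t

theorem SardAt.of_iterPartialDeriv_ne_zero [CharZero K] [ProperSpace K] [BorelSpace K]
    [SigmaFinite μ] (hS : SardAt.{w} μ l n) (hF : IsJetFamily l u F)
    (hcrit : ∀ t, IsCritical u F t) (hvan : DerivsVanish k u F) (hk : k + 1 < l) (hc : 0 < c)
    (j₀ : Fin b) {L : List (Fin (n + 1))} (hL : L.length = k)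
    (hpd : ∀ t, c ≤ ‖iterPartialDeriv (L ++ [i]) (F j₀ t) (u t)‖) :
    (Measure.pi fun _ : Fin b => μ) (range fun t j => F j t (u t)) = 0 := by
  obtain ⟨B, hB⟩ := hF.exists_norm_le
  obtain ⟨d, rfl⟩ : ∃ d, l = d + 2 + k := ⟨l - k - 2, by lia⟩
  simp only [iterPartialDeriv_concat] at hpd
  obtain _ | k := k
  · obtain rfl : L = [] := List.length_eq_zero_iff.1 hL
    exact hS.of_partialDeriv_ne_zero hF hcrit hc j₀ hpd
  · refine hS.of_equation hF (hvan.isFlat hF.polyFamily hB)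
      ((hF.polyFamily j₀).iterPartialDeriv L)
      ((hL ▸ hF.isWhitney j₀ : IsWhitney (d + 2 + L.length) u (F j₀)).iterPartialDeriv L
        (hF.polyFamily j₀) hB)
      (fun t => hvan j₀ t L (by lia) hL.le) hc hpd fun t => ?_
    obtain ⟨v, hv, h⟩ := hcrit t
    exact ⟨v, hv, 0, by simpa using h⟩

end Sard

section SardInduction

universe w

variable {K : Type*} [NontriviallyNormedField K] [MeasurableSpace K] (μ : Measure K) {n b l k : ℕ}
  {T : Type w} {u : T → Fin n → K} {F : Fin b → T → (Fin n → K) → K}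

theorem measure_range_eq_zero_of_iterPartialDeriv (ν : Measure (Fin b → K)) (k : ℕ)
    (hzero : ν (range fun (t : {t | ∀ j, ∀ L : List (Fin n), L.length = k + 1 →
      iterPartialDeriv L (F j t) (u t) = 0}) j => F j t (u t)) = 0)
    (hne : ∀ (j₀ : Fin b) (L : List (Fin n)) (i : Fin n) (c : ℝ), L.length = k → 0 < c →
      ν (range fun (t : {t | c ≤ ‖iterPartialDeriv (L ++ [i]) (F j₀ t) (u t)‖}) j =>
        F j t (u t)) = 0) :
    ν (range fun t j => F j t (u t)) = 0 := by
  refine measure_range_eq_zero_of_cover ν _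
    (ι := Option (Fin b × {L : List (Fin n) // L.length = k} × Fin n × ℕ))
    (fun o => o.elim {t | ∀ j, ∀ L : List (Fin n), L.length = k + 1 →
        iterPartialDeriv L (F j t) (u t) = 0}
      fun a => {t | 1 / ((a.2.2.2 : ℝ) + 1) ≤
        ‖iterPartialDeriv (a.2.1.1 ++ [a.2.2.1]) (F a.1 t) (u t)‖}) (fun t => ?_) ?_
  · by_cases ht : ∀ j, ∀ L : List (Fin n), L.length = k + 1 → iterPartialDeriv L (F j t) (u t) = 0
    · exact ⟨none, ht⟩
    push Not at ht
    obtain ⟨j, L, hL, hne⟩ := ht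
    obtain rfl | ⟨L, i, rfl⟩ := L.eq_nil_or_concat'
    · simp at hL
    obtain ⟨N, hN⟩ := exists_nat_one_div_lt (norm_pos_iff.2 hne)
    exact ⟨some (j, ⟨L, by simpa using hL⟩, i, N), hN.le⟩
  · rintro (_ | ⟨j, L, i, N⟩)
    · exact hzero
    · exact hne j L i (1 / ((N : ℝ) + 1)) L.2 (by positivity)

variable [TopologicalSpace T] [CompactSpace T] [ProperSpace K] [BorelSpace K] [μ.IsAddHaarMeasure]

theorem IsJetFamily.measure_range_eq_zero_of_isFlat (hF : IsJetFamily (k + 1) u F)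
    (hflat : ∀ j, IsFlat k u (F j)) (hn : n < (k + 1) * b) :
    (Measure.pi fun _ : Fin b => μ) (range fun t j => F j t (u t)) = 0 := by
  obtain ⟨B, hB⟩ := hF.exists_norm_le
  choose C hC hholder using fun j => (hF.isWhitney j).exists_norm_sub_le_of_isFlat (hflat j) hB
  have hsum : 0 ≤ ∑ j, C j := Finset.sum_nonneg fun j _ => hC j
  refine measure_range_eq_zero_of_holder μ hn hsum hB (fun s t => ?_)
    (hF.isClosed_range_eval k.succ_pos).measurableSet
  refine (pi_norm_le_iff_of_nonneg (by positivity)).2 fun j => (hholder j s t).trans ?_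
  gcongr
  exact Finset.single_le_sum (fun j _ => hC j) (Finset.mem_univ j)

theorem sard_of_derivsVanish [CharZero K] (ih : ∀ m, n = m + 1 → SardAt.{w} μ l m) (hn : n < l)
    (d : ℕ) (hk : k + d + 1 = l) (hF : IsJetFamily l u F) (hcrit : ∀ t, IsCritical u F t)
    (hvan : DerivsVanish k u F) :
    (Measure.pi fun _ : Fin b => μ) (range fun t j => F j t (u t)) = 0 := by
  induction d generalizing k T with
  | zero =>
    obtain rfl : k + 1 = l := hk
    obtain ⟨B, hB⟩ := hF.exists_norm_le
    obtain hT | ⟨⟨t₀⟩⟩ := isEmpty_or_nonempty T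
    · rw [range_eq_empty, measure_empty]
    obtain ⟨v, hv, -⟩ := hcrit t₀
    obtain ⟨j, -⟩ := Function.ne_iff.1 hv
    exact hF.measure_range_eq_zero_of_isFlat μ (hvan.isFlat hF.polyFamily hB)
      (hn.trans_le (Nat.le_mul_of_pos_right _ j.pos))
  | succ d ihd =>
    refine measure_range_eq_zero_of_iterPartialDeriv _ k ?_ fun j L i c hL hc => ?_
    · set Z : Set T := {t | ∀ j, ∀ L : List (Fin n), L.length = k + 1 →
        iterPartialDeriv L (F j t) (u t) = 0} with hZ
      have hZc : IsClosed Z := by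
        simp only [hZ, ofPred_forall]
        exact isClosed_iInter fun j => isClosed_iInter fun L => isClosed_iInter fun hL =>
          isClosed_eq (hF.continuous_iterPartialDeriv j (by lia)) continuous_const
      have : CompactSpace Z := isCompact_iff_compactSpace.1 hZc.isCompact
      refine ihd (k := k + 1) (by lia) (hF.restrict Z) (fun t => hcrit t) fun j t L hL₁ hL₂ => ?_
      rcases hL₂.eq_or_lt with hL | hL
      · exact t.2 j L hL
      · exact hvan j t L hL₁ (by lia)
    · set A : Set T := {t | c ≤ ‖iterPartialDeriv (L ++ [i]) (F j t) (u t)‖}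
      have hLl : (L ++ [i]).length < l := by simp [hL]; lia
      have : CompactSpace A := isCompact_iff_compactSpace.1
        (isClosed_le continuous_const (hF.continuous_iterPartialDeriv j hLl).norm).isCompact
      obtain _ | n := n
      · exact i.elim0
      · exact (ih n rfl).of_iterPartialDeriv_ne_zero (hF.restrict A) (fun t => hcrit t)
          (fun j t => hvan j t) (by lia) hc j hL fun t => t.2

theorem sardAt [CharZero K] (hn : n < l) : SardAt.{w} μ l n := by
  have step : ∀ m < l, (∀ m', m = m' + 1 → SardAt.{w} μ l m') → SardAt.{w} μ l m :=
    fun m hm ih b T _ _ u F hF hcrit =>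
      sard_of_derivsVanish μ ih hm (k := 0) (l - 1) (by lia) hF hcrit fun j t L h₁ h₂ => by lia
  induction n with
  | zero => exact step 0 hn fun m' hm' => by lia
  | succ n ih =>
    refine step (n + 1) hn fun m' hm' => ?_
    obtain rfl : n = m' := by lia
    exact ih (by lia)

end SardInduction

section Pairing

variable {K : Type*} [NontriviallyNormedField K] {E : Type*}
  {Y : Type*} [NormedAddCommGroup Y] [NormedSpace K Y]

/-- The value `∑ c_y φ(y)` of a function `φ` on a formal combination `∑ c_y [y]` of points. Finite
differences of `φ` are its values on products in the group algebra. -/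
def pairing (φ : E → Y) : AddMonoidAlgebra K E →ₗ[K] Y :=
  Finsupp.linearCombination K φ ∘ₗ (AddMonoidAlgebra.coeffLinearEquiv K).toLinearMap

@[simp] theorem pairing_single (φ : E → Y) (y : E) (c : K) :
    pairing φ (AddMonoidAlgebra.single y c) = c • φ y := by
  simp [pairing]

theorem pairing_sub (φ ψ : E → Y) (X : AddMonoidAlgebra K E) :
    pairing (fun y => φ y - ψ y) X = pairing φ X - pairing ψ X :=
  LinearMap.congr_fun (map_sub (Finsupp.bilinearCombination K K) φ ψ) _

theorem pairing_sum {ι : Type*} (s : Finset ι) (φ : ι → E → Y) (X : AddMonoidAlgebra K E) :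
    pairing (fun y => ∑ i ∈ s, φ i y) X = ∑ i ∈ s, pairing (φ i) X := by
  induction X using AddMonoidAlgebra.induction_linear with
  | zero => simp
  | add X X' h h' => simp only [map_add, h, h', Finset.sum_add_distrib]
  | single y c => simp [Finset.smul_sum]

theorem pairing_smul_const (φ : E → K) (c : Y) (X : AddMonoidAlgebra K E) :
    pairing (fun y => φ y • c) X = pairing φ X • c := by
  induction X using AddMonoidAlgebra.induction_linear with
  | zero => simp
  | add X X' h h' => rw [map_add, map_add, h, h', add_smul]
  | single y a => simp [smul_smul]

variable [AddCommGroup E]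

@[simp] theorem pairing_one (φ : E → Y) : pairing φ (1 : AddMonoidAlgebra K E) = φ 0 := by
  rw [AddMonoidAlgebra.one_def, pairing_single, one_smul]

theorem pairing_single_mul (φ : E → Y) (y : E) (X : AddMonoidAlgebra K E) :
    pairing φ (AddMonoidAlgebra.single y 1 * X) = pairing (fun x => φ (y + x)) X := by
  induction X using AddMonoidAlgebra.induction_linear with
  | zero => simp
  | add X X' h h' => rw [mul_add, map_add, map_add, h, h']
  | single y c => simp [AddMonoidAlgebra.single_mul_single]

variable (K) in
/-- The difference operator `[y] - [0]` of step `y`. -/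
def dif (y : E) : AddMonoidAlgebra K E := AddMonoidAlgebra.single y 1 - 1

@[simp] theorem dif_zero : dif K (0 : E) = 0 := by
  simp [dif, AddMonoidAlgebra.one_def]

theorem dif_add (x y : E) : dif K (x + y) = AddMonoidAlgebra.single y 1 * dif K x + dif K y := by
  rw [dif, dif, dif, mul_sub, AddMonoidAlgebra.single_mul_single, mul_one, add_comm y, mul_one]
  abel

theorem dif_nsmul_sub (N : ℕ) (y : E) :
    dif K (N • y) - N • dif K y = ∑ c ∈ Finset.range N, dif K (c • y) * dif K y := by
  induction N with
  | zero => simp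
  | succ N ih =>
    have hsingle : AddMonoidAlgebra.single y (1 : K) = dif K y + 1 := by simp [dif]
    rw [Finset.sum_range_succ, ← ih, succ_nsmul, succ_nsmul, dif_add, hsingle]
    ring

theorem pairing_dif_mul (φ : E → Y) (y : E) (X : AddMonoidAlgebra K E) :
    pairing φ (dif K y * X) = pairing (fun x => φ (y + x) - φ x) X := by
  rw [dif, sub_mul, one_mul, map_sub, pairing_single_mul, pairing_sub]

theorem prod_single_one {ι : Type*} (s : Finset ι) (y : ι → E) :
    ∏ i ∈ s, AddMonoidAlgebra.single (y i) (1 : K) = AddMonoidAlgebra.single (∑ i ∈ s, y i) 1 := by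
  classical
  induction s using Finset.induction_on with
  | empty => simp [AddMonoidAlgebra.one_def]
  | insert i s hi ih =>
    rw [Finset.prod_insert hi, ih, AddMonoidAlgebra.single_mul_single, Finset.sum_insert hi,
      one_mul]

theorem pairing_prod_dif {v : ℕ} (φ : E → Y) (y : Fin v → E) :
    pairing φ (∏ i, dif K (y i)) =
      ∑ S : Finset (Fin v), (-1 : K) ^ (v - S.card) • φ (∑ i ∈ S, y i) := by
  have hneg : (-1 : AddMonoidAlgebra K E) = AddMonoidAlgebra.single 0 (-1) := by
    rw [AddMonoidAlgebra.one_def, AddMonoidAlgebra.single_neg]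
  simp only [dif, sub_eq_add_neg]
  rw [Finset.prod_add, Finset.powerset_univ, map_sum]
  refine Finset.sum_congr rfl fun S _ => ?_
  rw [prod_single_one, Finset.prod_const, ← Finset.compl_eq_univ_sdiff, Finset.card_compl,
    Fintype.card_fin, hneg, AddMonoidAlgebra.single_pow, AddMonoidAlgebra.single_mul_single,
    pairing_single]
  simp

/-- The difference operator with the list of steps `L`. -/
def difs (L : List K) : AddMonoidAlgebra K K := (L.map (dif K)).prod

@[simp] theorem difs_nil : difs ([] : List K) = 1 := rfl

@[simp] theorem difs_cons (ζ : K) (L : List K) : difs (ζ :: L) = dif K ζ * difs L := by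
  simp [difs]

@[simp] theorem difs_append (L L' : List K) : difs (L ++ L') = difs L * difs L' := by
  simp [difs]

theorem prod_map_const_mul (c : K) (L : List K) :
    (L.map (c * ·)).prod = c ^ L.length * L.prod := by
  simpa using List.prod_map_mul (l := L) (f := fun _ => c) (g := id)

end Pairing

section Differences

variable {K : Type*} [NontriviallyNormedField K] {Y : Type*} [NormedAddCommGroup Y]
  [NormedSpace K Y] {φ : K → Y} {δ C ρ : ℝ} {l v p : ℕ} {L : List K}

/-- The `v`-th differences of `φ` with steps of size at most `ρ ≤ δ` are bounded by `C ρ^(l-v)`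
times the product of the steps. -/
def DiffBound (δ : ℝ) (l v : ℕ) (C : ℝ) (φ : K → Y) : Prop :=
  ∀ L : List K, L.length = v → ∀ ρ, 0 ≤ ρ → ρ ≤ δ → (∀ ζ ∈ L, ‖ζ‖ ≤ ρ) →
    ‖pairing φ (difs L)‖ ≤ C * ρ ^ (l - v) * ‖L.prod‖

theorem DiffBound.norm_pairing_dif_nsmul_sub_le (hφ : DiffBound δ l (v + 1) C φ) (hC : 0 ≤ C)
    (hv : v < l) (hnat : ∀ c : ℕ, ‖(c : K)‖ ≤ 1) (N : ℕ) {ζ : K} (hL : (ζ :: L).length = v)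
    (hρ₀ : 0 ≤ ρ) (hρδ : ρ ≤ δ) (hρ : ∀ x ∈ ζ :: L, ‖x‖ ≤ ρ) :
    ‖pairing φ ((dif K (N • ζ) - N • dif K ζ) * difs L)‖ ≤
      N * (C * ρ ^ (l - v) * ‖(ζ :: L).prod‖) := by
  rw [dif_nsmul_sub, Finset.sum_mul, map_sum]
  refine (norm_sum_le _ _).trans ((Finset.sum_le_card_nsmul _ _ _ fun c _ => ?_).trans_eq
    (by rw [Finset.card_range, nsmul_eq_mul]))
  have hcζ : ‖c • ζ‖ ≤ ρ := by
    rw [nsmul_eq_mul, norm_mul]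
    exact (mul_le_of_le_one_left (norm_nonneg _) (hnat c)).trans (hρ ζ List.mem_cons_self)
  have h := hφ (c • ζ :: ζ :: L) (by simpa using hL) ρ hρ₀ hρδ
    (List.forall_mem_cons.2 ⟨hcζ, hρ⟩)
  rw [difs_cons, difs_cons, ← mul_assoc, List.prod_cons, norm_mul] at h
  obtain ⟨e, he⟩ : ∃ e, l - v = e + 1 := ⟨l - v - 1, by lia⟩
  calc _ ≤ C * ρ ^ (l - (v + 1)) * (‖c • ζ‖ * ‖(ζ :: L).prod‖) := h
    _ ≤ C * ρ ^ (l - (v + 1)) * (ρ * ‖(ζ :: L).prod‖) := by gcongr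
    _ = _ := by rw [← Nat.sub_sub, he, Nat.add_sub_cancel, pow_succ]; ring

/-- The step `ζ` is replaced by `p ζ` in one element of the list after the other. -/
theorem DiffBound.norm_pairing_difs_map_sub_mul_le (hφ : DiffBound δ l (v + 1) C φ) (hC : 0 ≤ C)
    (hv : v < l) (hnat : ∀ c : ℕ, ‖(c : K)‖ ≤ 1) (hp : (p : K) ≠ 0) (L₀ : List K)
    (hL : (L ++ L₀).length = v) (hρ₀ : 0 ≤ ρ) (hρδ : ρ ≤ δ) (hρ : ∀ x ∈ L ++ L₀, ‖x‖ ≤ ρ) :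
    ‖pairing φ ((difs (L.map ((p : K) * ·)) - (p : K) ^ L.length • difs L) * difs L₀)‖ ≤
      L.length * (p / ‖(p : K)‖ * C * ρ ^ (l - v)) * (‖(p : K)‖ ^ L.length * ‖(L ++ L₀).prod‖) := by
  induction L generalizing L₀ with
  | nil => simp
  | cons ζ L ih =>
    set pL := L.map ((p : K) * ·) with hpL
    have hsplit : (difs ((ζ :: L).map ((p : K) * ·)) - (p : K) ^ (ζ :: L).length • difs (ζ :: L))
        * difs L₀ = (dif K (p • ζ) - p • dif K ζ) * difs (pL ++ L₀) +
          (p : K) • ((difs pL - (p : K) ^ L.length • difs L) * difs (ζ :: L₀)) := by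
      rw [List.map_cons, difs_cons, difs_cons, difs_cons, difs_append, List.length_cons, pow_succ',
        mul_smul, ← hpL, Nat.cast_smul_eq_nsmul K p, Nat.cast_smul_eq_nsmul K p, nsmul_eq_mul p ζ]
      simp only [nsmul_eq_mul, sub_mul, mul_sub, smul_mul_assoc, mul_smul_comm]
      ring_nf
    have hρ' : ∀ x ∈ ζ :: (pL ++ L₀), ‖x‖ ≤ ρ := by
      simp only [List.cons_append, List.forall_mem_cons, List.forall_mem_append] at hρ
      simp only [List.forall_mem_cons, List.forall_mem_append, hpL, List.forall_mem_map, norm_mul]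
      exact ⟨hρ.1, fun x hx => (mul_le_of_le_one_left (norm_nonneg _) (hnat p)).trans
        (hρ.2.1 x hx), hρ.2.2⟩
    have h₁ := hφ.norm_pairing_dif_nsmul_sub_le hC hv hnat p (by simpa [hpL] using hL) hρ₀ hρδ hρ'
    have h₂ := ih (ζ :: L₀) (by simpa [add_assoc, add_comm 1] using hL)
      fun x hx => hρ x (by simpa [or_left_comm] using hx)
    rw [hsplit, map_add, map_smul]
    refine (norm_add_le_of_le h₁ ((norm_smul_le _ _).trans
      (mul_le_mul_of_nonneg_left h₂ (norm_nonneg _)))).trans_eq ?_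
    have hpn : ‖(p : K)‖ ≠ 0 := norm_ne_zero_iff.2 hp
    simp only [List.prod_cons, List.prod_append, List.cons_append, norm_mul, hpL,
      prod_map_const_mul, norm_pow, List.length_cons, Nat.cast_add, Nat.cast_one, pow_succ]
    field_simp
    ring

theorem tendsto_map_pow_mul_replicate {q : K} (hq : ‖q‖ < 1) (L : List K) :
    Filter.Tendsto (fun N : ℕ => L.map (q ^ N * ·)) Filter.atTop
      (nhds (List.replicate L.length 0)) := by
  induction L with
  | nil => exact tendsto_const_nhds
  | cons ζ L ih =>
    have hζ : Filter.Tendsto (fun N : ℕ => q ^ N * ζ) Filter.atTop (nhds 0) := by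
      simpa using (tendsto_pow_atTop_nhds_zero_of_norm_lt_one hq).mul_const ζ
    exact hζ.cons ih

/-- The difference of `φ` with the steps `q ^ N ζ` for `ζ ∈ L`, divided by the powers of `q`: it is
the difference quotient of `φ` up to the factor `L.prod`. -/
def scaledDiff (q : K) (φ : K → Y) (L : List K) (N : ℕ) : Y :=
  ((q ^ N) ^ L.length)⁻¹ • pairing φ (difs (L.map (q ^ N * ·)))

theorem scaledDiff_zero (q : K) (φ : K → Y) (L : List K) :
    scaledDiff q φ L 0 = pairing φ (difs L) := by
  simp [scaledDiff]

theorem tendsto_scaledDiff {q : K} (hq₀ : q ≠ 0) (hq : ‖q‖ < 1)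
    (hφ : (fun L => pairing φ (difs L)) =o[nhds (List.replicate L.length (0 : K))] List.prod) :
    Filter.Tendsto (scaledDiff q φ L) Filter.atTop (nhds 0) := by
  rw [← Asymptotics.isLittleO_one_iff K]
  refine ((Asymptotics.isBigO_refl _ _).smul_isLittleO
    (hφ.comp_tendsto (tendsto_map_pow_mul_replicate hq L))).trans_isBigO
      (Asymptotics.IsBigO.congr_left (Asymptotics.isBigO_const_const L.prod one_ne_zero _)
        fun N => ?_)
  rw [Function.comp_apply, prod_map_const_mul, smul_eq_mul,
    inv_mul_cancel_left₀ (pow_ne_zero _ (pow_ne_zero _ hq₀))]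

theorem scaledDiff_succ_sub {q : K} (hq₀ : q ≠ 0) (φ : K → Y) (L : List K) (N : ℕ) :
    scaledDiff q φ L (N + 1) - scaledDiff q φ L N = ((q ^ (N + 1)) ^ L.length)⁻¹ •
      pairing φ (difs ((L.map (q ^ N * ·)).map (q * ·)) -
        q ^ L.length • difs (L.map (q ^ N * ·))) := by
  have hmap : (L.map (q ^ N * ·)).map (q * ·) = L.map (q ^ (N + 1) * ·) := by
    simp [pow_succ', mul_assoc, Function.comp_def]
  simp only [scaledDiff, hmap, map_sub, map_smul, smul_sub, smul_smul, pow_succ, mul_pow, mul_inv]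
  rw [inv_mul_cancel_right₀ (pow_ne_zero _ hq₀)]

theorem DiffBound.dist_scaledDiff_succ_le (hφ : DiffBound δ l (L.length + 1) C φ) (hC : 0 ≤ C)
    (hL : L.length < l) (hnat : ∀ c : ℕ, ‖(c : K)‖ ≤ 1) (hp : (p : K) ≠ 0) (hρ₀ : 0 ≤ ρ)
    (hρδ : ρ ≤ δ) (hρ : ∀ x ∈ L, ‖x‖ ≤ ρ) (N : ℕ) :
    dist (scaledDiff (p : K) φ L N) (scaledDiff (p : K) φ L (N + 1)) ≤
      l * (p / ‖(p : K)‖) * C * ρ ^ (l - L.length) * ‖L.prod‖ * ‖(p : K)‖ ^ N := by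
  have hpn : 0 < ‖(p : K)‖ := norm_pos_iff.2 hp
  have hρN : ∀ x ∈ L.map ((p : K) ^ N * ·) ++ [], ‖x‖ ≤ ‖(p : K)‖ ^ N * ρ := by
    simp only [List.append_nil, List.forall_mem_map, norm_mul, norm_pow]
    exact fun x hx => mul_le_mul_of_nonneg_left (hρ x hx) (by positivity)
  have hle : ‖(p : K)‖ ^ N * ρ ≤ ρ :=
    mul_le_of_le_one_left hρ₀ (pow_le_one₀ hpn.le (hnat p))
  have h := hφ.norm_pairing_difs_map_sub_mul_le hC hL hnat hp [] (by simp) (by positivity)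
    (hle.trans hρδ) hρN
  rw [difs_nil, mul_one, List.length_map, List.append_nil, prod_map_const_mul] at h
  have hpow : (‖(p : K)‖ ^ N) ^ (l - L.length) ≤ ‖(p : K)‖ ^ N := by
    rw [← pow_mul]
    exact pow_le_pow_of_le_one hpn.le (hnat p) (Nat.le_mul_of_pos_right N (by lia))
  have hlen : (L.length : ℝ) ≤ l := by exact_mod_cast hL.le
  rw [dist_comm, dist_eq_norm, scaledDiff_succ_sub hp, norm_smul, norm_inv, norm_pow, norm_pow,
    inv_mul_le_iff₀ (by positivity)]
  refine h.trans ?_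
  rw [norm_mul, norm_pow, norm_pow, mul_pow]
  calc _ ≤ l * (p / ‖(p : K)‖ * C * (‖(p : K)‖ ^ N * ρ ^ (l - L.length))) *
        (‖(p : K)‖ ^ L.length * ((‖(p : K)‖ ^ N) ^ L.length * ‖L.prod‖)) := by gcongr
    _ = _ := by ring

theorem DiffBound.of_succ (hφ : DiffBound δ l (v + 1) C φ) (hC : 0 ≤ C) (hv : v < l)
    (hnat : ∀ c : ℕ, ‖(c : K)‖ ≤ 1) (hp : (p : K) ≠ 0) (hp1 : ‖(p : K)‖ < 1)
    (hsmall : (fun L => pairing φ (difs L)) =o[nhds (List.replicate v (0 : K))] List.prod) :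
    DiffBound δ l v (l * (p / ‖(p : K)‖) / (1 - ‖(p : K)‖) * C) φ := by
  rintro L rfl ρ hρ₀ hρδ hρ
  have h := dist_le_of_le_geometric_of_tendsto₀ _ _ hp1
    (hφ.dist_scaledDiff_succ_le hC hv hnat hp hρ₀ hρδ hρ) (tendsto_scaledDiff hp hp1 hsmall)
  rw [dist_zero_right, scaledDiff_zero] at h
  exact h.trans_eq (by ring)

theorem DiffBound.of_le (hφ : DiffBound δ l l C φ) (hC : 0 ≤ C) (hnat : ∀ c : ℕ, ‖(c : K)‖ ≤ 1)
    (hp : (p : K) ≠ 0) (hp1 : ‖(p : K)‖ < 1)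
    (hsmall : ∀ v < l,
      (fun L => pairing φ (difs L)) =o[nhds (List.replicate v (0 : K))] List.prod)
    (d : ℕ) (hd : v + d = l) :
    DiffBound δ l v ((l * (p / ‖(p : K)‖) / (1 - ‖(p : K)‖)) ^ d * C) φ := by
  induction d generalizing v with
  | zero =>
    obtain rfl : v = l := hd
    simpa using hφ
  | succ d ih =>
    have : 0 ≤ 1 - ‖(p : K)‖ := by linarith
    have h := (ih (v := v + 1) (by lia)).of_succ (by positivity) (by lia) hnat hp hp1
      (hsmall v (by lia))
    rwa [← mul_assoc, ← pow_succ'] at h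

end Differences

section TaylorOneVariable

variable {K : Type*} [NontriviallyNormedField K]

theorem pairing_pow_difs_cons (k : ℕ) (ζ : K) (L : List K) :
    pairing (fun τ : K => τ ^ k) (difs (ζ :: L)) =
      ∑ i ∈ Finset.range k, (k.choose i : K) * (ζ ^ (k - i) *
        pairing (fun τ : K => τ ^ i) (difs L)) := by
  have h : (fun τ : K => (ζ + τ) ^ k - τ ^ k) =
      fun τ => ∑ i ∈ Finset.range k, τ ^ i • ((k.choose i : K) * ζ ^ (k - i)) := by
    ext τ
    rw [add_comm ζ τ, add_pow, Finset.sum_range_succ]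
    simp only [Nat.choose_self, Nat.sub_self, pow_zero, mul_one, Nat.cast_one,
      add_sub_cancel_right, smul_eq_mul]
    exact Finset.sum_congr rfl fun i _ => by ring
  rw [difs_cons, pairing_dif_mul, h, pairing_sum]
  exact Finset.sum_congr rfl fun i _ => by rw [pairing_smul_const, smul_eq_mul]; ring

theorem pairing_pow_difs_eq_zero (L : List K) {k : ℕ} (hk : k < L.length) :
    pairing (fun τ : K => τ ^ k) (difs L) = 0 := by
  induction L generalizing k with
  | nil => simp at hk
  | cons ζ L ih =>
    rw [pairing_pow_difs_cons]
    refine Finset.sum_eq_zero fun i hi => ?_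
    have hi := Finset.mem_range.1 hi
    rw [List.length_cons] at hk
    rw [ih (by lia), mul_zero, mul_zero]

theorem isLittleO_pow_mul_sub {v i k : ℕ} (hik : i < k) {q : List K → K} {c : K}
    (hq : (fun L => q L - L.prod * c) =o[nhds (List.replicate v (0 : K))] List.prod) :
    (fun w : K × List K => w.1 ^ (k - i) * q w.2 - if i + 1 = k then w.1 * (w.2.prod * c) else 0)
      =o[nhds 0 ×ˢ nhds (List.replicate v 0)] fun w => w.1 * w.2.prod := by
  have hsnd := hq.comp_tendsto (Filter.tendsto_snd (f := nhds (0 : K)))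
  obtain rfl | hlt := eq_or_lt_of_le (Nat.succ_le_of_lt hik)
  · simpa [mul_sub] using (Asymptotics.isBigO_refl (fun w : K × List K => w.1) _).mul_isLittleO hsnd
  · have hpow : (fun w : K × List K => w.1 ^ (k - i))
        =o[nhds 0 ×ˢ nhds (List.replicate v 0)] fun w => w.1 := by
      simpa only [Function.comp_def, pow_one] using
        (Asymptotics.isLittleO_pow_pow (𝕜 := K) (show 1 < k - i by lia)).comp_tendsto
          (Filter.tendsto_fst (f := nhds (0 : K)) (g := nhds (List.replicate v 0)))
    have hbig : q =O[nhds (List.replicate v (0 : K))] List.prod := by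
      have hconst : (fun L : List K => L.prod * c) =O[nhds (List.replicate v (0 : K))] List.prod :=
        (Asymptotics.isBigO_const_mul_self c List.prod _).congr_left fun L => mul_comm _ _
      exact (hq.isBigO.add hconst).congr_left fun L => sub_add_cancel _ _
    simpa [hlt.ne] using hpow.mul_isBigO (hbig.comp_tendsto Filter.tendsto_snd)

theorem isLittleO_pairing_pow_difs_sub (v k : ℕ) :
    (fun L : List K => pairing (fun τ : K => τ ^ k) (difs L) -
      L.prod * if k = v then (v.factorial : K) else 0) =o[nhds (List.replicate v 0)] List.prod := by
  induction v generalizing k with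
  | zero =>
    rw [List.replicate_zero, nhds_nil, Asymptotics.isLittleO_pure]
    rcases eq_or_ne k 0 with rfl | hk <;> simp_all
  | succ v ih =>
    have hsum := Asymptotics.IsLittleO.sum (s := Finset.range k) fun i hi =>
      (isLittleO_pow_mul_sub (Finset.mem_range.1 hi) (ih i)).const_mul_left (k.choose i : K)
    have hlim : ∀ w : K × List K, ∑ i ∈ Finset.range k, (k.choose i : K) *
        (if i + 1 = k then w.1 * (w.2.prod * if i = v then (v.factorial : K) else 0) else 0) =
          w.1 * w.2.prod * if k = v + 1 then ((v + 1).factorial : K) else 0 := by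
      intro w
      obtain _ | k := k
      · simp
      rw [Finset.sum_range_succ, Finset.sum_eq_zero fun i hi => by
        rw [if_neg (by have := Finset.mem_range.1 hi; lia), mul_zero]]
      rcases eq_or_ne k v with rfl | hk
      · simp [Nat.factorial_succ]; ring
      · simp [hk]
    have hcons : nhds (List.replicate (v + 1) (0 : K)) ≤
        (nhds 0 ×ˢ nhds (List.replicate v 0)).map fun w => w.1 :: w.2 :=
      (List.tendsto_cons_iff (f := id)).2 Filter.tendsto_map
    refine (Asymptotics.isLittleO_map.2 (hsum.congr (fun w => ?_) fun w => ?_)).mono hcons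
    · simp only [Finset.sum_apply, mul_sub, Finset.sum_sub_distrib, hlim, Function.comp_apply,
        pairing_pow_difs_cons, List.prod_cons]
    · simp only [Function.comp_apply, List.prod_cons]

variable {Y : Type*} [NormedAddCommGroup Y] [NormedSpace K Y] {φ : K → Y} {δ C : ℝ} {l p : ℕ}

theorem norm_sub_sum_pow_smul_le (hφ : DiffBound δ l l C φ)
    (hl : 1 ≤ l) (hC : 0 ≤ C) (hnat : ∀ c : ℕ, ‖(c : K)‖ ≤ 1) (hp : (p : K) ≠ 0)
    (hp1 : ‖(p : K)‖ < 1) (c : ℕ → Y)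
    (hc : ∀ v < l, (fun L : List K => pairing φ (difs L) - L.prod • (v.factorial : K) • c v)
      =o[nhds (List.replicate v 0)] List.prod) (τ : K) (hτ : ‖τ‖ ≤ δ) :
    ‖φ τ - ∑ k ∈ Finset.range l, τ ^ k • c k‖ ≤
      (l * (p / ‖(p : K)‖) / (1 - ‖(p : K)‖)) ^ (l - 1) * C * ‖τ‖ ^ l := by
  set g : K → Y := fun τ => φ τ - ∑ k ∈ Finset.range l, τ ^ k • c k with hg
  have hpairing : ∀ L : List K, pairing g (difs L) = pairing φ (difs L) -
      ∑ k ∈ Finset.range l, pairing (fun τ : K => τ ^ k) (difs L) • c k := fun L => by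
    rw [hg, pairing_sub, pairing_sum]
    simp only [pairing_smul_const]
  have hbound : DiffBound δ l l C g := fun L hL => by
    rw [hpairing, Finset.sum_eq_zero, sub_zero]
    · exact hφ L hL
    · intro k hk
      rw [pairing_pow_difs_eq_zero L (hL.symm ▸ Finset.mem_range.1 hk), zero_smul]
  have hsmall : ∀ v < l,
      (fun L => pairing g (difs L)) =o[nhds (List.replicate v (0 : K))] List.prod := by
    intro v hv
    have hpow (k : ℕ) : (fun L : List K => (pairing (fun τ : K => τ ^ k) (difs L) -
        L.prod * if k = v then (v.factorial : K) else 0) • c k)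
          =o[nhds (List.replicate v 0)] List.prod :=
      ((isLittleO_pairing_pow_difs_sub v k).smul_isBigO
        (Asymptotics.isBigO_const_const (c k) (one_ne_zero (α := K)) _)).congr_right
          fun L => mul_one L.prod
    refine ((hc v hv).sub (Asymptotics.IsLittleO.sum (s := Finset.range l)
      fun k _ => hpow k)).congr_left fun L => ?_
    simp only [hpairing, Finset.sum_apply, sub_smul, Finset.sum_sub_distrib, mul_ite, mul_zero,
      ite_smul, zero_smul, Finset.sum_ite_eq', Finset.mem_range, if_pos hv, smul_smul]
    abel
  have hzero : g 0 = 0 := by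
    simpa [nhds_nil, Asymptotics.isLittleO_pure] using hsmall 0 (by lia)
  have h := hbound.of_le hC hnat hp hp1 hsmall (v := 1) (l - 1) (by lia) [τ] rfl ‖τ‖
    (norm_nonneg _) hτ (by simp)
  rw [difs_cons, difs_nil, pairing_dif_mul, pairing_one, add_zero, hzero, sub_zero,
    List.prod_singleton, mul_assoc, ← pow_succ, Nat.sub_add_cancel hl] at h
  exact h

end TaylorOneVariable

section DifferenceQuotientExtensions

variable {K : Type*} [NontriviallyNormedField K] {m v : ℕ}
  {Y : Type*} [NormedAddCommGroup Y] [NormedSpace K Y] {f : (Fin m → K) → Y}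

theorem diffQuot_eq_pairing (f : (Fin m → K) → Y) (x : Fin m → K) (h : Fin v → Fin m → K)
    (ζ : Fin v → K) :
    diffQuot f x h ζ = (∏ i, ζ i)⁻¹ • pairing (fun y => f (x + y)) (∏ i, dif K (ζ i • h i)) := by
  rw [pairing_prod_dif, diffQuot]
  rfl

theorem diffQuot_update_smul (x : Fin m → K) (h : Fin v → Fin m → K) (i : Fin v) (c : K)
    (a : Fin m → K) (ζ : Fin v → K) :
    diffQuot f x (Function.update h i (c • a)) ζ =
      c • diffQuot f x (Function.update h i a) (Function.update ζ i (c * ζ i)) := by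
  have hdif : ∏ j, dif K (ζ j • Function.update h i (c • a) j) =
      ∏ j, dif K (Function.update ζ i (c * ζ i) j • Function.update h i a j) := by
    refine Finset.prod_congr rfl fun j _ => ?_
    rcases eq_or_ne j i with rfl | hj
    · simp [smul_smul, mul_comm]
    · simp [hj]
  have hprod : ∏ j, Function.update ζ i (c * ζ i) j = c * ∏ j, ζ j := by
    rw [Finset.prod_update_of_mem (Finset.mem_univ i), mul_assoc, ← Finset.erase_eq,
      Finset.mul_prod_erase _ _ (Finset.mem_univ i)]
  rw [diffQuot_eq_pairing, diffQuot_eq_pairing, hdif, hprod, smul_smul]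
  rcases eq_or_ne c 0 with rfl | hc
  · have hzero : ∏ j, dif K (Function.update ζ i (0 * ζ i) j • Function.update h i a j) = 0 :=
      Finset.prod_eq_zero (Finset.mem_univ i) (by simp)
    rw [hzero, map_zero, smul_zero, smul_zero]
  · rw [mul_inv, mul_inv_cancel_left₀ hc]

theorem diffQuot_update_add (x : Fin m → K) (h : Fin v → Fin m → K) (i : Fin v)
    (a a' : Fin m → K) (ζ : Fin v → K) :
    diffQuot f x (Function.update h i (a + a')) ζ =
      diffQuot f (x + ζ i • a') (Function.update h i a) ζ
        + diffQuot f x (Function.update h i a') ζ := by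
  have hdif : ∀ b : Fin m → K, ∏ j, dif K (ζ j • Function.update h i b j) =
      dif K (ζ i • b) * ∏ j ∈ Finset.univ.erase i, dif K (ζ j • h j) := fun b => by
    rw [← Finset.mul_prod_erase _ _ (Finset.mem_univ i), Function.update_self]
    congr 1
    refine Finset.prod_congr rfl fun j hj => ?_
    rw [Function.update_of_ne (Finset.ne_of_mem_erase hj)]
  simp only [diffQuot_eq_pairing, ← smul_add, hdif]
  simp only [smul_add, dif_add, add_mul, map_add, mul_assoc, pairing_single_mul, add_assoc]

theorem difs_ofFn (ζ : Fin v → K) : difs (List.ofFn ζ) = ∏ i, dif K (ζ i) := by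
  rw [difs, List.map_ofFn, List.prod_ofFn]
  rfl

theorem pairing_difs_ofFn (f : (Fin m → K) → Y) (x h : Fin m → K) {ζ : Fin v → K}
    (hζ : ∀ i, ζ i ≠ 0) :
    pairing (fun τ : K => f (x + τ • h)) (difs (List.ofFn ζ)) =
      (∏ i, ζ i) • diffQuot f x (fun _ => h) ζ := by
  rw [diffQuot, smul_inv_smul₀ (Finset.prod_ne_zero_iff.2 fun i _ => hζ i), difs_ofFn,
    pairing_prod_dif]
  simp only [vertex, Finset.sum_smul]

theorem isOpen_quotDomain {Ω : Set (Fin m → K)} (hΩ : IsOpen Ω) :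
    IsOpen (quotDomain (v := v) univ Ω) := by
  simp only [quotDomain, mem_univ, true_and, ofPred_forall]
  refine isOpen_iInter_of_finite fun S => hΩ.preimage ?_
  unfold vertex
  fun_prop

theorem mem_quotDomain_zero {Ω : Set (Fin m → K)} {x : Fin m → K} (hx : x ∈ Ω)
    (h : Fin v → Fin m → K) : (x, h, (0 : Fin v → K)) ∈ quotDomain univ Ω := by
  simp [quotDomain, vertex, hx]

/-- `Φ` is a continuous extension of the `v`-th difference quotient of `f` on `Ω`, the directions
being unrestricted, to the points where some of the `ζ_i` vanish. At `ζ = 0` it is the `v`-th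
derivative of `f`. -/
structure IsQuotExtension (Ω : Set (Fin m → K)) (f : (Fin m → K) → Y)
    (Φ : (Fin m → K) × (Fin v → Fin m → K) × (Fin v → K) → Y) : Prop where
  continuousOn : ContinuousOn Φ (quotDomain univ Ω)
  eq_diffQuot : ∀ x h ζ, (x, h, ζ) ∈ quotDomain univ Ω → (∀ i, ζ i ≠ 0) →
    Φ (x, h, ζ) = diffQuot f x h ζ

namespace IsQuotExtension

variable {Ω : Set (Fin m → K)} {Φ : (Fin m → K) × (Fin v → Fin m → K) × (Fin v → K) → Y}
  {x : Fin m → K}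

theorem continuousAt_zero (hΦ : IsQuotExtension Ω f Φ) (hΩ : IsOpen Ω) (hx : x ∈ Ω)
    (h : Fin v → Fin m → K) : ContinuousAt Φ (x, h, 0) :=
  hΦ.continuousOn.continuousAt ((isOpen_quotDomain hΩ).mem_nhds (mem_quotDomain_zero hx h))

theorem tendsto_diffQuot (hΦ : IsQuotExtension Ω f Φ) (hΩ : IsOpen Ω) (hx : x ∈ Ω)
    (h : Fin v → Fin m → K) {X : K → Fin m → K} {Z : K → Fin v → K} (hX : Continuous X)
    (hX₀ : X 0 = x) (hZ : Continuous Z) (hZ₀ : Z 0 = 0) (hZne : ∀ τ ≠ 0, ∀ i, Z τ i ≠ 0) :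
    Filter.Tendsto (fun τ => diffQuot f (X τ) h (Z τ)) (nhdsWithin 0 {0}ᶜ)
      (nhds (Φ (x, h, 0))) := by
  have hpath : Filter.Tendsto (fun τ => (X τ, h, Z τ)) (nhdsWithin 0 {0}ᶜ) (nhds (x, h, 0)) := by
    have : Continuous fun τ => (X τ, h, Z τ) := by fun_prop
    simpa only [hX₀, hZ₀] using (this.tendsto 0).mono_left nhdsWithin_le_nhds
  refine ((hΦ.continuousAt_zero hΩ hx h).tendsto.comp hpath).congr' ?_
  filter_upwards [hpath.eventually_mem
    ((isOpen_quotDomain hΩ).mem_nhds (mem_quotDomain_zero hx h)), self_mem_nhdsWithin] with τ hτ hτ₀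
  exact hΦ.eq_diffQuot _ _ _ hτ (hZne τ hτ₀)

theorem map_update_add (hΦ : IsQuotExtension Ω f Φ) (hΩ : IsOpen Ω) (hx : x ∈ Ω)
    (h : Fin v → Fin m → K) (i : Fin v) (a a' : Fin m → K) :
    Φ (x, Function.update h i (a + a'), 0) =
      Φ (x, Function.update h i a, 0) + Φ (x, Function.update h i a', 0) := by
  have hconst (h) := hΦ.tendsto_diffQuot hΩ hx h (X := fun _ => x) (Z := fun τ _ => τ)
    continuous_const rfl (by fun_prop) rfl fun τ hτ _ => hτ
  have hmove := hΦ.tendsto_diffQuot hΩ hx (Function.update h i a) (X := fun τ => x + τ • a')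
    (Z := fun τ _ => τ) (by fun_prop) (by simp) (by fun_prop) rfl fun τ hτ _ => hτ
  refine tendsto_nhds_unique (hconst _) ((hmove.add (hconst _)).congr fun τ => ?_)
  rw [diffQuot_update_add]

theorem map_update_smul (hΦ : IsQuotExtension Ω f Φ) (hΩ : IsOpen Ω) (hx : x ∈ Ω)
    (h : Fin v → Fin m → K) (i : Fin v) (c : K) (a : Fin m → K) :
    Φ (x, Function.update h i (c • a), 0) = c • Φ (x, Function.update h i a, 0) := by
  have hlim := hΦ.tendsto_diffQuot hΩ hx (Function.update h i (c • a)) (X := fun _ => x)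
    (Z := fun τ _ => τ) continuous_const rfl (by fun_prop) rfl fun τ hτ _ => hτ
  rcases eq_or_ne c 0 with rfl | hc
  · rw [zero_smul K (Φ _)]
    refine tendsto_nhds_unique hlim (tendsto_const_nhds.congr fun τ => ?_)
    rw [diffQuot_update_smul, zero_smul]
  · have hscaled := hΦ.tendsto_diffQuot hΩ hx (Function.update h i a) (X := fun _ => x)
      (Z := fun τ => Function.update (fun _ => τ) i (c * τ)) continuous_const rfl (by fun_prop)
      (by simp [funext_iff]) fun τ hτ j => by
        rcases eq_or_ne j i with rfl | hj
        · simpa using ⟨hc, hτ⟩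
        · simpa [hj] using hτ
    refine tendsto_nhds_unique hlim ((hscaled.const_smul c).congr fun τ => ?_)
    rw [diffQuot_update_smul]

/-- The `v`-th derivative of `f` at `x`, as a multilinear map. -/
def multilinear (hΦ : IsQuotExtension Ω f Φ) (hΩ : IsOpen Ω) (hx : x ∈ Ω) :
    MultilinearMap K (fun _ : Fin v => Fin m → K) Y :=
  MultilinearMap.mk' (fun h => Φ (x, h, 0)) (hΦ.map_update_add hΩ hx) (hΦ.map_update_smul hΩ hx)

theorem apply_const_smul (hΦ : IsQuotExtension Ω f Φ) (hΩ : IsOpen Ω) (hx : x ∈ Ω) (τ : K)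
    (h : Fin m → K) : Φ (x, fun _ => τ • h, 0) = τ ^ v • Φ (x, fun _ => h, 0) := by
  have hmul := (hΦ.multilinear hΩ hx).map_smul_univ (fun _ => τ) fun _ => h
  rwa [Finset.prod_const, Finset.card_univ, Fintype.card_fin] at hmul

theorem apply_const_eq_sum (hΦ : IsQuotExtension Ω f Φ) (hΩ : IsOpen Ω) (hx : x ∈ Ω)
    (w : Fin m → K) :
    Φ (x, fun _ => w, 0) =
      ∑ r : Fin v → Fin m, (∏ i, w (r i)) • Φ (x, fun i => Pi.single (r i) 1, 0) := by
  set D := hΦ.multilinear hΩ hx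
  change D (fun _ => w) = ∑ r : Fin v → Fin m, (∏ i, w (r i)) • D fun i => Pi.single (r i) 1
  conv_lhs => rw [pi_eq_sum_univ' w, D.map_sum]
  exact Finset.sum_congr rfl fun r _ => D.map_smul_univ _ _

theorem pairing_difs_eq (hΦ : IsQuotExtension Ω f Φ) {h : Fin m → K} {ζ : Fin v → K}
    (hζ : (x, (fun _ => h), ζ) ∈ quotDomain univ Ω) :
    pairing (fun τ : K => f (x + τ • h)) (difs (List.ofFn ζ)) =
      (∏ i, ζ i) • Φ (x, fun _ => h, ζ) := by
  by_cases hne : ∀ i, ζ i ≠ 0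
  · rw [pairing_difs_ofFn f x h hne, hΦ.eq_diffQuot _ _ _ hζ hne]
  · obtain ⟨i, hi⟩ := not_forall_not.1 hne
    rw [Finset.prod_eq_zero (Finset.mem_univ i) hi, zero_smul, difs_ofFn,
      Finset.prod_eq_zero (Finset.mem_univ i) (by rw [hi, dif_zero]), map_zero]

end IsQuotExtension

end DifferenceQuotientExtensions

section Taylor

theorem nhds_replicate_le_map_ofFn {X : Type*} [TopologicalSpace X] (v : ℕ) (x : X) :
    nhds (List.replicate v x) ≤ (nhds fun _ : Fin v => x).map List.ofFn := by
  induction v with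
  | zero => simp [nhds_nil, Filter.map_pure, nhds_discrete]
  | succ v ih =>
    have hcons : Filter.Tendsto (fun w : X × (Fin v → X) => (Fin.cons w.1 w.2 : Fin (v + 1) → X))
        (nhds x ×ˢ nhds fun _ => x) (nhds fun _ => x) := by
      rw [← nhds_prod_eq]
      exact (Continuous.finCons continuous_fst continuous_snd).tendsto' _ _
        (Fin.cons_self_tail fun _ => x)
    refine (List.tendsto_cons_iff (f := id)).2 (Filter.Tendsto.mono_left ?_
      (Filter.prod_mono le_rfl ih))
    rw [Filter.prod_map_right, Filter.tendsto_map'_iff]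
    exact (Filter.tendsto_map.comp hcons).congr fun w => List.ofFn_cons _ _

variable {K : Type*} [NontriviallyNormedField K] {m l p v : ℕ}
  {Y : Type*} [NormedAddCommGroup Y] [NormedSpace K Y] {f : (Fin m → K) → Y}
  {Ω : Set (Fin m → K)}

namespace IsQuotExtension

variable {Φ : (Fin m → K) × (Fin v → Fin m → K) × (Fin v → K) → Y} {x : Fin m → K} {δ C : ℝ}

theorem isLittleO_pairing_difs_sub (hΦ : IsQuotExtension Ω f Φ) (hΩ : IsOpen Ω) (hx : x ∈ Ω)
    (h : Fin m → K) :
    (fun L : List K => pairing (fun τ : K => f (x + τ • h)) (difs L) -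
      L.prod • Φ (x, fun _ => h, 0)) =o[nhds (List.replicate v 0)] List.prod := by
  have hpath : Filter.Tendsto (fun ζ : Fin v → K => (x, (fun _ : Fin v => h), ζ)) (nhds 0)
      (nhds (x, (fun _ : Fin v => h), 0)) := Continuous.tendsto (by fun_prop) 0
  have hlim : (fun ζ => Φ (x, fun _ => h, ζ) - Φ (x, fun _ => h, 0)) =o[nhds 0]
      fun _ => (1 : K) := by
    rw [Asymptotics.isLittleO_one_iff, ← sub_self (Φ (x, fun _ => h, 0))]
    exact ((hΦ.continuousAt_zero hΩ hx _).tendsto.comp hpath).sub_const _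
  refine (Asymptotics.isLittleO_map.2 ?_).mono (nhds_replicate_le_map_ofFn v 0)
  refine ((Asymptotics.isBigO_refl (fun ζ : Fin v → K => ∏ i, ζ i) _).smul_isLittleO
    hlim).congr' ?_ (Filter.Eventually.of_forall fun ζ => ?_)
  · filter_upwards [hpath.eventually_mem
      ((isOpen_quotDomain hΩ).mem_nhds (mem_quotDomain_zero hx _))] with ζ hζ
    rw [Function.comp_apply, hΦ.pairing_difs_eq hζ, List.prod_ofFn, smul_sub]
  · simp only [Function.comp_apply, List.prod_ofFn, smul_eq_mul, mul_one]

theorem diffBound (hΦ : IsQuotExtension Ω f Φ) {h : Fin m → K}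
    (hdom : ∀ ζ ∈ Metric.closedBall (0 : Fin v → K) δ, (x, (fun _ => h), ζ) ∈ quotDomain univ Ω)
    (hC : ∀ ζ ∈ Metric.closedBall (0 : Fin v → K) δ, ‖Φ (x, fun _ => h, ζ)‖ ≤ C) :
    DiffBound δ v v C fun τ : K => f (x + τ • h) := by
  intro L hL ρ hρ₀ hρδ hρ
  subst hL
  have hmem : L.get ∈ Metric.closedBall 0 δ := mem_closedBall_zero_iff.2 <|
    (pi_norm_le_iff_of_nonneg (hρ₀.trans hρδ)).2 fun i => (hρ _ (L.get_mem i)).trans hρδ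
  have hpairing := hΦ.pairing_difs_eq (hdom _ hmem)
  rw [← List.prod_ofFn, List.ofFn_get] at hpairing
  rw [hpairing, norm_smul, Nat.sub_self, pow_zero, mul_one, mul_comm]
  gcongr
  exact hC _ hmem

end IsQuotExtension

theorem closedBall_prod_subset_quotDomain {x₀ : Fin m → K} {r s : ℝ}
    (hΩ : Metric.closedBall x₀ (r + v * s) ⊆ Ω) :
    Metric.closedBall x₀ r ×ˢ Metric.closedBall 0 1 ×ˢ Metric.closedBall 0 s ⊆
      quotDomain (v := v) univ Ω := by
  rintro ⟨x, h, ζ⟩ ⟨hx, hh, hζ⟩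
  refine ⟨trivial, fun S => hΩ ?_⟩
  simp only [mem_closedBall_iff_norm, sub_zero] at hx hh hζ ⊢
  have hs : 0 ≤ s := (norm_nonneg ζ).trans hζ
  have hterm : ∀ i ∈ S, ‖ζ i • h i‖ ≤ s := fun i _ => by
    rw [norm_smul, ← mul_one s]
    exact mul_le_mul ((norm_le_pi_norm ζ i).trans hζ) ((norm_le_pi_norm h i).trans hh)
      (norm_nonneg _) hs
  have hsum : ‖∑ i ∈ S, ζ i • h i‖ ≤ v * s := by
    refine (norm_sum_le_of_le S hterm).trans ?_
    rw [Finset.sum_const, nsmul_eq_mul]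
    gcongr
    exact (Finset.card_le_univ S).trans_eq (Fintype.card_fin v)
  calc ‖vertex x h ζ S - x₀‖ = ‖(x - x₀) + ∑ i ∈ S, ζ i • h i‖ := by
        rw [vertex, add_sub_right_comm]
    _ ≤ r + v * s := norm_add_le_of_le hx hsum

theorem exists_eq_smul_norm_eq (w : Fin m → K) :
    ∃ (τ : K) (h : Fin m → K), w = τ • h ∧ ‖τ‖ = ‖w‖ ∧ ‖h‖ ≤ 1 := by
  rcases eq_or_ne w 0 with rfl | hw
  · exact ⟨0, 0, by simp⟩
  obtain ⟨i₀, -⟩ := Function.ne_iff.1 hw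
  have : Nonempty (Fin m) := ⟨i₀⟩
  obtain ⟨i, hi⟩ := Finite.exists_max fun i => ‖w i‖
  have hnorm : ‖w i‖ = ‖w‖ :=
    le_antisymm (norm_le_pi_norm w i) ((pi_norm_le_iff_of_nonneg (norm_nonneg _)).2 hi)
  have hpos : 0 < ‖w‖ := norm_pos_iff.2 hw
  have hne : w i ≠ 0 := norm_pos_iff.1 (hnorm ▸ hpos)
  refine ⟨w i, (w i)⁻¹ • w, (smul_inv_smul₀ hne w).symm, hnorm, ?_⟩
  rw [norm_smul, norm_inv, hnorm, inv_mul_cancel₀ hpos.ne']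

/-- The Taylor polynomial of degree less than `l` at `x`, evaluated at `z`; here `Φ v` extends the
`v`-th difference quotient, so that `Φ v (x, ·, 0)` is the `v`-th derivative at `x`. -/
def taylorPoly (Φ : ∀ v : ℕ, (Fin m → K) × (Fin v → Fin m → K) × (Fin v → K) → Y) (l : ℕ)
    (x z : Fin m → K) : Y :=
  ∑ k ∈ Finset.range l, (k.factorial : K)⁻¹ • Φ k (x, fun _ => z - x, 0)

variable {Φ : ∀ v : ℕ, (Fin m → K) × (Fin v → Fin m → K) × (Fin v → K) → Y}

theorem norm_sub_taylorPoly_le [CharZero K] (hΦ : ∀ v < l, IsQuotExtension Ω f (Φ v)) (hl : 1 ≤ l)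
    (hΩ : IsOpen Ω) (hnat : ∀ c : ℕ, ‖(c : K)‖ ≤ 1) (hp : (p : K) ≠ 0) (hp1 : ‖(p : K)‖ < 1)
    {x : Fin m → K} (hx : x ∈ Ω) {h : Fin m → K} {s C : ℝ} (hC : 0 ≤ C)
    (hf : DiffBound s l l C fun τ : K => f (x + τ • h)) {τ : K} (hτ : ‖τ‖ ≤ s) :
    ‖f (x + τ • h) - taylorPoly Φ l x (x + τ • h)‖ ≤
      (l * (p / ‖(p : K)‖) / (1 - ‖(p : K)‖)) ^ (l - 1) * C * ‖τ‖ ^ l := by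
  have hpoly : taylorPoly Φ l x (x + τ • h) =
      ∑ k ∈ Finset.range l, τ ^ k • (k.factorial : K)⁻¹ • Φ k (x, fun _ => h, 0) :=
    Finset.sum_congr rfl fun k hk => by
      rw [add_sub_cancel_left, (hΦ k (Finset.mem_range.1 hk)).apply_const_smul hΩ hx, smul_comm]
  rw [hpoly]
  refine norm_sub_sum_pow_smul_le hf hl hC hnat hp hp1
    (fun k => (k.factorial : K)⁻¹ • Φ k (x, fun _ => h, 0)) (fun v hv => ?_) τ hτ
  simpa only [smul_inv_smul₀ (Nat.cast_ne_zero.2 v.factorial_ne_zero : (v.factorial : K) ≠ 0)]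
    using (hΦ v hv).isLittleO_pairing_difs_sub hΩ hx h

theorem exists_norm_sub_taylorPoly_le [CharZero K] [ProperSpace K]
    (hΦ : ∀ v ≤ l, IsQuotExtension Ω f (Φ v)) (hl : 1 ≤ l) (hΩ : IsOpen Ω)
    (hnat : ∀ c : ℕ, ‖(c : K)‖ ≤ 1) (hp : (p : K) ≠ 0) (hp1 : ‖(p : K)‖ < 1) {x₀ : Fin m → K}
    {r s : ℝ} (hs : 0 ≤ s) (hball : Metric.closedBall x₀ (r + l * s) ⊆ Ω) :
    ∃ C, 0 ≤ C ∧ ∀ x ∈ Metric.closedBall x₀ r, ∀ z, ‖z - x‖ ≤ s →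
      ‖f z - taylorPoly Φ l x z‖ ≤ C * ‖z - x‖ ^ l := by
  have hdom := closedBall_prod_subset_quotDomain (v := l) hball
  obtain ⟨C, hC⟩ := ((isCompact_closedBall x₀ r).prod ((isCompact_closedBall 0 1).prod
    (isCompact_closedBall 0 s))).exists_bound_of_continuousOn
      ((hΦ l le_rfl).continuousOn.mono hdom)
  have : 0 ≤ 1 - ‖(p : K)‖ := sub_nonneg.2 hp1.le
  refine ⟨(l * (p / ‖(p : K)‖) / (1 - ‖(p : K)‖)) ^ (l - 1) * max C 0, by positivity,
    fun x hx z hz => ?_⟩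
  have hxΩ : x ∈ Ω :=
    hball (Metric.closedBall_subset_closedBall (le_add_of_nonneg_right (by positivity)) hx)
  obtain ⟨τ, h, hτh, hτ, hh⟩ := exists_eq_smul_norm_eq (z - x)
  have hhpi : (fun _ : Fin l => h) ∈ Metric.closedBall 0 1 := mem_closedBall_zero_iff.2 <|
    (pi_norm_le_iff_of_nonneg zero_le_one).2 fun _ => hh
  have hmem (ζ) (hζ : ζ ∈ Metric.closedBall (0 : Fin l → K) s) :=
    mk_mem_prod hx (mk_mem_prod hhpi hζ)
  have hdiff : DiffBound s l l (max C 0) fun τ : K => f (x + τ • h) :=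
    (hΦ l le_rfl).diffBound (fun ζ hζ => hdom (hmem ζ hζ))
      fun ζ hζ => (hC _ (hmem ζ hζ)).trans (le_max_left _ _)
  have hz' : z = x + τ • h := by rw [← hτh, add_sub_cancel]
  rw [← hτ, hz']
  exact norm_sub_taylorPoly_le (fun v hv => hΦ v hv.le) hl hΩ hnat hp hp1 hxΩ (le_max_right _ _)
    hdiff (hτ.trans_le hz)

theorem IsQuotExtension.polyFamily {b : ℕ} {f : (Fin m → K) → Fin b → K}
    {Φ : (Fin m → K) × (Fin v → Fin m → K) × (Fin v → K) → Fin b → K}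
    (hΦ : IsQuotExtension Ω f Φ) (hΩ : IsOpen Ω) {B : Set (Fin m → K)} (hB : IsCompact B)
    (hBΩ : B ⊆ Ω) (j : Fin b) :
    PolyFamily fun (x : B) (z : Fin m → K) => Φ (x, fun _ => z - x, 0) j := by
  have hexpand : (fun (x : B) (z : Fin m → K) => Φ (x, fun _ => z - x, 0) j) = fun (x : B) z =>
      ∑ r : Fin v → Fin m, (∏ i, (z (r i) - (x : Fin m → K) (r i))) *
        Φ (x, fun i => Pi.single (r i) 1, 0) j := by
    ext x z
    rw [hΦ.apply_const_eq_sum hΩ (hBΩ x.2), Finset.sum_apply]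
    rfl
  have hparam {θ : (Fin m → K) → K} (hθ : ContinuousOn θ B) :
      PolyFamily fun (x : B) (_ : Fin m → K) => θ x := by
    obtain ⟨C, hC⟩ := hB.exists_bound_of_continuousOn hθ
    exact .param _ C fun x => hC x x.2
  rw [hexpand]
  refine .sum _ fun r _ => .mul
    (.prod _ fun i _ => .sub (.coord _) (hparam (θ := fun x => x (r i)) ?_))
    (hparam (θ := fun x => Φ (x, fun i => Pi.single (r i) 1, 0) j) ?_)
  · exact (continuous_apply (r i)).continuousOn
  · refine (continuous_apply j).comp_continuousOn
      (hΦ.continuousOn.comp (by fun_prop) fun x hx => mem_quotDomain_zero (hBΩ hx) _)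

theorem polyFamily_taylorPoly {b : ℕ} {f : (Fin m → K) → Fin b → K}
    {Φ : ∀ v : ℕ, (Fin m → K) × (Fin v → Fin m → K) × (Fin v → K) → Fin b → K}
    (hΦ : ∀ v ≤ l, IsQuotExtension Ω f (Φ v)) (hΩ : IsOpen Ω) {B : Set (Fin m → K)}
    (hB : IsCompact B) (hBΩ : B ⊆ Ω) (j : Fin b) :
    PolyFamily fun (x : B) (z : Fin m → K) => taylorPoly Φ l x z j := by
  simp only [taylorPoly, Finset.sum_apply, Pi.smul_apply, smul_eq_mul]
  exact .sum _ fun k hk => .mul (.const _)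
    ((hΦ k (Finset.mem_range.1 hk).le).polyFamily hΩ hB hBΩ j)

theorem PolyFamily.isWhitney_of_approx {x₀ : Fin m → K} {ρ C : ℝ} (hρ : 0 < ρ)
    {P : Metric.closedBall x₀ ρ → (Fin m → K) → K} (hP : PolyFamily P) {g : (Fin m → K) → K}
    (hC : 0 ≤ C) (hg : ∀ (t : Metric.closedBall x₀ ρ) z, ‖z - (t : Fin m → K)‖ ≤ ρ →
      ‖g z - P t z‖ ≤ C * ‖z - (t : Fin m → K)‖ ^ l) :
    IsWhitney l Subtype.val P := fun R => by
  obtain ⟨B, hB, hPB⟩ := hP.bounded R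
  refine ⟨2 * C + 2 * B / ρ ^ l, by positivity, fun s t z hz => ?_⟩
  set d := ‖z - (t : Fin m → K)‖ + ‖z - (s : Fin m → K)‖
  by_cases hclose : ‖z - (t : Fin m → K)‖ ≤ ρ ∧ ‖z - (s : Fin m → K)‖ ≤ ρ
  · have ht : ‖g z - P t z‖ ≤ C * d ^ l := (hg t z hclose.1).trans (by
      gcongr; exact le_add_of_nonneg_right (norm_nonneg _))
    have hs : ‖g z - P s z‖ ≤ C * d ^ l := (hg s z hclose.2).trans (by
      gcongr; exact le_add_of_nonneg_left (norm_nonneg _))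
    calc ‖P t z - P s z‖ = ‖(g z - P s z) - (g z - P t z)‖ := by abel_nf
      _ ≤ C * d ^ l + C * d ^ l := norm_sub_le_of_le hs ht
      _ = 2 * C * d ^ l := by ring
      _ ≤ _ := by gcongr; exact le_add_of_nonneg_right (by positivity)
  · have hρd : ρ ≤ d := by
      by_contra! hlt
      have ht := norm_nonneg (z - (t : Fin m → K))
      have hs := norm_nonneg (z - (s : Fin m → K))
      exact hclose ⟨by linarith, by linarith⟩
    calc ‖P t z - P s z‖ ≤ B + B := norm_sub_le_of_le (hPB t z hz) (hPB s z hz)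
      _ = 2 * B / ρ ^ l * ρ ^ l := by field_simp; ring
      _ ≤ (2 * C + 2 * B / ρ ^ l) * d ^ l := by
        gcongr; exact le_add_of_nonneg_left (by positivity)

theorem IsC.exists_isJetFamily [CharZero K] [ProperSpace K] {b : ℕ} {f : (Fin m → K) → Fin b → K}
    (hf : IsC l Ω f) (hl : 1 ≤ l) (hΩ : IsOpen Ω) (hnat : ∀ c : ℕ, ‖(c : K)‖ ≤ 1)
    (hp : (p : K) ≠ 0) (hp1 : ‖(p : K)‖ < 1) {x₀ : Fin m → K} (hx₀ : x₀ ∈ Ω) :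
    ∃ ρ > 0, ∃ P : Fin b → Metric.closedBall x₀ ρ → (Fin m → K) → K,
      IsJetFamily l Subtype.val P ∧ ∃ C, ∀ j (t : Metric.closedBall x₀ ρ) z,
        ‖z - (t : Fin m → K)‖ ≤ ρ → ‖f z j - P j t z‖ ≤ C * ‖z - (t : Fin m → K)‖ ^ l := by
  choose! Φ hcont heq using hf
  have hΦ : ∀ v ≤ l, IsQuotExtension Ω f (Φ v) := fun v hv => ⟨hcont v hv, heq v hv⟩
  obtain ⟨r, hr, hrΩ⟩ := Metric.nhds_basis_closedBall.mem_iff.1 (hΩ.mem_nhds hx₀)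
  set ρ := r / (l + 1)
  have hρ : 0 < ρ := by positivity
  have hρr : ρ + l * ρ = r := by simp only [ρ]; field_simp; ring
  have hρΩ : Metric.closedBall x₀ ρ ⊆ Ω :=
    (Metric.closedBall_subset_closedBall (by nlinarith [l.cast_nonneg (α := ℝ)])).trans hrΩ
  obtain ⟨C, hC, htaylor⟩ := exists_norm_sub_taylorPoly_le hΦ hl hΩ hnat hp hp1 hρ.le
    (hρr ▸ hrΩ)
  have happrox (j) (t : Metric.closedBall x₀ ρ) (z) (hz : ‖z - (t : Fin m → K)‖ ≤ ρ) :
      ‖f z j - taylorPoly Φ l t z j‖ ≤ C * ‖z - (t : Fin m → K)‖ ^ l :=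
    (norm_le_pi_norm (f z - taylorPoly Φ l t z) j).trans (htaylor t t.2 z hz)
  have hpoly (j) := polyFamily_taylorPoly hΦ hΩ (isCompact_closedBall x₀ ρ) hρΩ j
  exact ⟨ρ, hρ, fun j t z => taylorPoly Φ l t z j, ⟨continuous_subtype_val, hpoly,
    fun j => (hpoly j).isWhitney_of_approx hρ hC (happrox j)⟩, C, happrox⟩

end Taylor

section LocalSard

variable {K : Type*} [NontriviallyNormedField K] {a b l p : ℕ}

theorem hasFDerivAt_of_norm_sub_le_pow {E F : Type*} [NormedAddCommGroup E] [NormedSpace K E]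
    [NormedAddCommGroup F] [NormedSpace K F] {f P : E → F} {P' : E →L[K] F} {x : E} {ρ C : ℝ}
    (hP : HasFDerivAt P P' x) (hl : 1 < l) (hρ : 0 < ρ)
    (hf : ∀ z, ‖z - x‖ ≤ ρ → ‖f z - P z‖ ≤ C * ‖z - x‖ ^ l) : HasFDerivAt f P' x := by
  have hO : (fun z => f z - P z) =O[nhds x] fun z => ‖z - x‖ ^ l := by
    refine .of_bound C ?_
    filter_upwards [Metric.closedBall_mem_nhds x hρ] with z hz
    rw [norm_pow, norm_norm]
    exact hf z (mem_closedBall_iff_norm.1 hz)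
  simpa [Pi.add_def] using (hO.hasFDerivAt (𝕜 := K) hl).add hP

section Critical

variable {T : Type*} {u : T → Fin a → K} {F : Fin b → T → (Fin a → K) → K} {t : T}

theorem isCritical_iff_sum_fderiv_eq_zero (hF : ∀ j, DifferentiableAt K (F j t) (u t)) :
    IsCritical u F t ↔ ∃ v : Fin b → K, v ≠ 0 ∧ ∑ j, v j • fderiv K (F j t) (u t) = 0 := by
  have hderiv (v : Fin b → K) : HasFDerivAt (fun z => ∑ j, v j * F j t z)
      (∑ j, v j • fderiv K (F j t) (u t)) (u t) :=
    .fun_sum fun j _ => (hF j).hasFDerivAt.const_mul (v j)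
  exact exists_congr fun v => and_congr_right fun _ =>
    ⟨fun h => (hderiv v).unique h, fun h => h ▸ hderiv v⟩

theorem isCritical_iff_exists_mem_sphere (hF : ∀ j, DifferentiableAt K (F j t) (u t)) :
    IsCritical u F t ↔ ∃ v ∈ Metric.sphere (0 : Fin b → K) 1,
      ∀ i, ∑ j, v j * partialDeriv i (F j t) (u t) = 0 := by
  have hzero (v : Fin b → K) : ∑ j, v j • fderiv K (F j t) (u t) = 0 ↔
      ∀ i, ∑ j, v j * partialDeriv i (F j t) (u t) = 0 := by
    refine ⟨fun h i => ?_, fun h => ContinuousLinearMap.coe_injective <|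
      LinearMap.pi_ext' fun i => LinearMap.ext_ring ?_⟩
    · simpa [partialDeriv] using DFunLike.congr_fun h (Pi.single i 1)
    · simpa [partialDeriv] using h i
  simp only [isCritical_iff_sum_fderiv_eq_zero hF, hzero, mem_sphere_zero_iff_norm]
  refine ⟨fun ⟨v, hv, hcrit⟩ => ?_,
    fun ⟨v, hv, hcrit⟩ => ⟨v, norm_ne_zero_iff.1 (by simp [hv]), hcrit⟩⟩
  obtain ⟨τ, h, rfl, hτ, -⟩ := exists_eq_smul_norm_eq v
  have hτ₀ : τ ≠ 0 := (smul_ne_zero_iff.1 hv).1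
  refine ⟨h, ?_, fun i => ?_⟩
  · rwa [norm_smul, eq_comm, mul_eq_left₀ (norm_ne_zero_iff.2 hτ₀)] at hτ
  · have := hcrit i
    simp only [Pi.smul_apply, smul_eq_mul, mul_assoc, ← Finset.mul_sum] at this
    exact (mul_eq_zero.1 this).resolve_left hτ₀

theorem isCritical_of_finrank_lt (hF : ∀ j, DifferentiableAt K (F j t) (u t))
    (hrank : Module.finrank K (LinearMap.range
      (ContinuousLinearMap.pi fun j => fderiv K (F j t) (u t)).toLinearMap) < b) :
    IsCritical u F t := by
  set J := ContinuousLinearMap.pi fun j => fderiv K (F j t) (u t)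
  have hlt : LinearMap.range J.toLinearMap < ⊤ := lt_top_iff_ne_top.2 fun h => by
    rw [h, finrank_top, Module.finrank_fin_fun] at hrank
    exact hrank.false
  obtain ⟨φ, hφ, hker⟩ := Submodule.exists_le_ker_of_lt_top _ hlt
  have hφsum (w : Fin b → K) : φ w = ∑ j, φ (Pi.single j 1) * w j := by
    conv_lhs => rw [pi_eq_sum_univ' w, map_sum]
    simp only [map_smul, smul_eq_mul, mul_comm]
  refine (isCritical_iff_sum_fderiv_eq_zero hF).2 ⟨fun j => φ (Pi.single j 1), fun h => ?_, ?_⟩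
  · exact hφ (LinearMap.ext fun w => by simp [hφsum w, congrFun h])
  · ext1 w
    have hJw : φ (J w) = 0 := hker ⟨w, rfl⟩
    simpa [J] using (hφsum (J w)).symm.trans hJw

theorem IsJetFamily.isClosed_setOf_isCritical [ProperSpace K] [TopologicalSpace T] [CompactSpace T]
    (hF : IsJetFamily l u F) (hl : a < l) : IsClosed {t | IsCritical u F t} := by
  let Z : Set (T × Metric.sphere (0 : Fin b → K) 1) :=
    {w | ∀ i, ∑ j, (w.2 : Fin b → K) j * partialDeriv i (F j w.1) (u w.1) = 0}
  have hZ : IsClosed Z := by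
    simp only [Z, ofPred_forall]
    refine isClosed_iInter fun i => isClosed_eq (continuous_finsetSum _ fun j _ => ?_)
      continuous_const
    have hpd := hF.continuous_iterPartialDeriv j (L := [i])
      (by rw [List.length_singleton]; have := i.isLt; lia)
    exact ((continuous_apply j).comp (continuous_subtype_val.comp continuous_snd)).mul
      (hpd.comp continuous_fst)
  have : CompactSpace (Metric.sphere (0 : Fin b → K) 1) :=
    isCompact_iff_compactSpace.1 (isCompact_sphere _ _)
  convert isClosedMap_fst_of_compactSpace _ hZ
  ext t
  simp [isCritical_iff_exists_mem_sphere fun j => (hF.polyFamily j).differentiable t (u t), Z]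

end Critical

theorem IsC.exists_null [CharZero K] [ProperSpace K] [MeasurableSpace K] [BorelSpace K]
    (μ : Measure K) [μ.IsAddHaarMeasure] {Ω : Set (Fin a → K)} {f : (Fin a → K) → Fin b → K}
    (hf : IsC l Ω f) (hl : a < l) (hΩ : IsOpen Ω) (hnat : ∀ c : ℕ, ‖(c : K)‖ ≤ 1)
    (hp : (p : K) ≠ 0) (hp1 : ‖(p : K)‖ < 1) {x₀ : Fin a → K} (hx₀ : x₀ ∈ Ω) :
    ∃ ρ > 0, ∃ S : Set (Fin b → K), IsCompact S ∧ (Measure.pi fun _ => μ) S = 0 ∧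
      ∀ x ∈ Metric.closedBall x₀ ρ,
        Module.finrank K (LinearMap.range (fderiv K f x).toLinearMap) < b → f x ∈ S := by
  obtain ⟨ρ, hρ, P, hP, C, hC⟩ := hf.exists_isJetFamily (by lia) hΩ hnat hp hp1 hx₀
  have : CompactSpace (Metric.closedBall x₀ ρ) :=
    isCompact_iff_compactSpace.1 (isCompact_closedBall _ _)
  have hdiff (t j) : DifferentiableAt K (P j t) t := (hP.polyFamily j).differentiable t t
  have hfP (t : Metric.closedBall x₀ ρ) (j) : P j t t = f t j := by
    have := hC j t t (by simp [hρ.le])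
    rw [sub_self, norm_zero, zero_pow (by lia), mul_zero, norm_le_zero_iff, sub_eq_zero] at this
    exact this.symm
  have hderiv (t : Metric.closedBall x₀ ρ) :
      HasFDerivAt f (ContinuousLinearMap.pi fun j => fderiv K (P j t) t) t := by
    obtain rfl | ha := a.eq_zero_or_pos
    · exact hasFDerivAt_of_subsingleton _ _ |>.congr_fderiv (Subsingleton.elim _ _)
    · exact hasFDerivAt_pi.2 fun j =>
        hasFDerivAt_of_norm_sub_le_pow (hdiff t j).hasFDerivAt (by lia) hρ (hC j t)
  set A := {t : Metric.closedBall x₀ ρ | IsCritical Subtype.val P t}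
  have : CompactSpace A := isCompact_iff_compactSpace.1 (hP.isClosed_setOf_isCritical hl).isCompact
  refine ⟨ρ, hρ, range fun (t : A) j => P j t t.1, isCompact_range
    ((hP.restrict A).continuous_eval (by lia)), sardAt μ hl b A _ _ (hP.restrict A) fun t => t.2,
    fun x hx hrank => ?_⟩
  rw [(hderiv ⟨x, hx⟩).fderiv] at hrank
  exact ⟨⟨⟨x, hx⟩, isCritical_of_finrank_lt (hdiff _) hrank⟩, funext (hfP _)⟩

end LocalSard

section Differentiability

variable {K : Type*} [NontriviallyNormedField K] {m : ℕ}
  {Y : Type*} [NormedAddCommGroup Y] [NormedSpace K Y] {f : (Fin m → K) → Y}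
  {Ω : Set (Fin m → K)} {x : Fin m → K}

theorem HasContDiffQuot.mono {v : ℕ} {H H' : Set (Fin v → Fin m → K)} (hH : H ⊆ H')
    (hf : HasContDiffQuot H' Ω f) : HasContDiffQuot H Ω f := by
  obtain ⟨Φ, hΦ, hΦf⟩ := hf
  have hsub : quotDomain H Ω ⊆ quotDomain H' Ω := fun w hw => ⟨hH hw.1, hw.2⟩
  exact ⟨Φ, hΦ.mono hsub, fun x h ζ hw => hΦf x h ζ (hsub hw)⟩

theorem diffQuot_one (f : (Fin m → K) → Y) (x : Fin m → K) (h : Fin 1 → Fin m → K)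
    (ζ : Fin 1 → K) : diffQuot f x h ζ = (ζ 0)⁻¹ • (f (x + ζ 0 • h 0) - f x) := by
  rw [diffQuot_eq_pairing]
  simp [dif]

theorem HasContDiffQuot.exists_isLittleO {h : Fin m → K}
    (hf : HasContDiffQuot {fun _ : Fin 1 => h} Ω f) (hΩ : IsOpen Ω) (hx : x ∈ Ω) :
    ∃ D : Y, (fun w : (Fin m → K) × K => f (w.1 + w.2 • h) - f w.1 - w.2 • D)
      =o[nhds (x, 0)] Prod.snd := by
  obtain ⟨Φ, hΦ, hΦf⟩ := hf
  let path : (Fin m → K) × K → (Fin m → K) × (Fin 1 → Fin m → K) × (Fin 1 → K) :=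
    fun w => (w.1, fun _ => h, fun _ => w.2)
  have hpath : Filter.Tendsto path (nhds (x, 0)) (nhds (path (x, 0))) :=
    Continuous.tendsto (by fun_prop) _
  have hdom : ∀ᶠ w in nhds (x, (0 : K)), path w ∈ quotDomain {fun _ => h} Ω := by
    filter_upwards [hpath.eventually_mem
      ((isOpen_quotDomain hΩ).mem_nhds (mem_quotDomain_zero hx _))] with w hw
    exact ⟨rfl, hw.2⟩
  have hlim : (fun w => Φ (path w) - Φ (path (x, 0))) =o[nhds (x, 0)] fun _ => (1 : K) := by
    rw [Asymptotics.isLittleO_one_iff, ← sub_self (Φ (path (x, 0)))]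
    exact ((hΦ _ hdom.self_of_nhds).tendsto.comp
      (tendsto_nhdsWithin_iff.2 ⟨hpath, hdom⟩)).sub_const _
  refine ⟨Φ (path (x, 0)), ((Asymptotics.isBigO_refl Prod.snd _).smul_isLittleO hlim).congr' ?_
    (.of_forall fun w => mul_one w.2)⟩
  filter_upwards [hdom] with w hw
  rcases eq_or_ne w.2 0 with hw₀ | hw₀
  · simp [hw₀]
  · rw [hΦf _ _ _ hw fun _ => hw₀, diffQuot_one, smul_sub, smul_inv_smul₀ hw₀]

/-- The point of `K^m` with the first `k` coordinates of `z` and the remaining ones of `x`; these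
points form the path from `x` to `z` along the coordinate axes. -/
def hybrid (x z : Fin m → K) (k : ℕ) : Fin m → K := fun j => if (j : ℕ) < k then z j else x j

theorem hybrid_succ (x z : Fin m → K) (k : Fin m) :
    hybrid x z (k + 1) = hybrid x z k + (z k - x k) • Pi.single k 1 := by
  ext j
  rcases lt_trichotomy (j : ℕ) k with h | h | h
  · simp [hybrid, h, Nat.lt_succ_of_lt h, (Fin.lt_def.2 h).ne]
  · obtain rfl := Fin.ext h
    simp [hybrid]
  · simp [hybrid, h.not_gt, Nat.not_lt.2 (Nat.succ_le_of_lt h), (Fin.lt_def.2 h).ne']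

theorem hasFDerivAt_of_isLittleO_partial {D : Fin m → Y}
    (hf : ∀ j, (fun w : (Fin m → K) × K => f (w.1 + w.2 • Pi.single j 1) - f w.1 - w.2 • D j)
      =o[nhds (x, 0)] Prod.snd) :
    HasFDerivAt f (∑ j, (ContinuousLinearMap.proj (R := K) j).smulRight (D j)) x := by
  have hcoord (j : Fin m) : (fun z : Fin m → K => f (hybrid x z (j + 1)) - f (hybrid x z j)
      - (z j - x j) • D j) =o[nhds x] fun z => z - x := by
    have hpath : Filter.Tendsto (fun z => (hybrid x z j, z j - x j)) (nhds x) (nhds (x, 0)) := by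
      refine Continuous.tendsto' (.prodMk (continuous_pi fun i => ?_) (by fun_prop)) _ _ ?_
      · unfold hybrid
        split_ifs <;> fun_prop
      · ext i <;> simp [hybrid]
    refine (((hf j).comp_tendsto hpath).congr_left fun z => ?_).trans_isBigO
      (.of_bound 1 (.of_forall fun z => ?_))
    · rw [Function.comp_apply, hybrid_succ]
    · simpa using norm_le_pi_norm (z - x) j
  have htele (z : Fin m → K) :
      ∑ j : Fin m, (f (hybrid x z (j + 1)) - f (hybrid x z j)) = f z - f x := by
    rw [Fin.sum_univ_eq_sum_range fun k => f (hybrid x z (k + 1)) - f (hybrid x z k),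
      Finset.sum_range_sub fun k => f (hybrid x z k),
      show hybrid x z m = z by ext; simp [hybrid], show hybrid x z 0 = x by ext; simp [hybrid]]
  refine .of_isLittleO
    ((Asymptotics.IsLittleO.sum (s := Finset.univ) fun j _ => hcoord j).congr_left fun z => ?_)
  simp [Finset.sum_apply, Finset.sum_sub_distrib, htele]

theorem differentiableAt_of_hasContDiffQuot
    (hf : ∀ j, HasContDiffQuot {fun _ : Fin 1 => Pi.single j 1} Ω f) (hΩ : IsOpen Ω)
    (hx : x ∈ Ω) : DifferentiableAt K f x := by
  choose D hD using fun j => (hf j).exists_isLittleO hΩ hx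
  exact (hasFDerivAt_of_isLittleO_partial hD).differentiableAt

theorem IsC.differentiableAt {l : ℕ} (hf : IsC l Ω f) (hl : 1 ≤ l) (hΩ : IsOpen Ω) (hx : x ∈ Ω) :
    DifferentiableAt K f x :=
  differentiableAt_of_hasContDiffQuot (fun _ => (hf 1 hl).mono (subset_univ _)) hΩ hx

theorem IsCPair.differentiableAt {t s : ℕ} (hf : IsCPair t s Ω f) (ht : 1 ≤ t) (hΩ : IsOpen Ω)
    (hx : x ∈ Ω) : DifferentiableAt K f x := by
  refine differentiableAt_of_hasContDiffQuot (fun j => hf 1 (fun _ => j) ?_) hΩ hx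
  calc ∑ i, ((Finset.univ.filter fun _ : Fin 1 => j = i).card - s)
      ≤ ∑ i, (Finset.univ.filter fun _ : Fin 1 => j = i).card :=
        Finset.sum_le_sum fun i _ => Nat.sub_le _ _
    _ = 1 := by simp [apply_ite Finset.card]
    _ ≤ t := ht

end Differentiability

section Charts

variable {K : Type*} [NontriviallyNormedField K] {a b l : ℕ}
  {M : Type*} [TopologicalSpace M] [ChartedSpace (Fin a → K) M]
  {N : Type*} [TopologicalSpace N] [ChartedSpace (Fin b → K) N]
  {f : M → N} {z : M} {e : OpenPartialHomeomorph M (Fin a → K)}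
  {e' : OpenPartialHomeomorph N (Fin b → K)}

variable (K a M) in
/-- The coordinate changes of the atlas of `M` are differentiable; this is what makes the rank of
a differential independent of the charts. -/
def IsDifferentiableAtlas : Prop :=
  ∀ e ∈ atlas (Fin a → K) M, ∀ e' ∈ atlas (Fin a → K) M,
    ∀ x ∈ e.target ∩ e.symm ⁻¹' e'.source, DifferentiableAt K (e' ∘ e.symm) x

theorem IsSCManifold.isDifferentiableAtlas {A : ApproxSystem K} {q n : ℕ}
    (hM : IsSCManifold A q n a M) : IsDifferentiableAtlas K a M := by
  intro e he e' he' x hx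
  rcases eq_or_ne e e' with rfl | hne
  · refine differentiableAt_id.congr_of_eventuallyEq ?_
    filter_upwards [e.open_target.mem_nhds hx.1] with y hy using e.right_inv hy
  · exact (hM.transition e he e' he' hne).1.differentiableAt (Nat.le_add_left 1 q)
      (e.symm.isOpen_inter_preimage e'.open_source) hx

theorem IsDifferentiableAtlas.mdifferentiableAt (hM : IsDifferentiableAtlas K a M)
    (he : e ∈ atlas (Fin a → K) M) (hz : z ∈ e.source) :
    MDifferentiableAt 𝓘(K, Fin a → K) 𝓘(K, Fin a → K) e z := by
  refine (mdifferentiableAt_iff _ _).2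
    ⟨e.continuousAt hz, DifferentiableAt.differentiableWithinAt ?_⟩
  exact hM _ (chart_mem_atlas _ z) e he _ ⟨mem_chart_target _ z, by simpa using hz⟩

theorem IsDifferentiableAtlas.mdifferentiableAt_symm (hM : IsDifferentiableAtlas K a M)
    (he : e ∈ atlas (Fin a → K) M) {x : Fin a → K} (hx : x ∈ e.target) :
    MDifferentiableAt 𝓘(K, Fin a → K) 𝓘(K, Fin a → K) e.symm x := by
  refine (mdifferentiableAt_iff _ _).2
    ⟨e.continuousAt_symm hx, DifferentiableAt.differentiableWithinAt ?_⟩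
  exact hM e he _ (chart_mem_atlas _ _) x ⟨hx, mem_chart_source _ _⟩

theorem IsCMap.isOpen_chart_domain (hf : IsCMap K a b l f) (e : OpenPartialHomeomorph M (Fin a → K))
    (e' : OpenPartialHomeomorph N (Fin b → K)) :
    IsOpen (e.target ∩ e.symm ⁻¹' (f ⁻¹' e'.source)) :=
  e.symm.isOpen_inter_preimage (e'.open_source.preimage hf.continuous)

theorem IsCMap.mdifferentiableAt (hf : IsCMap K a b l f) (hl : 1 ≤ l) (z : M) :
    MDifferentiableAt 𝓘(K, Fin a → K) 𝓘(K, Fin b → K) f z := by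
  refine (mdifferentiableAt_iff _ _).2
    ⟨hf.continuous.continuousAt, DifferentiableAt.differentiableWithinAt ?_⟩
  refine (hf.isC _ (chart_mem_atlas _ z) _ (chart_mem_atlas _ (f z))).differentiableAt hl
    (hf.isOpen_chart_domain _ _) ⟨mem_chart_target _ z, by simp⟩

theorem finrank_range_comp_comp_le {E₁ E₂ E₃ E₄ : Type*} [AddCommGroup E₁] [Module K E₁]
    [AddCommGroup E₂] [Module K E₂] [AddCommGroup E₃] [Module K E₃] [AddCommGroup E₄] [Module K E₄]
    [FiniteDimensional K E₃] (A : E₃ →ₗ[K] E₄) (B : E₂ →ₗ[K] E₃) (C : E₁ →ₗ[K] E₂) :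
    Module.finrank K (LinearMap.range (A ∘ₗ B ∘ₗ C)) ≤ Module.finrank K (LinearMap.range B) := by
  rw [LinearMap.range_comp]
  exact (Submodule.finrank_map_le _ _).trans
    (Submodule.finrank_mono (LinearMap.range_comp_le_range _ _))

theorem finrank_range_fderiv_le_differential (hM : IsDifferentiableAtlas K a M)
    (hN : IsDifferentiableAtlas K b N) (he : e ∈ atlas (Fin a → K) M)
    (he' : e' ∈ atlas (Fin b → K) N) {x : Fin a → K} (hx : x ∈ e.target)
    (hx' : f (e.symm x) ∈ e'.source)
    (hf : MDifferentiableAt 𝓘(K, Fin a → K) 𝓘(K, Fin b → K) f (e.symm x)) :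
    Module.finrank K (LinearMap.range (fderiv K (e' ∘ f ∘ e.symm) x).toLinearMap) ≤
      Module.finrank K (LinearMap.range (differential K a b f (e.symm x)).toLinearMap) := by
  have hcomp := hf.hasMFDerivAt.comp x (hM.mdifferentiableAt_symm he hx).hasMFDerivAt
  have hderiv := HasMFDerivAt.comp x (hN.mdifferentiableAt he' hx').hasMFDerivAt hcomp
  obtain ⟨A, C, hchain⟩ : ∃ (A : (Fin b → K) →L[K] (Fin b → K)) (C : (Fin a → K) →L[K] (Fin a → K)),
      fderiv K (e' ∘ f ∘ e.symm) x = A ∘L differential K a b f (e.symm x) ∘L C :=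
    ⟨_, _, mfderiv_eq_fderiv.symm.trans hderiv.mfderiv⟩
  rw [hchain]
  exact finrank_range_comp_comp_le _ _ _

theorem criticalSet_eq_univ (f : M → N) (hab : a < b) : criticalSet K a b f = univ := by
  refine eq_univ_of_forall fun z => lt_of_le_of_lt (LinearMap.finrank_range_le _) ?_
  rwa [Module.finrank_fin_fun]

end Charts

section NullCriticalValues

variable {K : Type*} [NontriviallyNormedField K] [CharZero K] [ProperSpace K] [MeasurableSpace K]
  [BorelSpace K] (μ : Measure K) [μ.IsAddHaarMeasure] {p a b l : ℕ}
  {M : Type*} [TopologicalSpace M] [ChartedSpace (Fin a → K) M]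
  {N : Type*} [TopologicalSpace N] [ChartedSpace (Fin b → K) N] {f : M → N}
  {e' : OpenPartialHomeomorph N (Fin b → K)}

theorem IsCMap.exists_mem_nhds_null (hf : IsCMap K a b l f) (hl : a < l)
    (hM : IsDifferentiableAtlas K a M) (hN : IsDifferentiableAtlas K b N)
    (hnat : ∀ c : ℕ, ‖(c : K)‖ ≤ 1) (hp : (p : K) ≠ 0) (hp1 : ‖(p : K)‖ < 1)
    (he' : e' ∈ atlas (Fin b → K) N) {z₀ : M} (hz₀ : f z₀ ∈ e'.source) :
    ∃ U ∈ nhds z₀, ∃ S : Set (Fin b → K), IsCompact S ∧ (Measure.pi fun _ => μ) S = 0 ∧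
      ∀ z ∈ U, z ∈ criticalSet K a b f → f z ∈ e'.source → e' (f z) ∈ S := by
  set e := chartAt (Fin a → K) z₀
  have he : e ∈ atlas (Fin a → K) M := chart_mem_atlas _ z₀
  have hz₀e : z₀ ∈ e.source := mem_chart_source _ z₀
  obtain ⟨ρ, hρ, S, hS, hS₀, hcrit⟩ := (hf.isC e he e' he').exists_null μ hl
    (hf.isOpen_chart_domain e e') hnat hp hp1 (x₀ := e z₀)
    ⟨e.map_source hz₀e, by simpa [e.left_inv hz₀e] using hz₀⟩
  refine ⟨e.source ∩ e ⁻¹' Metric.closedBall (e z₀) ρ, Filter.inter_mem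
    (e.open_source.mem_nhds hz₀e) (e.continuousAt hz₀e (Metric.closedBall_mem_nhds _ hρ)),
    S, hS, hS₀, fun z ⟨hze, hzρ⟩ hz hzf => ?_⟩
  have hrank := finrank_range_fderiv_le_differential hM hN he he' (e.map_source hze)
    (by rwa [e.left_inv hze]) (hf.mdifferentiableAt (by lia) _)
  rw [e.left_inv hze] at hrank
  simpa [e.left_inv hze] using hcrit _ hzρ (hrank.trans_lt hz)

variable [SecondCountableTopology M]

theorem IsCMap.exists_measurableSet_null (hf : IsCMap K a b l f) (hl : a < l)
    (hM : IsDifferentiableAtlas K a M) (hN : IsDifferentiableAtlas K b N)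
    (hnat : ∀ c : ℕ, ‖(c : K)‖ ≤ 1) (hp : (p : K) ≠ 0) (hp1 : ‖(p : K)‖ < 1)
    (he' : e' ∈ atlas (Fin b → K) N) :
    ∃ T : Set (Fin b → K), MeasurableSet T ∧ (Measure.pi fun _ => μ) T = 0 ∧
      ∀ z ∈ criticalSet K a b f, f z ∈ e'.source → e' (f z) ∈ T := by
  choose! U hU S hS hS₀ hcrit using
    fun (z : M) (hz : f z ∈ e'.source) => hf.exists_mem_nhds_null μ hl hM hN hnat hp hp1 he' hz
  obtain ⟨s, hs, hcount, hsU⟩ := TopologicalSpace.countable_cover_nhdsWithin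
    (s := f ⁻¹' e'.source) fun z hz => mem_nhdsWithin_of_mem_nhds (hU z hz)
  refine ⟨⋃ z ∈ s, S z, .biUnion hcount fun z hz => (hS z (hs hz)).measurableSet,
    (measure_biUnion_null_iff hcount).2 fun z hz => hS₀ z (hs hz), fun z hz hzs => ?_⟩
  obtain ⟨y, hy, hzy⟩ := mem_iUnion₂.1 (hsU hzs)
  exact mem_iUnion₂.2 ⟨y, hy, hcrit y (hs hy) z hzy hz hzs⟩

theorem IsCMap.dense_compl_image_criticalSet (hf : IsCMap K a b l f) (hl : a < l)
    (hM : IsDifferentiableAtlas K a M) (hN : IsDifferentiableAtlas K b N)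
    (hnat : ∀ c : ℕ, ‖(c : K)‖ ≤ 1) (hp : (p : K) ≠ 0) (hp1 : ‖(p : K)‖ < 1) :
    Dense (f '' criticalSet K a b f)ᶜ := by
  refine dense_iff_inter_open.2 fun V hV ⟨y, hy⟩ => ?_
  set e := chartAt (Fin b → K) y
  obtain ⟨μ, hμ⟩ : ∃ μ : Measure K, μ.IsAddHaarMeasure := ⟨Measure.addHaar, inferInstance⟩
  obtain ⟨T, -, hT₀, hT⟩ :=
    hf.exists_measurableSet_null μ hl hM hN hnat hp hp1 (chart_mem_atlas _ y)
  by_contra hempty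
  have hsub : e '' (e.source ∩ V) ⊆ T := by
    rintro _ ⟨w, ⟨hw, hwV⟩, rfl⟩
    obtain ⟨z, hz, rfl⟩ : w ∈ f '' criticalSet K a b f := by
      by_contra hwc
      exact hempty ⟨w, hwV, hwc⟩
    exact hT z hz hw
  have hpos : 0 < (Measure.pi fun _ => μ) (e '' (e.source ∩ V)) :=
    (e.isOpen_image_source_inter hV).measure_pos _
      ⟨e y, mem_image_of_mem _ ⟨mem_chart_source _ y, hy⟩⟩
  exact hpos.ne' (measure_mono_null hsub hT₀)

end NullCriticalValues

section InducedMeasureZero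

theorem DisjointRefinement.measurableSet_cell_inter_preimage {K : Type*} [NontriviallyNormedField K]
    [SecondCountableTopology K] [MeasurableSpace K] [BorelSpace K] {b : ℕ} {N : Type*}
    [TopologicalSpace N] [ChartedSpace (Fin b → K) N] [MeasurableSpace N] [BorelSpace N] {ι : Type*}
    (D : DisjointRefinement K b N ι) (i : ι) {T : Set (Fin b → K)} (hT : MeasurableSet T) :
    MeasurableSet (D.cell i ∩ D.chart i ⁻¹' T) := by
  have hc : Continuous ((D.cell i).domRestrict (D.chart i)) :=
    continuousOn_iff_continuous_domRestrict.1 ((D.chart i).continuousOn.mono (D.cell_subset i))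
  have h := (D.isClopen_cell i).isOpen.measurableSet.subtype_image (hc.measurable hT)
  rwa [domRestrict_eq, preimage_comp, Subtype.image_preimage_coe] at h

theorem norm_natCast_le_one (p : ℕ) [Fact p.Prime] (K : Type*) [NontriviallyNormedField K]
    [NormedAlgebra ℚ_[p] K] (c : ℕ) : ‖(c : K)‖ ≤ 1 := by
  rw [← map_natCast (algebraMap ℚ_[p] K), norm_algebraMap']
  exact_mod_cast Padic.norm_int_le_one (p := p) c

theorem norm_natCast_self_lt_one (p : ℕ) [Fact p.Prime] (K : Type*) [NontriviallyNormedField K]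
    [NormedAlgebra ℚ_[p] K] : ‖(p : K)‖ < 1 := by
  rw [← map_natCast (algebraMap ℚ_[p] K), norm_algebraMap']
  exact Padic.norm_p_lt_one

variable {p : ℕ} [Fact p.Prime] {K : Type*} [NontriviallyNormedField K] [NormedAlgebra ℚ_[p] K]
  [FiniteDimensional ℚ_[p] K] [MeasurableSpace K] [BorelSpace K]
  {b : ℕ} {N : Type*} [TopologicalSpace N] [ChartedSpace (Fin b → K) N] [MeasurableSpace N]
  [BorelSpace N] {ι : Type*}

theorem inducedMeasure_cell_inter_preimage_eq_zero (D : DisjointRefinement K b N ι) (i : ι)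
    {T : Set (Fin b → K)} (hT : MeasurableSet T) (hT₀ : haar p K b T = 0) :
    inducedMeasure p D (D.cell i ∩ D.chart i ⁻¹' T) = 0 := by
  have : ProperSpace K := FiniteDimensional.proper ℚ_[p] K
  have hm := D.measurableSet_cell_inter_preimage i hT
  rw [inducedMeasure, Measure.sum_apply _ hm, ENNReal.tsum_eq_zero]
  intro k
  have hopen : IsOpen (D.chart k '' D.cell k) := by
    rw [← inter_eq_right.2 (D.cell_subset k)]
    exact (D.chart k).isOpen_image_source_inter (D.isClopen_cell k).isOpen
  by_cases hae : AEMeasurable (D.chart k).symm ((haar p K b).restrict (D.chart k '' D.cell k))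
  · rw [Measure.map_apply_of_aemeasurable hae hm, Measure.restrict_apply' hopen.measurableSet]
    refine measure_mono_null ?_ hT₀
    rintro _ ⟨⟨hy, hyT⟩, w, hw, rfl⟩
    rw [(D.chart k).left_inv (D.cell_subset k hw)] at hy
    rw [mem_preimage, (D.chart k).left_inv (D.cell_subset k hw)] at hyT
    rcases eq_or_ne k i with rfl | hki
    · exact hyT
    · exact absurd hy (disjoint_left.1 (D.disjoint hki) hw)
  · rw [Measure.map_of_not_aemeasurable hae, Measure.coe_zero, Pi.zero_apply]

theorem IsCMap.inducedMeasure_image_criticalSet {a l : ℕ} {M : Type*} [TopologicalSpace M]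
    [SecondCountableTopology M] [ChartedSpace (Fin a → K) M] {f : M → N}
    (hf : IsCMap K a b l f) (hl : a < l) (hM : IsDifferentiableAtlas K a M)
    (hN : IsDifferentiableAtlas K b N) (D : DisjointRefinement K b N ι) :
    inducedMeasure p D (f '' criticalSet K a b f) = 0 := by
  have : ProperSpace K := FiniteDimensional.proper ℚ_[p] K
  have : CharZero K := charZero_of_injective_algebraMap (algebraMap ℚ_[p] K).injective
  have : (haar p K b).IsAddHaarMeasure := by unfold haar; infer_instance
  have hac : haar p K b ≪ Measure.pi fun _ : Fin b => (Measure.addHaar : Measure K) :=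
    Measure.absolutelyContinuous_isAddHaarMeasure _ _
  choose T hT hT₀ hcrit using fun i => hf.exists_measurableSet_null Measure.addHaar hl hM hN
    (norm_natCast_le_one p K) (Nat.cast_ne_zero.2 (Fact.out : p.Prime).ne_zero)
    (norm_natCast_self_lt_one p K) (D.chart_mem i)
  have hcount : {i | (f ⁻¹' D.cell i).Nonempty}.Countable :=
    PairwiseDisjoint.countable_of_isOpen (s := fun i => f ⁻¹' D.cell i)
      (fun i _ k _ hik => (D.disjoint hik).preimage f)
      (fun i _ => (D.isClopen_cell i).isOpen.preimage hf.continuous) fun i hi => hi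
  refine measure_mono_null ?_ ((measure_biUnion_null_iff hcount).2 fun i _ =>
    inducedMeasure_cell_inter_preimage_eq_zero D i (hT i) (hac (hT₀ i)))
  rintro _ ⟨z, hz, rfl⟩
  obtain ⟨i, hi⟩ := mem_iUnion.1 (D.iUnion_cell ▸ mem_univ (f z))
  exact mem_iUnion₂.2 ⟨i, ⟨z, hi⟩, hi, hcrit i z hz (D.cell_subset i hi)⟩

end InducedMeasureZero

end NASard

end

theorem theorem3p19_general (p : ℕ) [Fact p.Prime]
    {K : Type*} [NontriviallyNormedField K] [NormedAlgebra ℚ_[p] K] [FiniteDimensional ℚ_[p] K]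
    [MeasurableSpace K] [BorelSpace K] {a b l : ℕ} (hl : a < l)
    {M : Type*} [TopologicalSpace M] [SecondCountableTopology M] [ChartedSpace (Fin a → K) M]
    (hM : NASard.IsDifferentiableAtlas K a M)
    {N : Type*} [TopologicalSpace N] [ChartedSpace (Fin b → K) N]
    [MeasurableSpace N] [BorelSpace N]
    (hN : NASard.IsDifferentiableAtlas K b N)
    {f : M → N} (hf : NASard.IsCMap K a b l f) :
    (∀ (ι : Type*) (D : NASard.DisjointRefinement K b N ι),
      NASard.inducedMeasure p D (f '' NASard.criticalSet K a b f) = 0) ∧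
    Dense (f '' NASard.criticalSet K a b f)ᶜ ∧
    (a < b → ∀ (ι : Type*) (D : NASard.DisjointRefinement K b N ι),
      NASard.inducedMeasure p D (range f) = 0) := by
  have : ProperSpace K := FiniteDimensional.proper ℚ_[p] K
  have : CharZero K := charZero_of_injective_algebraMap (algebraMap ℚ_[p] K).injective
  refine ⟨fun _ D => hf.inducedMeasure_image_criticalSet hl hM hN D,
    hf.dense_compl_image_criticalSet hl hM hN (NASard.norm_natCast_le_one p K)
      (Nat.cast_ne_zero.2 (Fact.out : p.Prime).ne_zero) (NASard.norm_natCast_self_lt_one p K),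
    fun hab _ D => ?_⟩
  rw [← image_univ, ← NASard.criticalSet_eq_univ (K := K) f hab]
  exact hf.inducedMeasure_image_criticalSet hl hM hN D

theorem theorem3p19 (p : ℕ) [Fact p.Prime]
    {K : Type*} [NontriviallyNormedField K] [NormedAlgebra ℚ_[p] K] [FiniteDimensional ℚ_[p] K]
    [MeasurableSpace K] [BorelSpace K]
    (A : NASard.ApproxSystem K) (q n : ℕ) (hn : 1 ≤ n) (a b l : ℕ) (hl : max a b < l)
    {M : Type*} [TopologicalSpace M] [SecondCountableTopology M] [ChartedSpace (Fin a → K) M]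
    (hM : NASard.IsSCManifold A q n a M)
    {N : Type*} [TopologicalSpace N] [ChartedSpace (Fin b → K) N]
    [MeasurableSpace N] [BorelSpace N]
    (hN : NASard.IsSCManifold A q n b N)
    (f : M → N) (hf : NASard.IsCMap K a b l f) :
    (∀ (ι : Type*) (D : NASard.DisjointRefinement K b N ι),
      NASard.inducedMeasure p D (f '' NASard.criticalSet K a b f) = 0) ∧
    Dense (f '' NASard.criticalSet K a b f)ᶜ ∧
    (a < b → ∀ (ι : Type*) (D : NASard.DisjointRefinement K b N ι),
      NASard.inducedMeasure p D (range f) = 0) := by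
  exact theorem3p19_general p ((le_max_left a b).trans_lt hl) hM.isDifferentiableAtlas
    hN.isDifferentiableAtlas hf
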